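/- Write $r=|x|$, $\square=\partial_t^2-\partial_1^2-\partial_2^2-\partial_3^2$ and $u'=(\partial_t u,\partial_1u,\partial_2u,\partial_3u)$ on $[0,\infty)\times\mathbb R^3$. Let $\{Z\}$ be the seven vector fields $\partial_t$, $\partial_1,\partial_2,\partial_3$, and $x_i\partial_j-x_j\partial_i$ ($1\le i<j\le 3$). For a finite word $\alpha=(\alpha_1,\dots,\alpha_n)$ in these fields put $|\alpha|=n$ and $Z^\alpha=Z_{\alpha_1}\cdots Z_{\alpha_n}$. Let $E$ be a finite-dimensional real inner product space ($E=\mathbb R$ for a scalar equation, $E=\mathbb R^m$ for a system). **Theorem 2.3.** For every $N=0,1,2,\dots$ there is a constant $C<\infty$, depending only on $N$ and $E$, such that the following holds. Let $v:[0,\infty)\times\mathbb R^3\to E$ be of class $C^{N+2}$ up to the boundary $t=0$, and let $\square v=G$ in $[0,\infty)\times\mathbb R^3$. Then for every $t\ge 0$ $$\sum_{|\alpha|\le N}\Big(\|Z^\alpha v'(t,\cdot)\|_{L^2(\mathbb R^3)}+(\ln(2+t))^{-1/2}\,\big\|(1+r)^{-1/2}Z^\alpha v'\big\|_{L^2([0,t]\times\mathbb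 R^3)}\Big)$$ $$\le C\sum_{|\alpha|\le N}\|(Z^\alpha v)'(0,\cdot)\|_{L^2(\mathbb R^3)}+C\sum_{|\alpha|\le N}\int_0^t\|Z^\alpha G(s,\cdot)\|_{L^2(\mathbb R^3)}\,ds .$$ All norms take values in $[0,\infty]$; in particular, if the right-hand side is finite, then so is the left-hand side. -/

import Mathlib

open scoped NNReal ENNReal

noncomputable section

namespace KSSWave

/-- Three-dimensional Euclidean space. -/
abbrev Space : Type := EuclideanSpace ℝ (Fin 3)

/-- Points `(t, x)` of Minkowski space; only the half `t ≥ 0` carries the solutions. -/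
abbrev Spacetime : Type := ℝ × Space

/-- The closed half space `[0, ∞) × ℝ³`. -/
def halfSpace : Set Spacetime := Set.Ici (0 : ℝ) ×ˢ (Set.univ : Set Space)

/-- The unit vector of space in the coordinate direction `i`. -/
def basisVec (i : Fin 3) : Space := EuclideanSpace.single i (1 : ℝ)

/-- The coordinate directions of spacetime: index `0` is the time direction, index `i + 1` is the
spatial direction `i`. -/
def dir : Fin 4 → Spacetime :=
  Fin.cases ((1 : ℝ), (0 : Space)) (fun i : Fin 3 => ((0 : ℝ), basisVec i))

/-- The names of the vector fields `Z`: time translation, the three space translations, and the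
three rotations, named by the pairs `i < j`. -/
abbrev FieldIndex : Type := Unit ⊕ Fin 3 ⊕ {p : Fin 3 × Fin 3 // p.1 < p.2}

/-- The vector fields `∂_t`, `∂_i` and `x_i ∂_j - x_j ∂_i`, as maps from points to vectors. -/
def vectorField : FieldIndex → Spacetime → Spacetime
  | Sum.inl _, _ => ((1 : ℝ), (0 : Space))
  | Sum.inr (Sum.inl i), _ => ((0 : ℝ), basisVec i)
  | Sum.inr (Sum.inr q), p =>
      ((0 : ℝ), p.2 q.1.1 • basisVec q.1.2 - p.2 q.1.2 • basisVec q.1.1)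

section Operators

variable {F : Type*} [NormedAddCommGroup F] [NormedSpace ℝ F]

/-- The partial derivative `∂_μ u` on the half space (one-sided in time at `t = 0`). -/
def partialDeriv (μ : Fin 4) (u : Spacetime → F) : Spacetime → F :=
  fun p => fderivWithin ℝ u halfSpace p (dir μ)

/-- The derivative `Z u` of `u` along one of the vector fields. -/
def fieldDeriv (k : FieldIndex) (u : Spacetime → F) : Spacetime → F :=
  fun p => fderivWithin ℝ u halfSpace p (vectorField k p)

/-- `Z^α u = Z_{α₁} (Z_{α₂} (⋯ (Z_{αₙ} u)))` for a word `α = [α₁, …, αₙ]`. -/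
def wordDeriv (α : List FieldIndex) (u : Spacetime → F) : Spacetime → F :=
  α.foldr fieldDeriv u

/-- The full space-time gradient `u' = (∂_t u, ∂_1 u, ∂_2 u, ∂_3 u)`, whose values carry the
Euclidean norm `|u'|² = |∂_t u|² + |∂_1 u|² + |∂_2 u|² + |∂_3 u|²`. -/
def gradient (u : Spacetime → F) : Spacetime → PiLp 2 (fun _ : Fin 4 => F) :=
  fun p => WithLp.toLp 2 (fun μ => partialDeriv μ u p)

/-- The d'Alembertian `□ = ∂_t² - ∂_1² - ∂_2² - ∂_3²`. -/
def box (u : Spacetime → F) : Spacetime → F :=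
  fun p => partialDeriv 0 (partialDeriv 0 u) p
    - ∑ i : Fin 3, partialDeriv i.succ (partialDeriv i.succ u) p

/-- The norm `‖u(t, ·)‖_{L²(ℝ³)}`, with values in `[0, ∞]`. -/
def sliceNorm (u : Spacetime → F) (t : ℝ) : ℝ≥0∞ :=
  MeasureTheory.eLpNorm (fun x : Space => u (t, x)) 2 MeasureTheory.volume

/-- The norm `‖(1 + r)^{-1/2} u‖_{L²([0, t] × ℝ³)}`, `r = |x|`, with values in `[0, ∞]`. -/
def weightedNorm (u : Spacetime → F) (t : ℝ) : ℝ≥0∞ :=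
  MeasureTheory.eLpNorm (fun p : Spacetime => (1 + ‖p.2‖) ^ (-(1 / 2) : ℝ) • u p) 2
    (MeasureTheory.volume.restrict (Set.Icc (0 : ℝ) t ×ˢ (Set.univ : Set Space)))

end Operators

/-- The sum over all words `α` of length `|α| ≤ N` in the vector fields `Z`. -/
def sumWords (N : ℕ) (f : List FieldIndex → ℝ≥0∞) : ℝ≥0∞ :=
  ∑ n ∈ Finset.range (N + 1), ∑ α : Fin n → FieldIndex, f (List.ofFn α)

end KSSWave

end

/-! The commutators of the fields Z with the translations are combinations of translations with
constant coefficients. These coefficients are antisymmetric in the spatial indices and vanish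
against a symmetric Hessian, so Z commutes with □ (`box_wordDeriv`). They also bound |Z^α v'|
pointwise by a finite sum of |(Z^β v)'| with |β| ≤ N (`exists_enorm_wordDeriv_gradient_le`). It
therefore suffices to treat N = 0 for C² solutions and to apply that case to each Z^β v. Pairing
with an orthonormal basis of E makes the equation scalar.

For scalar u let a be the initial norm of u' and γ the time integral of ‖G‖. The energy inequality
gives ‖u'(s)‖ ≤ M = a + 2γ (`sliceNorm_gradient_le`). For the weighted norm put g_R = (R² +
r²)^{-1/2}. The multiplier g_R (x·∇u + u) controls ∬ R² g_R³ |u'|² by a multiple of M², uniformly in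
R ≥ 1 (`slabIntegral_morawetz_le`). This is integrated against dR/R over [1, ρ] with ρ = 2 + t.
Since ∫ R g_R³ dR = g_1 - g_ρ, the result is the weight (1 + r)^{-1} up to O(1/ρ), at the price of a
factor ln ρ. The O(1/ρ) remainder costs only the energy, because t ≤ ρ (`lintegral_weight_le`).

No decay of u is assumed, so every identity is localized by a C¹ cutoff with bounded spatial
support. In the energy estimate the cutoff decreases along outgoing cones, and its derivative has a
good sign. In the Morawetz estimate a cutoff at radius ρ produces errors of size 1/ρ times |u'|² +
(1 + r²)^{-1} u², which are harmless over a time t ≤ ρ. The zero-order term is handled by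
`hardy_inequality`. That lemma needs u in L² of a ball with the right scaling, which holds only
after subtracting a constant. The constant comes from a Poincaré inequality at time 0
(`exists_lintegral_slice_sub_le`), and neither u' nor □u sees it. -/

open MeasureTheory Set

noncomputable section

namespace KSSWave

/-! ### One-sided calculus on the closed half space, and the commutators of Z with ∂ and □. -/

section Calculus

variable {F : Type*} [NormedAddCommGroup F] [NormedSpace ℝ F]

lemma uniqueDiffOn_halfSpace : UniqueDiffOn ℝ halfSpace :=
  (uniqueDiffOn_Ici 0).prod uniqueDiffOn_univ

lemma mem_halfSpace {p : Spacetime} : p ∈ halfSpace ↔ 0 ≤ p.1 := by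
  simp [halfSpace]

lemma mk_mem_halfSpace {s : ℝ} (hs : 0 ≤ s) (x : Space) : ((s, x) : Spacetime) ∈ halfSpace :=
  mem_halfSpace.2 hs

lemma halfSpace_mem_nhds {p : Spacetime} (hp : 0 < p.1) : halfSpace ∈ nhds p := by
  have : IsOpen {q : Spacetime | 0 < q.1} := isOpen_lt continuous_const continuous_fst
  exact Filter.mem_of_superset (this.mem_nhds hp) fun q hq => mem_halfSpace.2 (le_of_lt hq)

/-- This is what gives symmetry of second derivatives at boundary points t = 0. -/
lemma halfSpace_subset_closure_interior : halfSpace ⊆ closure (interior halfSpace) := by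
  rw [halfSpace, interior_prod_eq, closure_prod_eq, interior_univ, closure_univ, interior_Ici,
    closure_Ioi]

/-- The spatial coordinates as functions on spacetime. -/
def coord (i : Fin 3) (p : Spacetime) : ℝ := p.2 i

/-- The spatial coordinates as continuous linear forms on spacetime. -/
def coordL (i : Fin 3) : Spacetime →L[ℝ] ℝ :=
  (EuclideanSpace.proj i : Space →L[ℝ] ℝ).comp (ContinuousLinearMap.snd ℝ ℝ Space)

lemma coord_eq_coordL (i : Fin 3) : coord i = coordL i := rfl

lemma contDiff_coord (i : Fin 3) {n : WithTop ℕ∞} : ContDiff ℝ n (coord i) := by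
  rw [coord_eq_coordL]; exact (coordL i).contDiff

lemma partialDeriv_congr {u w : Spacetime → F} (h : EqOn u w halfSpace) (μ : Fin 4) :
    EqOn (partialDeriv μ u) (partialDeriv μ w) halfSpace := fun p hp => by
  simp only [partialDeriv]; rw [fderivWithin_congr h (h hp)]

lemma fieldDeriv_congr {u w : Spacetime → F} (h : EqOn u w halfSpace) (k : FieldIndex) :
    EqOn (fieldDeriv k u) (fieldDeriv k w) halfSpace := fun p hp => by
  simp only [fieldDeriv]; rw [fderivWithin_congr h (h hp)]

lemma wordDeriv_cons (k : FieldIndex) (α : List FieldIndex) (u : Spacetime → F) :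
    wordDeriv (k :: α) u = fieldDeriv k (wordDeriv α u) := rfl

lemma wordDeriv_append_singleton (α : List FieldIndex) (k : FieldIndex) (u : Spacetime → F) :
    wordDeriv (α ++ [k]) u = wordDeriv α (fieldDeriv k u) := by
  simp [wordDeriv]

lemma wordDeriv_congr {u w : Spacetime → F} (h : EqOn u w halfSpace) (α : List FieldIndex) :
    EqOn (wordDeriv α u) (wordDeriv α w) halfSpace := by
  induction α with
  | nil => exact h
  | cons k α ih => exact fieldDeriv_congr ih k

lemma differentiableWithinAt_of_contDiffOn {n : ℕ} {u : Spacetime → F}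
    (h : ContDiffOn ℝ (n + 1 : ℕ) u halfSpace) {p : Spacetime} (hp : p ∈ halfSpace) :
    DifferentiableWithinAt ℝ u halfSpace p :=
  (h.differentiableOn (by norm_cast)) p hp

lemma contDiffOn_fderivWithin_halfSpace {n : ℕ} {u : Spacetime → F}
    (h : ContDiffOn ℝ (n + 1 : ℕ) u halfSpace) :
    ContDiffOn ℝ n (fderivWithin ℝ u halfSpace) halfSpace :=
  h.fderivWithin uniqueDiffOn_halfSpace (by norm_cast)

lemma contDiffOn_partialDeriv {n : ℕ} {u : Spacetime → F}
    (h : ContDiffOn ℝ (n + 1 : ℕ) u halfSpace) (μ : Fin 4) :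
    ContDiffOn ℝ n (partialDeriv μ u) halfSpace :=
  (contDiffOn_fderivWithin_halfSpace h).clm_apply contDiffOn_const

lemma contDiff_vectorField (k : FieldIndex) {n : WithTop ℕ∞} : ContDiff ℝ n (vectorField k) := by
  rcases k with _ | i | q
  · exact contDiff_const
  · exact contDiff_const
  · refine contDiff_const.prodMk (ContDiff.sub ?_ ?_)
    · exact (contDiff_coord q.1.1).smul contDiff_const
    · exact (contDiff_coord q.1.2).smul contDiff_const

lemma contDiffOn_fieldDeriv {n : ℕ} {u : Spacetime → F}
    (h : ContDiffOn ℝ (n + 1 : ℕ) u halfSpace) (k : FieldIndex) :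
    ContDiffOn ℝ n (fieldDeriv k u) halfSpace :=
  (contDiffOn_fderivWithin_halfSpace h).clm_apply (contDiff_vectorField k).contDiffOn

lemma contDiffOn_wordDeriv (α : List FieldIndex) {n : ℕ} {u : Spacetime → F}
    (h : ContDiffOn ℝ (n + α.length : ℕ) u halfSpace) :
    ContDiffOn ℝ n (wordDeriv α u) halfSpace := by
  induction α generalizing n with
  | nil => exact h
  | cons k α ih =>
    refine contDiffOn_fieldDeriv (ih (n := n + 1) (h.of_le ?_)) k
    simp only [List.length_cons]; norm_cast; omega

lemma partialDeriv_add {u w : Spacetime → F} {p : Spacetime} (hp : p ∈ halfSpace)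
    (hu : DifferentiableWithinAt ℝ u halfSpace p) (hw : DifferentiableWithinAt ℝ w halfSpace p)
    (μ : Fin 4) :
    partialDeriv μ (fun q => u q + w q) p = partialDeriv μ u p + partialDeriv μ w p := by
  simp only [partialDeriv]
  rw [fderivWithin_fun_add (uniqueDiffOn_halfSpace p hp) hu hw]; rfl

lemma partialDeriv_sub {u w : Spacetime → F} {p : Spacetime} (hp : p ∈ halfSpace)
    (hu : DifferentiableWithinAt ℝ u halfSpace p) (hw : DifferentiableWithinAt ℝ w halfSpace p)
    (μ : Fin 4) :
    partialDeriv μ (fun q => u q - w q) p = partialDeriv μ u p - partialDeriv μ w p := by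
  simp only [partialDeriv]
  rw [fderivWithin_fun_sub (uniqueDiffOn_halfSpace p hp) hu hw]; rfl

lemma partialDeriv_sum {ι : Type*} (s : Finset ι) {u : ι → Spacetime → F} {p : Spacetime}
    (hp : p ∈ halfSpace) (hu : ∀ i ∈ s, DifferentiableWithinAt ℝ (u i) halfSpace p)
    (μ : Fin 4) :
    partialDeriv μ (fun q => ∑ i ∈ s, u i q) p = ∑ i ∈ s, partialDeriv μ (u i) p := by
  simp only [partialDeriv]
  rw [fderivWithin_fun_sum (uniqueDiffOn_halfSpace p hp) hu]; simp

lemma partialDeriv_smul {a : Spacetime → ℝ} {u : Spacetime → F} {p : Spacetime}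
    (hp : p ∈ halfSpace)
    (ha : DifferentiableWithinAt ℝ a halfSpace p) (hu : DifferentiableWithinAt ℝ u halfSpace p)
    (μ : Fin 4) :
    partialDeriv μ (fun q => a q • u q) p
      = a p • partialDeriv μ u p + partialDeriv μ a p • u p := by
  simp only [partialDeriv]
  rw [fderivWithin_fun_smul (uniqueDiffOn_halfSpace p hp) ha hu]; rfl

lemma partialDeriv_mul {a u : Spacetime → ℝ} {p : Spacetime}
    (hp : p ∈ halfSpace)
    (ha : DifferentiableWithinAt ℝ a halfSpace p) (hu : DifferentiableWithinAt ℝ u halfSpace p)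
    (μ : Fin 4) :
    partialDeriv μ (fun q => a q * u q) p
      = a p * partialDeriv μ u p + partialDeriv μ a p * u p :=
  partialDeriv_smul hp ha hu μ

lemma partialDeriv_coord (i : Fin 3) {p : Spacetime} (hp : p ∈ halfSpace) (μ : Fin 4) :
    partialDeriv μ (coord i) p = if μ = i.succ then 1 else 0 := by
  simp only [partialDeriv, coord_eq_coordL]
  rw [(coordL i).fderivWithin (uniqueDiffOn_halfSpace p hp)]
  refine Fin.cases ?_ (fun j => ?_) μ
  · simp [dir, coordL, (Fin.succ_ne_zero i).symm]
  · simp [dir, coordL, basisVec, eq_comm]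

/-- Up to the boundary, the second derivative within the half space is symmetric because each point
is a limit of interior points. -/
lemma partialDeriv_comm {u : Spacetime → F} (h : ContDiffOn ℝ 2 u halfSpace) (μ ν : Fin 4) :
    EqOn (partialDeriv μ (partialDeriv ν u)) (partialDeriv ν (partialDeriv μ u)) halfSpace := by
  intro p hp
  have h1 : DifferentiableWithinAt ℝ (fderivWithin ℝ u halfSpace) halfSpace p :=
    differentiableWithinAt_of_contDiffOn (n := 0)
      (contDiffOn_fderivWithin_halfSpace (n := 1) h) hp
  have key : ∀ μ ν : Fin 4, partialDeriv μ (partialDeriv ν u) p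
      = fderivWithin ℝ (fderivWithin ℝ u halfSpace) halfSpace p (dir μ) (dir ν) := by
    intro μ ν
    unfold partialDeriv
    rw [fderivWithin_clm_apply (uniqueDiffOn_halfSpace p hp) h1 (differentiableWithinAt_const _)]
    simp
  rw [key, key]
  exact ((h p hp).isSymmSndFDerivWithinAt (by simp) uniqueDiffOn_halfSpace
    (halfSpace_subset_closure_interior hp) hp) _ _

/-- The coefficients of the commutators `[Z_k, ∂_μ]` in terms of the translations. -/
def commCoeff : FieldIndex → Fin 4 → Fin 4 → ℝ
  | Sum.inr (Sum.inr q), μ, ν =>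
      (if μ = q.1.2.succ then if ν = q.1.1.succ then 1 else 0 else 0)
        - (if μ = q.1.1.succ then if ν = q.1.2.succ then 1 else 0 else 0)
  | _, _, _ => 0

lemma fieldDeriv_rotation (q : {p : Fin 3 × Fin 3 // p.1 < p.2}) (u : Spacetime → F) :
    fieldDeriv (Sum.inr (Sum.inr q)) u
      = fun p => coord q.1.1 p • partialDeriv q.1.2.succ u p
          - coord q.1.2 p • partialDeriv q.1.1.succ u p := by
  funext p
  simp only [fieldDeriv, partialDeriv, vectorField, dir, coord, Fin.cases_succ]
  rw [← map_smul, ← map_smul, ← map_sub]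
  congr 1
  ext <;> simp

/-- The commutator of a field `Z_k` with a translation. -/
lemma fieldDeriv_partialDeriv {u : Spacetime → F} (h : ContDiffOn ℝ 2 u halfSpace)
    (k : FieldIndex) (μ : Fin 4) :
    EqOn (fieldDeriv k (partialDeriv μ u))
      (fun p => partialDeriv μ (fieldDeriv k u) p
        + ∑ ν, commCoeff k μ ν • partialDeriv ν u p) halfSpace := by
  intro p hp
  rcases k with _ | i | q
  · simp only [commCoeff, zero_smul, Finset.sum_const_zero, add_zero]
    exact partialDeriv_comm h 0 μ hp
  · simp only [commCoeff, zero_smul, Finset.sum_const_zero, add_zero]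
    exact partialDeriv_comm h i.succ μ hp
  · have hd : ∀ ν, DifferentiableWithinAt ℝ (partialDeriv ν u) halfSpace p := fun ν =>
      differentiableWithinAt_of_contDiffOn (n := 0) (contDiffOn_partialDeriv (n := 1) h ν) hp
    have hc : ∀ i, DifferentiableWithinAt ℝ (coord i) halfSpace p := fun i =>
      ((contDiff_coord i (n := 1)).differentiable (by norm_num) p).differentiableWithinAt
    rw [fieldDeriv_rotation, fieldDeriv_rotation]
    simp only
    rw [partialDeriv_sub hp ((hc _).fun_smul (hd _)) ((hc _).fun_smul (hd _)),
      partialDeriv_smul hp (hc _) (hd _), partialDeriv_smul hp (hc _) (hd _),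
      partialDeriv_coord _ hp, partialDeriv_coord _ hp, partialDeriv_comm h μ _ hp,
      partialDeriv_comm h μ _ hp]
    have : ∑ ν, commCoeff (Sum.inr (Sum.inr q)) μ ν • partialDeriv ν u p
        = (if μ = q.1.2.succ then (1 : ℝ) else 0) • partialDeriv q.1.1.succ u p
          - (if μ = q.1.1.succ then (1 : ℝ) else 0) • partialDeriv q.1.2.succ u p := by
      simp only [commCoeff, sub_smul, Finset.sum_sub_distrib]
      congr 1
      · split_ifs <;> simp
      · split_ifs <;> simp
    rw [this]
    abel

/-- Rotations generate orthogonal transformations, so their matrices are antisymmetric. The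
invariance of the Laplacian rests on this alone. -/
lemma commCoeff_succ (k : FieldIndex) (i j : Fin 3) :
    commCoeff k i.succ j.succ = - commCoeff k j.succ i.succ := by
  rcases k with _ | a | q
  · simp [commCoeff]
  · simp [commCoeff]
  · simp only [commCoeff, Fin.succ_inj]
    split_ifs <;> simp_all

lemma commCoeff_zero_right (k : FieldIndex) (μ : Fin 4) : commCoeff k μ 0 = 0 := by
  rcases k with _ | a | q <;> simp [commCoeff, (Fin.succ_ne_zero _).symm]

lemma commCoeff_zero_left (k : FieldIndex) (ν : Fin 4) : commCoeff k 0 ν = 0 := by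
  rcases k with _ | a | q <;> simp [commCoeff, (Fin.succ_ne_zero _).symm]

lemma abs_commCoeff_le (k : FieldIndex) (μ ν : Fin 4) : |commCoeff k μ ν| ≤ 1 := by
  rcases k with _ | a | q
  · simp [commCoeff]
  · simp [commCoeff]
  · simp only [commCoeff]
    have := q.2.ne
    split_ifs <;> simp_all

lemma fieldDeriv_add {u w : Spacetime → F} {p : Spacetime} (hp : p ∈ halfSpace)
    (hu : DifferentiableWithinAt ℝ u halfSpace p) (hw : DifferentiableWithinAt ℝ w halfSpace p)
    (k : FieldIndex) :
    fieldDeriv k (fun q => u q + w q) p = fieldDeriv k u p + fieldDeriv k w p := by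
  simp only [fieldDeriv]
  rw [fderivWithin_fun_add (uniqueDiffOn_halfSpace p hp) hu hw]; rfl

lemma fieldDeriv_sub {u w : Spacetime → F} {p : Spacetime} (hp : p ∈ halfSpace)
    (hu : DifferentiableWithinAt ℝ u halfSpace p) (hw : DifferentiableWithinAt ℝ w halfSpace p)
    (k : FieldIndex) :
    fieldDeriv k (fun q => u q - w q) p = fieldDeriv k u p - fieldDeriv k w p := by
  simp only [fieldDeriv]
  rw [fderivWithin_fun_sub (uniqueDiffOn_halfSpace p hp) hu hw]; rfl

lemma fieldDeriv_sum {ι : Type*} (s : Finset ι) {u : ι → Spacetime → F} {p : Spacetime}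
    (hp : p ∈ halfSpace) (hu : ∀ i ∈ s, DifferentiableWithinAt ℝ (u i) halfSpace p)
    (k : FieldIndex) :
    fieldDeriv k (fun q => ∑ i ∈ s, u i q) p = ∑ i ∈ s, fieldDeriv k (u i) p := by
  simp only [fieldDeriv]
  rw [fderivWithin_fun_sum (uniqueDiffOn_halfSpace p hp) hu]; simp

lemma fieldDeriv_const_smul (c : ℝ) {u : Spacetime → F} {p : Spacetime} (hp : p ∈ halfSpace)
    (hu : DifferentiableWithinAt ℝ u halfSpace p) (k : FieldIndex) :
    fieldDeriv k (fun q => c • u q) p = c • fieldDeriv k u p := by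
  simp only [fieldDeriv]
  rw [fderivWithin_fun_const_smul (uniqueDiffOn_halfSpace p hp) hu]; rfl

lemma partialDeriv_const_smul (c : ℝ) {u : Spacetime → F} {p : Spacetime} (hp : p ∈ halfSpace)
    (hu : DifferentiableWithinAt ℝ u halfSpace p) (μ : Fin 4) :
    partialDeriv μ (fun q => c • u q) p = c • partialDeriv μ u p := by
  simp only [partialDeriv]
  rw [fderivWithin_fun_const_smul (uniqueDiffOn_halfSpace p hp) hu]; rfl

/-- The commutator with ∂_μ is used twice; its coefficients are constant, so both uses give the same
Hessian term, hence the factor 2. -/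
lemma partialDeriv_partialDeriv_fieldDeriv {u : Spacetime → F} (h : ContDiffOn ℝ 3 u halfSpace)
    (k : FieldIndex) (μ : Fin 4) :
    EqOn (partialDeriv μ (partialDeriv μ (fieldDeriv k u)))
      (fun p => fieldDeriv k (partialDeriv μ (partialDeriv μ u)) p
        - (2 : ℝ) • ∑ ν, commCoeff k μ ν • partialDeriv ν (partialDeriv μ u) p) halfSpace := by
  intro p hp
  have h2 : ContDiffOn ℝ 2 u halfSpace := h.of_le (by norm_num)
  have hd : ∀ ν, ContDiffOn ℝ 2 (partialDeriv ν u) halfSpace := fun ν =>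
    contDiffOn_partialDeriv (n := 2) h ν
  have e1 : EqOn (partialDeriv μ (fieldDeriv k u))
      (fun p => fieldDeriv k (partialDeriv μ u) p
        - ∑ ν, commCoeff k μ ν • partialDeriv ν u p) halfSpace := by
    intro q hq
    simp [fieldDeriv_partialDeriv h2 k μ hq]
  have hdd : ∀ ν, DifferentiableWithinAt ℝ (partialDeriv ν u) halfSpace p := fun ν =>
    differentiableWithinAt_of_contDiffOn (n := 1) (hd ν) hp
  have hs : ∀ ν ∈ Finset.univ, DifferentiableWithinAt ℝ
      (fun q => commCoeff k μ ν • partialDeriv ν u q) halfSpace p := fun ν _ =>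
    (hdd ν).const_smul _
  have e2 := fieldDeriv_partialDeriv (hd μ) k μ hp
  have e3 : ∑ ν, commCoeff k μ ν • partialDeriv μ (partialDeriv ν u) p
      = ∑ ν, commCoeff k μ ν • partialDeriv ν (partialDeriv μ u) p :=
    Finset.sum_congr rfl fun ν _ => by rw [partialDeriv_comm h2 μ ν hp]
  rw [partialDeriv_congr e1 μ hp, partialDeriv_sub hp
    (differentiableWithinAt_of_contDiffOn (n := 0) (contDiffOn_fieldDeriv (n := 1) (hd μ) k) hp)
    (DifferentiableWithinAt.fun_sum hs), partialDeriv_sum _ hp hs]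
  simp only [partialDeriv_const_smul _ hp (hdd _), e3]
  simp only at e2
  rw [e2, two_smul]
  abel

/-- The fields `Z` commute with the d'Alembertian. -/
lemma box_fieldDeriv {u : Spacetime → F} (h : ContDiffOn ℝ 3 u halfSpace) (k : FieldIndex) :
    EqOn (box (fieldDeriv k u)) (fieldDeriv k (box u)) halfSpace := by
  intro p hp
  have h2 : ContDiffOn ℝ 2 u halfSpace := h.of_le (by norm_num)
  have hdd : ∀ μ ν, DifferentiableWithinAt ℝ (partialDeriv μ (partialDeriv ν u)) halfSpace p :=
    fun μ ν => differentiableWithinAt_of_contDiffOn (n := 0)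
      (contDiffOn_partialDeriv (n := 1) (contDiffOn_partialDeriv (n := 2) h ν) μ) hp
  have e := fun μ => partialDeriv_partialDeriv_fieldDeriv h k μ hp
  simp only at e
  -- Exchanging i and j changes the sign of the coefficient and not the Hessian, so the sum equals
  -- its own negative.
  have hz : ∑ i : Fin 3, ∑ j : Fin 3,
      commCoeff k i.succ j.succ • partialDeriv j.succ (partialDeriv i.succ u) p = 0 := by
    have h1 : ∑ i : Fin 3, ∑ j : Fin 3,
        commCoeff k i.succ j.succ • partialDeriv j.succ (partialDeriv i.succ u) p
        = - ∑ i : Fin 3, ∑ j : Fin 3,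
        commCoeff k i.succ j.succ • partialDeriv j.succ (partialDeriv i.succ u) p := by
      conv_lhs => rw [Finset.sum_comm]
      simp only [← Finset.sum_neg_distrib]
      refine Finset.sum_congr rfl fun i _ => Finset.sum_congr rfl fun j _ => ?_
      rw [commCoeff_succ, partialDeriv_comm h2 i.succ j.succ hp, neg_smul]
    have h3 : (2 : ℝ) • ∑ i : Fin 3, ∑ j : Fin 3,
        commCoeff k i.succ j.succ • partialDeriv j.succ (partialDeriv i.succ u) p = 0 := by
      rw [two_smul]; nth_rewrite 1 [h1]; simp
    simpa using h3
  have e0 : fieldDeriv k (box u) p = fieldDeriv k (partialDeriv 0 (partialDeriv 0 u)) p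
      - ∑ i : Fin 3, fieldDeriv k (partialDeriv i.succ (partialDeriv i.succ u)) p := by
    have := fieldDeriv_sub hp (hdd 0 0)
      (DifferentiableWithinAt.fun_sum fun i (_ : i ∈ (Finset.univ : Finset (Fin 3))) =>
        hdd i.succ i.succ) k
    rw [fieldDeriv_sum _ hp (fun i _ => hdd _ _)] at this
    exact this
  rw [e0, box, e]
  simp only [e, commCoeff_zero_left, zero_smul, Finset.sum_const_zero, smul_zero, sub_zero,
    Finset.sum_sub_distrib, Fin.sum_univ_succ (n := 3), commCoeff_zero_right, zero_add,
    ← Finset.smul_sum, hz]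

lemma box_wordDeriv (α : List FieldIndex) {u : Spacetime → F}
    (h : ContDiffOn ℝ (α.length + 2 : ℕ) u halfSpace) :
    EqOn (box (wordDeriv α u)) (wordDeriv α (box u)) halfSpace := by
  induction α with
  | nil => exact fun p _ => rfl
  | cons k α ih =>
    intro p hp
    have h3 : ContDiffOn ℝ 3 (wordDeriv α u) halfSpace :=
      contDiffOn_wordDeriv α (n := 3) (h.of_le (by simp only [List.length_cons]; norm_cast; omega))
    rw [wordDeriv_cons, wordDeriv_cons, box_fieldDeriv h3 k hp]
    exact fieldDeriv_congr (ih (h.of_le (by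
      simp only [List.length_cons]; norm_cast; omega))) k hp

lemma wordDeriv_add (α : List FieldIndex) {u w : Spacetime → F}
    (hu : ContDiffOn ℝ α.length u halfSpace) (hw : ContDiffOn ℝ α.length w halfSpace) :
    EqOn (wordDeriv α (fun q => u q + w q)) (fun q => wordDeriv α u q + wordDeriv α w q)
      halfSpace := by
  induction α with
  | nil => exact fun p _ => rfl
  | cons k α ih =>
    intro p hp
    have hu1 := contDiffOn_wordDeriv α (n := 1) (hu.of_le (by simp [add_comm]))
    have hw1 := contDiffOn_wordDeriv α (n := 1) (hw.of_le (by simp [add_comm]))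
    rw [wordDeriv_cons, fieldDeriv_congr (ih (hu.of_le (by simp)) (hw.of_le (by simp))) k hp]
    exact fieldDeriv_add hp (differentiableWithinAt_of_contDiffOn (n := 0) hu1 hp)
      (differentiableWithinAt_of_contDiffOn (n := 0) hw1 hp) k

lemma wordDeriv_const_smul (α : List FieldIndex) (c : ℝ) {u : Spacetime → F}
    (hu : ContDiffOn ℝ α.length u halfSpace) :
    EqOn (wordDeriv α (fun q => c • u q)) (fun q => c • wordDeriv α u q) halfSpace := by
  induction α with
  | nil => exact fun p _ => rfl
  | cons k α ih =>
    intro p hp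
    have hu1 := contDiffOn_wordDeriv α (n := 1) (hu.of_le (by simp [add_comm]))
    rw [wordDeriv_cons, fieldDeriv_congr (ih (hu.of_le (by simp))) k hp]
    exact fieldDeriv_const_smul c hp (differentiableWithinAt_of_contDiffOn (n := 0) hu1 hp) k

lemma wordDeriv_zero (α : List FieldIndex) :
    EqOn (wordDeriv α (fun _ => (0 : F))) (fun _ => 0) halfSpace := by
  induction α with
  | nil => exact fun p _ => rfl
  | cons k α ih =>
    intro p hp
    rw [wordDeriv_cons, fieldDeriv_congr ih k hp]
    simp [fieldDeriv]

lemma wordDeriv_sum (α : List FieldIndex) {ι : Type*} (s : Finset ι) {u : ι → Spacetime → F}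
    (hu : ∀ i, ContDiffOn ℝ α.length (u i) halfSpace) :
    EqOn (wordDeriv α (fun q => ∑ i ∈ s, u i q)) (fun q => ∑ i ∈ s, wordDeriv α (u i) q)
      halfSpace := by
  classical
  induction s using Finset.induction_on with
  | empty => simpa using wordDeriv_zero α
  | insert i s hi ih =>
    intro p hp
    simp only [Finset.sum_insert hi]
    rw [wordDeriv_add α (hu i) (ContDiffOn.sum fun j _ => hu j) hp]
    simp only [ih hp]

end Calculus

/-! ### Sums over words of bounded length. -/

section Words

/-- The number of words of length at most `N`. -/
def wordCount (N : ℕ) : ℝ≥0 :=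
  ∑ n ∈ Finset.range (N + 1), (Fintype.card (Fin n → FieldIndex) : ℝ≥0)

lemma le_sumWords {N : ℕ} (f : List FieldIndex → ℝ≥0∞) {α : List FieldIndex}
    (hα : α.length ≤ N) : f α ≤ sumWords N f := by
  unfold sumWords
  calc f α = f (List.ofFn α.get) := by rw [List.ofFn_get]
    _ ≤ ∑ β : Fin α.length → FieldIndex, f (List.ofFn β) :=
        Finset.single_le_sum (f := fun β : Fin α.length → FieldIndex => f (List.ofFn β))
          (fun _ _ => zero_le) (Finset.mem_univ α.get)
    _ ≤ _ := Finset.single_le_sum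
        (f := fun n => ∑ β : Fin n → FieldIndex, f (List.ofFn β))
        (fun _ _ => zero_le) (Finset.mem_range.2 (Nat.lt_succ_of_le hα))

lemma sumWords_le_of_forall_le {N : ℕ} {f : List FieldIndex → ℝ≥0∞} {B : ℝ≥0∞}
    (h : ∀ α : List FieldIndex, α.length ≤ N → f α ≤ B) :
    sumWords N f ≤ wordCount N * B := by
  unfold sumWords wordCount
  push_cast
  rw [Finset.sum_mul]
  refine Finset.sum_le_sum fun n hn => ?_
  calc ∑ α : Fin n → FieldIndex, f (List.ofFn α) ≤ ∑ α : Fin n → FieldIndex, B :=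
        Finset.sum_le_sum fun α _ => h _ (by
          rw [List.length_ofFn]; exact Nat.lt_succ_iff.1 (Finset.mem_range.1 hn))
    _ = _ := by simp

lemma sumWords_mono {N : ℕ} {f g : List FieldIndex → ℝ≥0∞}
    (h : ∀ α : List FieldIndex, α.length ≤ N → f α ≤ g α) : sumWords N f ≤ sumWords N g :=
  Finset.sum_le_sum fun n hn => Finset.sum_le_sum fun α _ => h _ (by
    rw [List.length_ofFn]; exact Nat.lt_succ_iff.1 (Finset.mem_range.1 hn))

lemma sumWords_mul_add (N : ℕ) (c : ℝ≥0∞) (f g : List FieldIndex → ℝ≥0∞) :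
    sumWords N (fun α => c * (f α + g α)) = c * sumWords N f + c * sumWords N g := by
  simp only [sumWords, mul_add, Finset.sum_add_distrib, Finset.mul_sum]

lemma sumWords_succ_le (N : ℕ) (f : List FieldIndex → ℝ≥0∞) (k : FieldIndex) :
    sumWords N (fun β => f (β ++ [k])) ≤ wordCount N * sumWords (N + 1) f :=
  sumWords_le_of_forall_le fun α hα => le_sumWords f (by simpa using hα)

end Words

/-! ### Moving words across the gradient. -/

section Gradient

lemma norm_piLp_le_sum {F : Type*} [NormedAddCommGroup F]
    (x : PiLp 2 (fun _ : Fin 4 => F)) : ‖x‖ ≤ ∑ μ, ‖x μ‖ := by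
  rw [PiLp.norm_eq_of_L2]
  refine Real.sqrt_le_iff.2 ⟨Finset.sum_nonneg fun _ _ => norm_nonneg _, ?_⟩
  exact Finset.sum_sq_le_sq_sum_of_nonneg fun _ _ => norm_nonneg _

lemma enorm_piLp_le_sum {F : Type*} [NormedAddCommGroup F]
    (x : PiLp 2 (fun _ : Fin 4 => F)) : ‖x‖ₑ ≤ ∑ μ, ‖x μ‖ₑ := by
  have := norm_piLp_le_sum x
  simp only [← ofReal_norm]
  rw [← ENNReal.ofReal_sum_of_nonneg fun _ _ => norm_nonneg _]
  exact ENNReal.ofReal_le_ofReal this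

variable {F : Type*} [NormedAddCommGroup F] [NormedSpace ℝ F]

lemma contDiffOn_gradient {n : ℕ} {u : Spacetime → F}
    (h : ContDiffOn ℝ (n + 1 : ℕ) u halfSpace) :
    ContDiffOn ℝ n (gradient u) halfSpace := by
  rw [contDiffOn_piLp]
  exact fun μ => contDiffOn_partialDeriv h μ

lemma enorm_partialDeriv_le (u : Spacetime → F) (μ : Fin 4) (p : Spacetime) :
    ‖partialDeriv μ u p‖ₑ ≤ ‖gradient u p‖ₑ := by
  rw [enorm_le_iff_norm_le]
  exact PiLp.norm_apply_le (gradient u p) μ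

lemma fieldDeriv_clm {F' : Type*} [NormedAddCommGroup F'] [NormedSpace ℝ F'] (L : F →L[ℝ] F')
    {u : Spacetime → F} {p : Spacetime} (hp : p ∈ halfSpace)
    (hu : DifferentiableWithinAt ℝ u halfSpace p) (k : FieldIndex) :
    fieldDeriv k (fun q => L (u q)) p = L (fieldDeriv k u p) := by
  simp only [fieldDeriv]
  have := L.hasFDerivAt.comp_hasFDerivWithinAt p hu.hasFDerivWithinAt
  rw [show (fun q => L (u q)) = L ∘ u from rfl, this.fderivWithin (uniqueDiffOn_halfSpace p hp)]
  rfl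

lemma partialDeriv_clm {F' : Type*} [NormedAddCommGroup F'] [NormedSpace ℝ F'] (L : F →L[ℝ] F')
    {u : Spacetime → F} {p : Spacetime} (hp : p ∈ halfSpace)
    (hu : DifferentiableWithinAt ℝ u halfSpace p) (μ : Fin 4) :
    partialDeriv μ (fun q => L (u q)) p = L (partialDeriv μ u p) := by
  simp only [partialDeriv]
  have := L.hasFDerivAt.comp_hasFDerivWithinAt p hu.hasFDerivWithinAt
  rw [show (fun q => L (u q)) = L ∘ u from rfl, this.fderivWithin (uniqueDiffOn_halfSpace p hp)]
  rfl

lemma wordDeriv_clm {F' : Type*} [NormedAddCommGroup F'] [NormedSpace ℝ F'] (L : F →L[ℝ] F')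
    (α : List FieldIndex) {u : Spacetime → F} (hu : ContDiffOn ℝ α.length u halfSpace) :
    EqOn (wordDeriv α (fun q => L (u q))) (fun q => L (wordDeriv α u q)) halfSpace := by
  induction α with
  | nil => exact fun p _ => rfl
  | cons k α ih =>
    intro p hp
    have hu1 := contDiffOn_wordDeriv α (n := 1) (hu.of_le (by simp [add_comm]))
    rw [wordDeriv_cons, fieldDeriv_congr (ih (hu.of_le (by simp))) k hp]
    exact fieldDeriv_clm L hp (differentiableWithinAt_of_contDiffOn (n := 0) hu1 hp) k

lemma box_clm {F' : Type*} [NormedAddCommGroup F'] [NormedSpace ℝ F'] (L : F →L[ℝ] F')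
    {u : Spacetime → F} (hu : ContDiffOn ℝ 2 u halfSpace) :
    EqOn (box (fun q => L (u q))) (fun q => L (box u q)) halfSpace := by
  intro p hp
  have e1 : ∀ μ, EqOn (partialDeriv μ (fun q => L (u q))) (fun q => L (partialDeriv μ u q))
      halfSpace := fun μ q hq =>
    partialDeriv_clm L hq (differentiableWithinAt_of_contDiffOn (n := 1) hu hq) μ
  have e2 : ∀ μ, partialDeriv μ (partialDeriv μ (fun q => L (u q))) p
      = L (partialDeriv μ (partialDeriv μ u) p) := fun μ => by
    rw [partialDeriv_congr (e1 μ) μ hp]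
    exact partialDeriv_clm L hp (differentiableWithinAt_of_contDiffOn (n := 0)
      (contDiffOn_partialDeriv (n := 1) hu μ) hp) μ
  simp only [box, e2, map_sub, map_sum]

lemma wordDeriv_gradient_apply (α : List FieldIndex) {u : Spacetime → F}
    (hu : ContDiffOn ℝ (α.length + 1 : ℕ) u halfSpace) (μ : Fin 4) {p : Spacetime}
    (hp : p ∈ halfSpace) :
    wordDeriv α (gradient u) p μ = wordDeriv α (partialDeriv μ u) p :=
  (wordDeriv_clm (PiLp.proj 2 (fun _ : Fin 4 => F) μ : PiLp 2 (fun _ : Fin 4 => F) →L[ℝ] F) α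
    (contDiffOn_gradient hu) hp).symm

/-- Words in the fields `Z` may be moved across a translation. -/
lemma exists_enorm_wordDeriv_partialDeriv_le (n : ℕ) : ∃ C : ℝ≥0, ∀ α : List FieldIndex,
    α.length = n → ∀ u : Spacetime → F, ContDiffOn ℝ (n + 1 : ℕ) u halfSpace →
    ∀ μ, ∀ p ∈ halfSpace, ‖wordDeriv α (partialDeriv μ u) p‖ₑ
      ≤ C * sumWords n (fun β => ‖gradient (wordDeriv β u) p‖ₑ) := by
  induction n with
  | zero =>
    refine ⟨1, fun α hα u hu μ p hp => ?_⟩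
    obtain rfl := List.length_eq_zero_iff.1 hα
    rw [ENNReal.coe_one, one_mul]
    exact (enorm_partialDeriv_le u μ p).trans
      (le_sumWords (fun β => ‖gradient (wordDeriv β u) p‖ₑ) (α := []) le_rfl)
  | succ n ih =>
    obtain ⟨C, hC⟩ := ih
    refine ⟨C * wordCount n + 4 * (C * wordCount n), fun α hα u hu μ p hp => ?_⟩
    obtain rfl | ⟨α, k, rfl⟩ := List.eq_nil_or_concat α
    · simp at hα
    have hl : α.length = n := by simpa using hα
    have hu2 : ContDiffOn ℝ 2 u halfSpace := hu.of_le (by norm_cast; omega)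
    have hun : ContDiffOn ℝ (n + 1 : ℕ) u halfSpace := hu.of_le (by norm_cast; omega)
    have hZ : ContDiffOn ℝ (n + 1 : ℕ) (fieldDeriv k u) halfSpace := contDiffOn_fieldDeriv hu k
    have hpd : ∀ ν, ContDiffOn ℝ α.length (partialDeriv ν u) halfSpace := fun ν =>
      hl ▸ contDiffOn_partialDeriv hun ν
    have hsm : ∀ ν, ContDiffOn ℝ α.length (fun q => commCoeff k μ ν • partialDeriv ν u q)
      halfSpace := fun ν => contDiffOn_const.smul (hpd ν)
    set S := sumWords (n + 1) (fun β => ‖gradient (wordDeriv β u) p‖ₑ) with hS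
    have h1 : ‖wordDeriv α (partialDeriv μ (fieldDeriv k u)) p‖ₑ ≤ C * (wordCount n * S) := by
      refine (hC α hl _ hZ μ p hp).trans ?_
      gcongr
      simp only [← wordDeriv_append_singleton]
      exact sumWords_succ_le n (fun β => ‖gradient (wordDeriv β u) p‖ₑ) k
    have h2 : ∀ ν, ‖wordDeriv α (partialDeriv ν u) p‖ₑ ≤ C * (wordCount n * S) := fun ν => by
      refine (hC α hl _ hun ν p hp).trans ?_
      gcongr
      exact sumWords_le_of_forall_le fun β hβ =>
        le_sumWords (fun β => ‖gradient (wordDeriv β u) p‖ₑ) (by omega)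
    -- One commutator, then linearity of Z^α. The remaining terms carry a word shorter by one
    -- letter.
    have e : wordDeriv α (fieldDeriv k (partialDeriv μ u)) p
        = wordDeriv α (partialDeriv μ (fieldDeriv k u)) p
          + ∑ ν, commCoeff k μ ν • wordDeriv α (partialDeriv ν u) p := by
      rw [wordDeriv_congr (fieldDeriv_partialDeriv hu2 k μ) α hp]
      rw [wordDeriv_add α (hl ▸ contDiffOn_partialDeriv hZ μ)
        (ContDiffOn.sum fun ν _ => hsm ν) hp]
      simp only [wordDeriv_sum α Finset.univ hsm hp, wordDeriv_const_smul α _ (hpd _) hp]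
    rw [List.concat_eq_append, wordDeriv_append_singleton, e]
    refine (enorm_add_le _ _).trans ?_
    have h3 : ‖∑ ν, commCoeff k μ ν • wordDeriv α (partialDeriv ν u) p‖ₑ
        ≤ 4 * (C * (wordCount n * S)) := by
      refine (enorm_sum_le _ _).trans ((Finset.sum_le_card_nsmul _ _ (C * (wordCount n * S))
        fun ν _ => ?_).trans (by simp))
      rw [enorm_smul]
      refine le_trans (mul_le_of_le_one_left zero_le ?_) (h2 ν)
      rw [← ofReal_norm, Real.norm_eq_abs]
      exact ENNReal.ofReal_le_one.2 (abs_commCoeff_le k μ ν)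
    refine (add_le_add h1 h3).trans (le_of_eq ?_)
    push_cast
    ring

lemma exists_enorm_wordDeriv_gradient_le (N : ℕ) : ∃ C : ℝ≥0, ∀ α : List FieldIndex,
    α.length ≤ N → ∀ u : Spacetime → F, ContDiffOn ℝ (N + 1 : ℕ) u halfSpace →
    ∀ p ∈ halfSpace, ‖wordDeriv α (gradient u) p‖ₑ
      ≤ C * sumWords N (fun β => ‖gradient (wordDeriv β u) p‖ₑ) := by
  choose C hC using exists_enorm_wordDeriv_partialDeriv_le (F := F)
  -- The constant C n serves words of length exactly n; summing over n gives one constant for all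
  -- lengths up to N. The 4 counts the components of the gradient.
  refine ⟨∑ n ∈ Finset.range (N + 1), 4 * (C n * wordCount n), fun α hα u hu p hp => ?_⟩
  have hu' : ContDiffOn ℝ (α.length + 1 : ℕ) u halfSpace := hu.of_le (by norm_cast; omega)
  set S := sumWords N (fun β => ‖gradient (wordDeriv β u) p‖ₑ) with hS
  calc ‖wordDeriv α (gradient u) p‖ₑ ≤ ∑ μ, ‖wordDeriv α (gradient u) p μ‖ₑ :=
        enorm_piLp_le_sum _
    _ ≤ ∑ μ : Fin 4, C α.length * (wordCount α.length * S) := by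
        refine Finset.sum_le_sum fun μ _ => ?_
        rw [wordDeriv_gradient_apply α hu' μ hp]
        refine (hC _ α rfl u hu' μ p hp).trans ?_
        gcongr
        exact sumWords_le_of_forall_le fun β hβ =>
          le_sumWords (fun β => ‖gradient (wordDeriv β u) p‖ₑ) (hβ.trans hα)
    _ = ((4 * (C α.length * wordCount α.length) : ℝ≥0) : ℝ≥0∞) * S := by
        simp; ring
    _ ≤ _ := by
        gcongr
        exact Finset.single_le_sum (f := fun n => 4 * (C n * wordCount n))
          (fun _ _ => zero_le) (Finset.mem_range.2 (Nat.lt_succ_of_le hα))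

end Gradient

/-! ### The divergence theorem in a slab, for fields of bounded spatial support. -/

section Divergence

/-- `f` vanishes at the points of the half space with `|x| > ρ`. -/
def SpatialSupport (ρ : ℝ) (f : Spacetime → ℝ) : Prop :=
  ∀ p ∈ halfSpace, ρ < ‖p.2‖ → f p = 0

lemma continuous_slice {F : Type*} [TopologicalSpace F] {f : Spacetime → F}
    (hf : ContinuousOn f halfSpace) {s : ℝ}
    (hs : 0 ≤ s) : Continuous fun x : Space => f (s, x) :=
  hf.comp_continuous (by fun_prop) fun x => mk_mem_halfSpace hs x

lemma SpatialSupport.hasCompactSupport_slice {ρ : ℝ} {f : Spacetime → ℝ}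
    (h : SpatialSupport ρ f) {s : ℝ} (hs : 0 ≤ s) :
    HasCompactSupport fun x : Space => f (s, x) := by
  refine HasCompactSupport.of_support_subset_isCompact (isCompact_closedBall (0 : Space) ρ) ?_
  intro x hx
  by_contra hx'
  exact hx (h (s, x) (mk_mem_halfSpace hs x) (by simpa using hx'))

lemma SpatialSupport.integrable_slice {ρ : ℝ} {f : Spacetime → ℝ}
    (h : SpatialSupport ρ f) (hf : ContinuousOn f halfSpace) {s : ℝ} (hs : 0 ≤ s) :
    Integrable fun x : Space => f (s, x) :=
  (continuous_slice hf hs).integrable_of_hasCompactSupport (h.hasCompactSupport_slice hs)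

/-- Over a bounded time interval the support lies in a compact set, on which `f` is continuous up to
t = 0. -/
lemma SpatialSupport.integrable_slab {ρ : ℝ} {f : Spacetime → ℝ}
    (h : SpatialSupport ρ f) (hf : ContinuousOn f halfSpace) (t : ℝ) :
    Integrable f (((volume : Measure ℝ).restrict (Ioc 0 t)).prod (volume : Measure Space)) := by
  have e : ((volume : Measure ℝ).restrict (Ioc 0 t)).prod (volume : Measure Space)
      = (volume : Measure Spacetime).restrict (Ioc 0 t ×ˢ univ) := by
    rw [Measure.volume_eq_prod, ← Measure.prod_restrict, Measure.restrict_univ]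
  rw [e]
  have h1 : IntegrableOn f (Icc 0 t ×ˢ Metric.closedBall (0 : Space) ρ) volume :=
    (hf.mono fun p hp => mem_halfSpace.2 hp.1.1).integrableOn_compact
      (isCompact_Icc.prod (isCompact_closedBall _ _))
  have h2 : IntegrableOn f (Icc 0 t ×ˢ (univ : Set Space)) volume := by
    refine h1.of_forall_sdiff_eq_zero (measurableSet_Icc.prod MeasurableSet.univ) ?_
    rintro ⟨s, x⟩ ⟨⟨hs, -⟩, hp⟩
    refine h _ (mk_mem_halfSpace hs.1 x) ?_
    by_contra hx
    exact hp ⟨hs, by simpa using hx⟩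
  exact h2.mono_set (prod_mono Ioc_subset_Icc_self Subset.rfl)

/-- The strict inequality in `SpatialSupport` makes the region of vanishing relatively open, so
derivatives vanish there with the same ρ. -/
lemma SpatialSupport.partialDeriv {ρ : ℝ} {f : Spacetime → ℝ} (h : SpatialSupport ρ f)
    (μ : Fin 4) : SpatialSupport ρ (partialDeriv μ f) := by
  intro p hp hx
  have ho : IsOpen {q : Spacetime | ρ < ‖q.2‖} := isOpen_lt continuous_const (by fun_prop)
  have : f =ᶠ[nhdsWithin p halfSpace] fun _ => 0 := by
    filter_upwards [self_mem_nhdsWithin, mem_nhdsWithin_of_mem_nhds (ho.mem_nhds hx)] with q hq hq'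
    exact h q hq hq'
  simp only [KSSWave.partialDeriv]
  rw [this.fderivWithin_eq (h p hp hx)]
  simp

lemma hasFDerivAt_of_contDiffOn {f : Spacetime → ℝ} (hf : ContDiffOn ℝ 1 f halfSpace)
    {p : Spacetime} (hp : 0 < p.1) : HasFDerivAt f (fderivWithin ℝ f halfSpace p) p :=
  ((hf.differentiableOn one_ne_zero) p (mem_halfSpace.2 hp.le)).hasFDerivWithinAt.hasFDerivAt
    (halfSpace_mem_nhds hp)

lemma continuousOn_partialDeriv {f : Spacetime → ℝ} (hf : ContDiffOn ℝ 1 f halfSpace)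
    (μ : Fin 4) : ContinuousOn (partialDeriv μ f) halfSpace :=
  (contDiffOn_partialDeriv (n := 0) (by simpa using hf) μ).continuousOn

lemma hasFDerivAt_slice {f : Spacetime → ℝ} (hf : ContDiffOn ℝ 1 f halfSpace) {s : ℝ}
    (hs : 0 ≤ s) (x : Space) :
    HasFDerivAt (fun y : Space => f (s, y))
      ((fderivWithin ℝ f halfSpace (s, x)).comp (ContinuousLinearMap.inr ℝ ℝ Space)) x :=
  HasFDerivWithinAt.comp_hasFDerivAt x
    ((hf.differentiableOn one_ne_zero) _ (mk_mem_halfSpace hs x)).hasFDerivWithinAt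
    (hasFDerivAt_prodMk_right s x) (.of_forall fun y => mk_mem_halfSpace hs y)

/-- Integration by parts against the constant function 1. -/
lemma integral_partialDeriv_succ_eq_zero {ρ : ℝ} {f : Spacetime → ℝ} (h : SpatialSupport ρ f)
    (hf : ContDiffOn ℝ 1 f halfSpace) (i : Fin 3) {s : ℝ} (hs : 0 ≤ s) :
    ∫ x : Space, partialDeriv i.succ f (s, x) = 0 := by
  have h1 := (h.partialDeriv i.succ).integrable_slice (continuousOn_partialDeriv hf _) hs
  have h2 := h.integrable_slice hf.continuousOn hs
  have key := integral_bilinear_hasLineDerivAt_right_eq_neg_left_of_integrable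
    (f := fun x : Space => f (s, x)) (f' := fun x => partialDeriv i.succ f (s, x))
    (g := fun _ => (1 : ℝ)) (g' := fun _ => 0) (v := basisVec i) (μ := (volume : Measure Space))
    (B := ContinuousLinearMap.mul ℝ ℝ) (by simpa using h1) (by simp) (by simpa using h2)
    (fun x _ => ?_) (fun x _ => ?_)
  · simpa using key
  · exact (hasFDerivAt_slice hf hs x).hasLineDerivAt (basisVec i)
  · exact (hasFDerivAt_const (1 : ℝ) x).hasLineDerivAt (basisVec i)

/-- The divergence theorem in the slab `[0, t] × ℝ³`, for a vector field that vanishes for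
large `|x|`. -/
theorem integral_divergence {ρ : ℝ} {J : Fin 4 → Spacetime → ℝ}
    (hJ : ∀ μ, ContDiffOn ℝ 1 (J μ) halfSpace) (hs : ∀ μ, SpatialSupport ρ (J μ)) {t : ℝ}
    (ht : 0 ≤ t) :
    (∫ x : Space, J 0 (t, x)) - ∫ x : Space, J 0 (0, x)
      = ∫ s in (0 : ℝ)..t, ∫ x : Space, ∑ μ, partialDeriv μ (J μ) (s, x) := by
  have hc : ∀ μ, ContinuousOn (partialDeriv μ (J μ)) halfSpace := fun μ =>
    continuousOn_partialDeriv (hJ μ) μ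
  have e1 : ∫ s in (0 : ℝ)..t, ∫ x : Space, ∑ μ, partialDeriv μ (J μ) (s, x)
      = ∫ s in (0 : ℝ)..t, ∫ x : Space, partialDeriv 0 (J 0) (s, x) := by
    rw [intervalIntegral.integral_of_le ht, intervalIntegral.integral_of_le ht]
    refine setIntegral_congr_fun measurableSet_Ioc fun s hs' => ?_
    rw [integral_finsetSum _ fun μ _ =>
      ((hs μ).partialDeriv μ).integrable_slice (hc μ) hs'.1.le, Fin.sum_univ_succ]
    simp [integral_partialDeriv_succ_eq_zero (hs _) (hJ _) _ hs'.1.le]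
  have e2 : ∀ x : Space, ∫ s in Ioc 0 t, partialDeriv 0 (J 0) (s, x) = J 0 (t, x) - J 0 (0, x) := by
    intro x
    have hmap : MapsTo (fun s : ℝ => ((s, x) : Spacetime)) (Icc 0 t) halfSpace :=
      fun s hs' => mk_mem_halfSpace hs'.1 x
    have hcl : ContinuousOn (fun s : ℝ => ((s, x) : Spacetime)) (Icc 0 t) := by fun_prop
    rw [← intervalIntegral.integral_of_le ht]
    -- Two-sided time derivatives exist only for s > 0; at the endpoints continuity is enough.
    refine intervalIntegral.integral_eq_sub_of_hasDerivAt_of_le ht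
      (f := fun s => J 0 (s, x)) ((hJ 0).continuousOn.comp hcl hmap) (fun s hs' => ?_) ?_
    · have hd := hasFDerivAt_of_contDiffOn (hJ 0) (p := (s, x)) hs'.1
      have hl : HasDerivAt (fun r : ℝ => ((r, x) : Spacetime)) ((1 : ℝ), (0 : Space)) s :=
        (hasDerivAt_id s).prodMk (hasDerivAt_const s x)
      exact hd.comp_hasDerivAt s hl
    · refine ContinuousOn.intervalIntegrable ?_
      rw [uIcc_of_le ht]
      exact (hc 0).comp hcl hmap
  rw [e1, intervalIntegral.integral_of_le ht,
    integral_integral_swap (f := fun s x => partialDeriv 0 (J 0) (s, x))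
      (((hs 0).partialDeriv 0).integrable_slab (hc 0) t)]
  simp only [e2]
  rw [integral_sub ((hs 0).integrable_slice (hJ 0).continuousOn ht)
    ((hs 0).integrable_slice (hJ 0).continuousOn le_rfl)]

lemma SpatialSupport.intervalIntegrable {ρ : ℝ} {f : Spacetime → ℝ}
    (h : SpatialSupport ρ f) (hf : ContinuousOn f halfSpace) {t : ℝ} (ht : 0 ≤ t) :
    IntervalIntegrable (fun s => ∫ x : Space, f (s, x)) volume 0 t := by
  rw [intervalIntegrable_iff_integrableOn_Ioc_of_le ht]
  exact (h.integrable_slab hf t).integral_prod_left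

lemma SpatialSupport.integral_mono {ρ ρ' : ℝ} {f g : Spacetime → ℝ}
    (hf : SpatialSupport ρ f) (hfc : ContinuousOn f halfSpace)
    (hg : SpatialSupport ρ' g) (hgc : ContinuousOn g halfSpace)
    (h : ∀ p ∈ halfSpace, f p ≤ g p) {t : ℝ} (ht : 0 ≤ t) :
    ∫ s in (0 : ℝ)..t, ∫ x : Space, f (s, x) ≤ ∫ s in (0 : ℝ)..t, ∫ x : Space, g (s, x) :=
  intervalIntegral.integral_mono_on ht (hf.intervalIntegrable hfc ht)
    (hg.intervalIntegrable hgc ht) fun _ hs =>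
      MeasureTheory.integral_mono (hf.integrable_slice hfc hs.1)
      (hg.integrable_slice hgc hs.1) fun x => h _ (mk_mem_halfSpace hs.1 x)

end Divergence

/-! ### Translation between extended L² norms and real integrals of squares. -/

section SquareNorm

variable {X : Type*} [MeasurableSpace X] {m : Measure X}

lemma eLpNorm_two_sq {F : Type*} [NormedAddCommGroup F] (f : X → F) :
    eLpNorm f 2 m ^ 2 = ∫⁻ x, ‖f x‖ₑ ^ 2 ∂m := by
  have := eLpNorm_nnreal_pow_eq_lintegral (f := f) (μ := m) (p := 2) two_ne_zero
  simpa using this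

lemma eLpNorm_two_le_of_integral {F : Type*} [NormedAddCommGroup F] {f : X → F} {c : ℝ}
    (hc : 0 ≤ c)
    (hi : Integrable (fun x => ‖f x‖ ^ 2) m) (h : ∫ x, ‖f x‖ ^ 2 ∂m ≤ c ^ 2) :
    eLpNorm f 2 m ≤ ENNReal.ofReal c := by
  rw [← ENNReal.pow_le_pow_left_iff two_ne_zero, eLpNorm_two_sq, ← ENNReal.ofReal_pow hc]
  calc ∫⁻ x, ‖f x‖ₑ ^ 2 ∂m = ∫⁻ x, ENNReal.ofReal (‖f x‖ ^ 2) ∂m := by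
        simp only [ENNReal.ofReal_pow (norm_nonneg _), ofReal_norm]
    _ = ENNReal.ofReal (∫ x, ‖f x‖ ^ 2 ∂m) :=
        (ofReal_integral_eq_lintegral_ofReal hi (.of_forall fun _ => by positivity)).symm
    _ ≤ _ := ENNReal.ofReal_le_ofReal h

lemma integral_norm_sq_le_of_eLpNorm_two {F : Type*} [NormedAddCommGroup F] {f : X → F} {c : ℝ}
    (hc : 0 ≤ c) (hf : AEStronglyMeasurable f m) (h : eLpNorm f 2 m ≤ ENNReal.ofReal c) :
    Integrable (fun x => ‖f x‖ ^ 2) m ∧ ∫ x, ‖f x‖ ^ 2 ∂m ≤ c ^ 2 := by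
  have hL : MemLp f 2 m := ⟨hf, h.trans_lt ENNReal.ofReal_lt_top⟩
  have hi : Integrable (fun x => ‖f x‖ ^ 2) m := hL.integrable_norm_pow two_ne_zero
  refine ⟨hi, ?_⟩
  rw [← ENNReal.pow_le_pow_left_iff two_ne_zero, eLpNorm_two_sq, ← ENNReal.ofReal_pow hc] at h
  rw [← ENNReal.ofReal_le_ofReal_iff (by positivity),
    ofReal_integral_eq_lintegral_ofReal hi (.of_forall fun _ => by positivity)]
  simpa only [ENNReal.ofReal_pow (norm_nonneg _), ofReal_norm] using h

lemma enorm_integral_mul_le {f g : X → ℝ} (hf : AEStronglyMeasurable f m)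
    (hg : AEStronglyMeasurable g m) :
    ‖∫ x, f x * g x ∂m‖ₑ ≤ eLpNorm f 2 m * eLpNorm g 2 m := by
  refine (enorm_integral_le_lintegral_enorm _).trans ?_
  rw [← eLpNorm_one_eq_lintegral_enorm]
  have : ENNReal.HolderTriple 2 2 1 := inferInstance
  exact eLpNorm_smul_le_mul_eLpNorm (𝕜 := ℝ) (p := 2) (q := 2) (r := 1) hg hf

end SquareNorm

lemma SpatialSupport.mul_left {ρ : ℝ} {f : Spacetime → ℝ} (h : SpatialSupport ρ f)
    (g : Spacetime → ℝ) : SpatialSupport ρ fun p => f p * g p := fun p hp hx => by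
  simp [h p hp hx]

lemma SpatialSupport.neg {ρ : ℝ} {f : Spacetime → ℝ} (h : SpatialSupport ρ f) :
    SpatialSupport ρ fun p => -f p := fun p hp hx => by
  simp [h p hp hx]

lemma SpatialSupport.add {ρ : ℝ} {f g : Spacetime → ℝ} (h : SpatialSupport ρ f)
    (h' : SpatialSupport ρ g) : SpatialSupport ρ fun p => f p + g p := fun p hp hx => by
  simp [h p hp hx, h' p hp hx]

lemma SpatialSupport.sum {ι : Type*} (s : Finset ι) {ρ : ℝ} {f : ι → Spacetime → ℝ}
    (h : ∀ i, SpatialSupport ρ (f i)) : SpatialSupport ρ fun p => ∑ i ∈ s, f i p :=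
  fun p hp hx => by simp [h _ p hp hx]

/-- The space-time integral of a product, estimated by the Cauchy-Schwarz inequality in space. -/
lemma abs_integral_mul_le {f G : Spacetime → ℝ} (hf : ContinuousOn f halfSpace)
    (hG : ContinuousOn G halfSpace) {t c γ : ℝ} (hc : 0 ≤ c) (hγ : 0 ≤ γ)
    (hfc : ∀ s ∈ Icc 0 t, sliceNorm f s ≤ ENNReal.ofReal c)
    (hGγ : ∫⁻ r in Icc (0 : ℝ) t, sliceNorm G r ≤ ENNReal.ofReal γ) {s : ℝ} (hs : s ∈ Icc 0 t) :
    |∫ r in (0 : ℝ)..s, ∫ x : Space, f (r, x) * G (r, x)| ≤ c * γ := by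
  rw [← ENNReal.ofReal_le_ofReal_iff (by positivity), ← Real.norm_eq_abs, ofReal_norm,
    intervalIntegral.integral_of_le hs.1, ENNReal.ofReal_mul hc]
  refine (enorm_integral_le_lintegral_enorm _).trans ?_
  calc ∫⁻ r in Ioc 0 s, ‖∫ x : Space, f (r, x) * G (r, x)‖ₑ
      ≤ ∫⁻ r in Ioc 0 s, ENNReal.ofReal c * sliceNorm G r := by
        refine setLIntegral_mono_ae' measurableSet_Ioc (.of_forall fun r hr => ?_)
        refine (enorm_integral_mul_le (continuous_slice hf hr.1.le).aestronglyMeasurable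
          (continuous_slice hG hr.1.le).aestronglyMeasurable).trans ?_
        exact mul_le_mul_left (hfc r ⟨hr.1.le, hr.2.trans hs.2⟩) _
    -- A finite constant can be taken out without measurability of r ↦ ‖G(r)‖.
    _ = ENNReal.ofReal c * ∫⁻ r in Ioc 0 s, sliceNorm G r :=
        lintegral_const_mul' _ _ ENNReal.ofReal_ne_top
    _ ≤ ENNReal.ofReal c * ∫⁻ r in Icc 0 t, sliceNorm G r := by
        gcongr
        exact fun r hr => ⟨hr.1.le, hr.2.trans hs.2⟩
    _ ≤ _ := by gcongr

/-! ### Derivatives of radial functions and of squared positive parts. -/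

section ChainRule

lemma partialDeriv_comp {h : ℝ → ℝ} {h' : ℝ} {f : Spacetime → ℝ} {p : Spacetime}
    (hp : p ∈ halfSpace) (hh : HasDerivAt h h' (f p))
    (hf : DifferentiableWithinAt ℝ f halfSpace p) (μ : Fin 4) :
    partialDeriv μ (fun q => h (f q)) p = h' * partialDeriv μ f p := by
  simp only [partialDeriv]
  have := hh.comp_hasFDerivWithinAt p hf.hasFDerivWithinAt
  rw [show (fun q => h (f q)) = h ∘ f from rfl, this.fderivWithin (uniqueDiffOn_halfSpace p hp)]
  simp

/-- The function `r² = |x|²`. -/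
def rsq (p : Spacetime) : ℝ := ‖p.2‖ ^ 2

lemma rsq_eq (p : Spacetime) : rsq p = ∑ i, coord i p ^ 2 := by
  simp [rsq, EuclideanSpace.norm_sq_eq, coord]

lemma rsq_nonneg (p : Spacetime) : 0 ≤ rsq p := by unfold rsq; positivity

lemma contDiff_rsq {n : WithTop ℕ∞} : ContDiff ℝ n rsq :=
  contDiff_snd.norm_sq ℝ

lemma differentiableWithinAt_rsq (p : Spacetime) : DifferentiableWithinAt ℝ rsq halfSpace p :=
  (contDiff_rsq (n := 1)).differentiable one_ne_zero p |>.differentiableWithinAt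

lemma differentiableWithinAt_coord (i : Fin 3) (p : Spacetime) :
    DifferentiableWithinAt ℝ (coord i) halfSpace p :=
  (contDiff_coord i (n := 1)).differentiable one_ne_zero p |>.differentiableWithinAt

lemma partialDeriv_zero_rsq {p : Spacetime} (hp : p ∈ halfSpace) : partialDeriv 0 rsq p = 0 := by
  rw [show rsq = fun q => ∑ i, coord i q ^ 2 from funext rsq_eq,
    partialDeriv_sum _ hp fun i _ => (differentiableWithinAt_coord i p).fun_pow 2]
  refine Finset.sum_eq_zero fun i _ => ?_
  rw [partialDeriv_comp (h := fun a => a ^ 2) hp (hasDerivAt_pow 2 _)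
    (differentiableWithinAt_coord i p), partialDeriv_coord i hp]
  simp [(Fin.succ_ne_zero i).symm]

lemma partialDeriv_succ_rsq {p : Spacetime} (hp : p ∈ halfSpace) (j : Fin 3) :
    partialDeriv j.succ rsq p = 2 * coord j p := by
  rw [show rsq = fun q => ∑ i, coord i q ^ 2 from funext rsq_eq,
    partialDeriv_sum _ hp fun i _ => (differentiableWithinAt_coord i p).fun_pow 2]
  have : ∀ i : Fin 3, partialDeriv j.succ (fun q => coord i q ^ 2) p
      = if j = i then 2 * coord j p else 0 := fun i => by
    rw [partialDeriv_comp (h := fun a => a ^ 2) hp (hasDerivAt_pow 2 _)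
      (differentiableWithinAt_coord i p), partialDeriv_coord i hp]
    simp only [Fin.succ_inj]
    split_ifs with h <;> simp [h]
  simp [this]

/-- Differentiation of a radial function. -/
lemma partialDeriv_succ_radial {h : ℝ → ℝ} {h' : ℝ} {p : Spacetime} (hp : p ∈ halfSpace)
    (hh : HasDerivAt h h' (rsq p)) (j : Fin 3) :
    partialDeriv j.succ (fun q => h (rsq q)) p = 2 * h' * coord j p := by
  rw [partialDeriv_comp hp hh (differentiableWithinAt_rsq p), partialDeriv_succ_rsq hp]; ring

lemma partialDeriv_zero_radial {h : ℝ → ℝ} {h' : ℝ} {p : Spacetime} (hp : p ∈ halfSpace)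
    (hh : HasDerivAt h h' (rsq p)) : partialDeriv 0 (fun q => h (rsq q)) p = 0 := by
  rw [partialDeriv_comp hp hh (differentiableWithinAt_rsq p), partialDeriv_zero_rsq hp, mul_zero]

/-- Squaring the positive part makes it C¹: at 0 it is dominated by x² = o(x). All cutoffs below are
such squares, and their derivatives keep one factor of the unsquared cutoff. -/
lemma hasDerivAt_max_zero_sq (a : ℝ) :
    HasDerivAt (fun a : ℝ => max a 0 ^ 2) (2 * max a 0) a := by
  rcases lt_trichotomy a 0 with h | rfl | h
  · rw [max_eq_right h.le, mul_zero]
    refine (hasDerivAt_const a (0 : ℝ)).congr_of_eventuallyEq ?_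
    filter_upwards [Iio_mem_nhds h] with b hb
    simp [max_eq_right (le_of_lt (by simpa using hb : b < 0))]
  · rw [hasDerivAt_iff_isLittleO]
    have : (fun x : ℝ => x ^ 2) =o[nhds 0] fun x : ℝ => x ^ 1 :=
      Asymptotics.isLittleO_pow_pow (by norm_num)
    simp only [pow_one] at this
    refine Asymptotics.IsBigO.trans_isLittleO (.of_bound 1 (.of_forall fun x => ?_))
      (by simpa using this)
    rcases le_total x 0 with hx | hx <;> simp [hx, sq_nonneg]
  · rw [max_eq_left h.le]
    have : HasDerivAt (fun a : ℝ => a ^ 2) (2 * a) a := by simpa using hasDerivAt_pow 2 a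
    refine this.congr_of_eventuallyEq ?_
    filter_upwards [Ioi_mem_nhds h] with b hb
    simp [max_eq_left (le_of_lt (by simpa using hb : 0 < b))]

lemma contDiff_max_zero_sq : ContDiff ℝ 1 fun a : ℝ => max a 0 ^ 2 := by
  rw [contDiff_one_iff_deriv]
  refine ⟨fun a => (hasDerivAt_max_zero_sq a).differentiableAt, ?_⟩
  rw [show deriv (fun a : ℝ => max a 0 ^ 2) = fun a => 2 * max a 0 from
    funext fun a => (hasDerivAt_max_zero_sq a).deriv]
  fun_prop

end ChainRule

/-! ### The energy inequality. -/

section Energy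

/-- The energy density `|u'|²`. -/
def energyDensity (u : Spacetime → ℝ) (p : Spacetime) : ℝ := ∑ μ, partialDeriv μ u p ^ 2

lemma norm_gradient_sq (u : Spacetime → ℝ) (p : Spacetime) :
    ‖gradient u p‖ ^ 2 = energyDensity u p := by
  simp [PiLp.norm_sq_eq_of_L2, gradient, energyDensity]

lemma energyDensity_nonneg (u : Spacetime → ℝ) (p : Spacetime) : 0 ≤ energyDensity u p :=
  Finset.sum_nonneg fun _ _ => sq_nonneg _

lemma sq_partialDeriv_le (u : Spacetime → ℝ) (μ : Fin 4) (p : Spacetime) :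
    partialDeriv μ u p ^ 2 ≤ energyDensity u p :=
  Finset.single_le_sum (f := fun μ => partialDeriv μ u p ^ 2) (fun _ _ => sq_nonneg _)
    (Finset.mem_univ μ)

/-- The energy current of `u`, multiplied by a weight. -/
def energyCurrent (φ u : Spacetime → ℝ) : Fin 4 → Spacetime → ℝ :=
  Fin.cases (fun p => φ p * (2⁻¹ * energyDensity u p))
    (fun i p => -(φ p * (partialDeriv 0 u p * partialDeriv i.succ u p)))

variable {u φ : Spacetime → ℝ}

lemma contDiffOn_energyDensity (hu : ContDiffOn ℝ 2 u halfSpace) :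
    ContDiffOn ℝ 1 (energyDensity u) halfSpace :=
  ContDiffOn.sum fun μ _ => (contDiffOn_partialDeriv (n := 1) hu μ).pow 2

lemma contDiffOn_energyCurrent (hu : ContDiffOn ℝ 2 u halfSpace)
    (hφ : ContDiffOn ℝ 1 φ halfSpace) (μ : Fin 4) :
    ContDiffOn ℝ 1 (energyCurrent φ u μ) halfSpace := by
  refine Fin.cases ?_ (fun i => ?_) μ
  · exact hφ.mul (contDiffOn_const.mul (contDiffOn_energyDensity hu))
  · exact (hφ.mul ((contDiffOn_partialDeriv (n := 1) hu 0).mul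
      (contDiffOn_partialDeriv (n := 1) hu i.succ))).neg

/-- The mixed terms ∂_i u ∂_i ∂_t u from the time and space components cancel by symmetry of second
derivatives; what is left is □u and the derivatives of the weight. -/
lemma divergence_energyCurrent (hu : ContDiffOn ℝ 2 u halfSpace)
    (hφ : ContDiffOn ℝ 1 φ halfSpace) {p : Spacetime} (hp : p ∈ halfSpace) :
    ∑ μ, partialDeriv μ (energyCurrent φ u μ) p
      = 2⁻¹ * partialDeriv 0 φ p * energyDensity u p
        - partialDeriv 0 u p * ∑ i : Fin 3, partialDeriv i.succ φ p * partialDeriv i.succ u p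
        + φ p * partialDeriv 0 u p * box u p := by
  have hd : ∀ μ, DifferentiableWithinAt ℝ (partialDeriv μ u) halfSpace p := fun μ =>
    differentiableWithinAt_of_contDiffOn (n := 0) (contDiffOn_partialDeriv (n := 1) hu μ) hp
  have hφd : DifferentiableWithinAt ℝ φ halfSpace p :=
    differentiableWithinAt_of_contDiffOn (n := 0) hφ hp
  have he : DifferentiableWithinAt ℝ (energyDensity u) halfSpace p :=
    differentiableWithinAt_of_contDiffOn (n := 0) (contDiffOn_energyDensity hu) hp
  have hde : partialDeriv 0 (energyDensity u) p
      = ∑ μ, 2 * partialDeriv μ u p * partialDeriv μ (partialDeriv 0 u) p := by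
    unfold energyDensity
    rw [partialDeriv_sum _ hp fun μ _ => (hd μ).fun_pow 2]
    refine Finset.sum_congr rfl fun μ _ => ?_
    rw [partialDeriv_comp (h := fun a => a ^ 2) hp (hasDerivAt_pow 2 _) (hd μ),
      partialDeriv_comm hu 0 μ hp]
    simp
  have h0 : partialDeriv 0 (energyCurrent φ u 0) p
      = φ p * (2⁻¹ * ∑ μ, 2 * partialDeriv μ u p * partialDeriv μ (partialDeriv 0 u) p)
        + partialDeriv 0 φ p * (2⁻¹ * energyDensity u p) := by
    rw [← hde]
    change partialDeriv 0 (fun p => φ p * (2⁻¹ * energyDensity u p)) p = _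
    rw [partialDeriv_mul hp hφd (he.const_mul _)]
    congr 2
    exact partialDeriv_const_smul 2⁻¹ hp he 0
  have hi : ∀ i : Fin 3, partialDeriv i.succ (energyCurrent φ u i.succ) p
      = -(φ p * (partialDeriv 0 u p * partialDeriv i.succ (partialDeriv i.succ u) p
          + partialDeriv i.succ (partialDeriv 0 u) p * partialDeriv i.succ u p)
        + partialDeriv i.succ φ p * (partialDeriv 0 u p * partialDeriv i.succ u p)) := by
    intro i
    change partialDeriv i.succ
      (fun p => -(φ p * (partialDeriv 0 u p * partialDeriv i.succ u p))) p = _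
    rw [partialDeriv_comp (h := fun a => -a) hp (hasDerivAt_neg _)
      (hφd.fun_mul ((hd 0).fun_mul (hd i.succ))),
      partialDeriv_mul hp hφd ((hd 0).fun_mul (hd i.succ)),
      partialDeriv_mul hp (hd 0) (hd i.succ)]
    ring
  rw [Fin.sum_univ_succ, h0]
  simp only [hi, box, Fin.sum_univ_succ (n := 3), Fin.sum_univ_three]
  ring

/-- The square root of the weight in the energy estimate. -/
def coneWeight (ρ : ℝ) (p : Spacetime) : ℝ := max (1 - (p.1 + √(1 + rsq p)) / ρ) 0

lemma contDiff_japanese : ContDiff ℝ 1 fun p : Spacetime => √(1 + rsq p) :=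
  (contDiff_const.add contDiff_rsq).sqrt fun p => by have := rsq_nonneg p; positivity

lemma contDiff_coneWeight_sq (ρ : ℝ) : ContDiff ℝ 1 fun p => coneWeight ρ p ^ 2 :=
  contDiff_max_zero_sq.comp
    (contDiff_const.sub ((contDiff_fst.add contDiff_japanese).div_const ρ))

lemma coneWeight_nonneg (ρ : ℝ) (p : Spacetime) : 0 ≤ coneWeight ρ p := le_max_right _ _

lemma coneWeight_le_one {ρ : ℝ} (hρ : 0 < ρ) {p : Spacetime} (hp : p ∈ halfSpace) :
    coneWeight ρ p ≤ 1 := by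
  have := mem_halfSpace.1 hp
  refine max_le ?_ zero_le_one
  have : 0 ≤ (p.1 + √(1 + rsq p)) / ρ := by positivity
  linarith

lemma spatialSupport_coneWeight_sq {ρ : ℝ} (hρ : 0 < ρ) :
    SpatialSupport ρ fun p => coneWeight ρ p ^ 2 := by
  intro p hp hx
  have h0 := mem_halfSpace.1 hp
  have h1 : ‖p.2‖ ≤ √(1 + rsq p) := Real.le_sqrt_of_sq_le (by unfold rsq; linarith)
  have : coneWeight ρ p = 0 := by
    refine max_eq_right ?_
    rw [sub_nonpos, one_le_div hρ]
    linarith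
  simp [this]

lemma partialDeriv_coneWeight_sq (ρ : ℝ) {p : Spacetime} (hp : p ∈ halfSpace) (μ : Fin 4) :
    partialDeriv μ (fun p => coneWeight ρ p ^ 2) p = -(2 / ρ * coneWeight ρ p)
      * (Fin.cases 1 (fun i => coord i p / √(1 + rsq p)) μ : ℝ) := by
  have hd : DifferentiableWithinAt ℝ (fun p : Spacetime => √(1 + rsq p)) halfSpace p :=
    (contDiff_japanese.differentiable one_ne_zero p).differentiableWithinAt
  have h1 : DifferentiableWithinAt ℝ (fun p : Spacetime => p.1) halfSpace p :=
    differentiable_fst.differentiableAt.differentiableWithinAt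
  have hdiv : DifferentiableWithinAt ℝ (fun p : Spacetime => (p.1 + √(1 + rsq p)) / ρ)
      halfSpace p := by
    simpa only [div_eq_mul_inv] using (h1.fun_add hd).mul_const ρ⁻¹
  have hs : HasDerivAt (fun y => √(1 + y)) (1 / (2 * √(1 + rsq p))) (rsq p) := by
    have h0 : 1 + rsq p ≠ 0 := by have := rsq_nonneg p; positivity
    exact ((hasDerivAt_id (rsq p)).const_add 1).sqrt h0
  have e0 : partialDeriv μ (fun p : Spacetime => p.1) p = if μ = 0 then 1 else 0 := by
    simp only [partialDeriv]
    rw [(hasFDerivAt_fst (p := p)).hasFDerivWithinAt.fderivWithin (uniqueDiffOn_halfSpace p hp)]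
    refine Fin.cases ?_ (fun i => ?_) μ <;> simp [dir]
  unfold coneWeight
  rw [partialDeriv_comp (h := fun a => max a 0 ^ 2) hp (hasDerivAt_max_zero_sq _)
    (hdiv.const_sub 1),
    partialDeriv_comp (h := fun a => 1 - a / ρ) hp
      (((hasDerivAt_id _).div_const ρ).const_sub 1) (h1.fun_add hd),
    partialDeriv_add hp h1 hd, e0]
  refine Fin.cases ?_ (fun i => ?_) μ
  · rw [partialDeriv_zero_radial hp hs]
    simp; ring
  · rw [partialDeriv_succ_radial hp hs]
    simp; ring

/-- The weight is a decreasing function of t + √(1 + r²), whose spatial gradient y has length at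
most 1. Its derivative therefore contributes a multiple of -(|u'|² - 2 ∂_t u y·∇u), which is
nonpositive. -/
lemma divergence_energyCurrent_le {ρ : ℝ} (hρ : 0 < ρ) (hu : ContDiffOn ℝ 2 u halfSpace)
    {p : Spacetime} (hp : p ∈ halfSpace) :
    ∑ μ, partialDeriv μ (energyCurrent (fun p => coneWeight ρ p ^ 2) u μ) p
      ≤ coneWeight ρ p ^ 2 * partialDeriv 0 u p * box u p := by
  rw [divergence_energyCurrent hu (contDiff_coneWeight_sq ρ).contDiffOn hp]
  simp only [partialDeriv_coneWeight_sq ρ hp, Fin.cases_zero, Fin.cases_succ]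
  set c := 2 / ρ * coneWeight ρ p with hc
  have hc0 : 0 ≤ c := mul_nonneg (by positivity) (coneWeight_nonneg ρ p)
  set y : Fin 3 → ℝ := fun i => coord i p / √(1 + rsq p) with hy
  have hy1 : ∑ i, y i ^ 2 ≤ 1 := by
    have h0 := rsq_nonneg p
    simp only [hy, div_pow, Real.sq_sqrt (by positivity : 0 ≤ 1 + rsq p)]
    rw [← Finset.sum_div, ← rsq_eq, div_le_one (by positivity)]
    linarith
  have hcs := Finset.sum_mul_sq_le_sq_mul_sq Finset.univ y (fun i => partialDeriv i.succ u p)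
  set Y := ∑ i, y i * partialDeriv i.succ u p with hY
  set V := ∑ i : Fin 3, partialDeriv i.succ u p ^ 2 with hV
  have hV0 : 0 ≤ V := Finset.sum_nonneg fun _ _ => sq_nonneg _
  have hen : energyDensity u p = partialDeriv 0 u p ^ 2 + V := by
    rw [energyDensity, Fin.sum_univ_succ]
  have hYV : Y ^ 2 ≤ V := hcs.trans (mul_le_of_le_one_left hV0 hy1)
  have hsum : ∑ i : Fin 3, -c * (coord i p / √(1 + rsq p)) * partialDeriv i.succ u p = -c * Y := by
    rw [hY, Finset.mul_sum]; exact Finset.sum_congr rfl fun i _ => by rw [hy]; ring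
  rw [hsum, hen]
  have : c * (2 * partialDeriv 0 u p * Y) ≤ c * (partialDeriv 0 u p ^ 2 + V) :=
    mul_le_mul_of_nonneg_left (by nlinarith [sq_nonneg (partialDeriv 0 u p - Y)]) hc0
  linarith

/-- The cutoff makes the localized energy finite and continuous in time before any global bound is
known, so it can be compared with its own maximum. -/
lemma sliceNorm_coneWeight_le {G : Spacetime → ℝ} (hu : ContDiffOn ℝ 2 u halfSpace)
    (hG : EqOn (box u) G halfSpace) {t a γ : ℝ} (ha : 0 ≤ a) (hγ : 0 ≤ γ)
    (ha' : sliceNorm (gradient u) 0 ≤ ENNReal.ofReal a)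
    (hγ' : ∫⁻ s in Icc (0 : ℝ) t, sliceNorm G s ≤ ENNReal.ofReal γ)
    {ρ : ℝ} (hρ : 0 < ρ) {s : ℝ} (hs : s ∈ Icc 0 t) :
    sliceNorm (fun p => coneWeight ρ p • gradient u p) s ≤ ENNReal.ofReal (a + 2 * γ) := by
  have ht : 0 ≤ t := hs.1.trans hs.2
  have hd : ∀ μ, ContDiffOn ℝ 1 (partialDeriv μ u) halfSpace := fun μ =>
    contDiffOn_partialDeriv (n := 1) hu μ
  have hbc : ContinuousOn (box u) halfSpace :=
    (continuousOn_partialDeriv (hd 0) 0).sub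
      (continuousOn_finsetSum _ fun i _ => continuousOn_partialDeriv (hd i.succ) i.succ)
  have hGc : ContinuousOn G halfSpace := hbc.congr hG.symm
  set φ : Spacetime → ℝ := fun p => coneWeight ρ p ^ 2 with hφ
  have hφ1 : ContDiffOn ℝ 1 φ halfSpace := (contDiff_coneWeight_sq ρ).contDiffOn
  have hφs : SpatialSupport ρ φ := spatialSupport_coneWeight_sq hρ
  have hφ0 : ∀ p, 0 ≤ φ p := fun p => sq_nonneg _
  have hφle : ∀ p ∈ halfSpace, φ p ≤ 1 := fun p hp =>
    pow_le_one₀ (coneWeight_nonneg ρ p) (coneWeight_le_one hρ hp)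
  have hen := (contDiffOn_energyDensity hu).continuousOn
  have hJ := contDiffOn_energyCurrent hu hφ1
  have hJs : ∀ μ, SpatialSupport ρ (energyCurrent φ u μ) :=
    Fin.cases (hφs.mul_left _) fun i => (hφs.mul_left _).neg
  have hdivc : ContinuousOn (fun p => ∑ μ, partialDeriv μ (energyCurrent φ u μ) p) halfSpace :=
    continuousOn_finsetSum _ fun μ _ => continuousOn_partialDeriv (hJ μ) μ
  have hdivs : SpatialSupport ρ fun p => ∑ μ, partialDeriv μ (energyCurrent φ u μ) p :=
    SpatialSupport.sum _ fun μ => (hJs μ).partialDeriv μ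
  have hfc : ContinuousOn (fun p => φ p * partialDeriv 0 u p) halfSpace :=
    hφ1.continuousOn.mul (hd 0).continuousOn
  have hfs : SpatialSupport ρ fun p => φ p * partialDeriv 0 u p := hφs.mul_left _
  set E : ℝ → ℝ := fun s => ∫ x : Space, φ (s, x) * energyDensity u (s, x) with hE
  have hEint : ∀ r, 0 ≤ r → Integrable fun x : Space => φ (r, x) * energyDensity u (r, x) :=
    fun r hr => (hφs.mul_left _).integrable_slice (hφ1.continuousOn.mul hen) hr
  have hEJ : ∀ r, ∫ x : Space, energyCurrent φ u 0 (r, x) = 2⁻¹ * E r := by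
    intro r
    rw [hE, ← integral_const_mul]
    refine integral_congr_ae (.of_forall fun x => ?_)
    simp only [energyCurrent, Fin.cases_zero]; ring
  have hid : ∀ r, 0 ≤ r → E r = E 0 + 2 * ∫ s in (0 : ℝ)..r, ∫ x : Space,
      ∑ μ, partialDeriv μ (energyCurrent φ u μ) (s, x) := by
    intro r hr
    have := integral_divergence hJ hJs hr
    rw [hEJ, hEJ] at this
    linarith
  -- By `hid`, E is a constant plus a primitive of an integrable function.
  have hcont : ContinuousOn E (Icc 0 t) := by
    have h1 := intervalIntegral.continuousOn_primitive_interval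
      (f := fun s => ∫ x : Space, ∑ μ, partialDeriv μ (energyCurrent φ u μ) (s, x))
      (a := 0) (b := t) (μ := volume) (by
        rw [uIcc_of_le ht, integrableOn_Icc_iff_integrableOn_Ioc,
          ← intervalIntegrable_iff_integrableOn_Ioc_of_le ht]
        exact hdivs.intervalIntegrable hdivc ht)
    rw [uIcc_of_le ht] at h1
    exact ((continuousOn_const (c := E 0)).add (h1.const_smul (2 : ℝ))).congr
      fun r hr => by simpa using hid r hr.1
  obtain ⟨r₀, hr₀, hmax⟩ := isCompact_Icc.exists_isMaxOn ⟨s, hs⟩ hcont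
  have hE0 : ∀ r, 0 ≤ E r := fun r =>
    integral_nonneg fun x => mul_nonneg (hφ0 _) (energyDensity_nonneg _ _)
  have hEa : E 0 ≤ a ^ 2 := by
    obtain ⟨hi, hle⟩ := integral_norm_sq_le_of_eLpNorm_two ha
      (continuous_slice (contDiffOn_gradient (n := 1) hu).continuousOn
        le_rfl).aestronglyMeasurable ha'
    refine le_trans (integral_mono (hEint 0 le_rfl) hi fun x => ?_) hle
    simp only [norm_gradient_sq]
    exact mul_le_of_le_one_left (energyDensity_nonneg _ _) (hφle _ (mk_mem_halfSpace le_rfl x))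
  set q := √(E r₀) with hq
  have hq2 : q ^ 2 = E r₀ := Real.sq_sqrt (hE0 _)
  -- Here φ² ≤ φ, because 0 ≤ φ ≤ 1.
  have hfq : ∀ r ∈ Icc 0 t, sliceNorm (fun p => φ p * partialDeriv 0 u p) r
      ≤ ENNReal.ofReal q := by
    intro r hr
    have hle : ∀ x : Space, ‖φ (r, x) * partialDeriv 0 u (r, x)‖ ^ 2
        ≤ φ (r, x) * energyDensity u (r, x) := fun x => by
      rw [Real.norm_eq_abs, sq_abs, mul_pow]
      have h1 := hφle _ (mk_mem_halfSpace hr.1 x)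
      have h2 := hφ0 (r, x)
      exact mul_le_mul (by nlinarith) (sq_partialDeriv_le u 0 _) (sq_nonneg _) h2
    have hi : Integrable fun x : Space => ‖φ (r, x) * partialDeriv 0 u (r, x)‖ ^ 2 := by
      refine (hEint r hr.1).mono' ?_ (.of_forall fun x => ?_)
      · exact ((continuous_slice hfc hr.1).norm.pow 2).aestronglyMeasurable
      · rw [Real.norm_of_nonneg (sq_nonneg _)]; exact hle x
    refine eLpNorm_two_le_of_integral (Real.sqrt_nonneg _) hi ?_
    rw [hq2]
    exact (integral_mono hi (hEint r hr.1) hle).trans (hmax hr)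
  have hS : E r₀ ≤ a ^ 2 + 2 * (q * γ) := by
    have h1 := abs_integral_mul_le hfc hGc (Real.sqrt_nonneg _) hγ hfq hγ' hr₀
    have h2 := hdivs.integral_mono hdivc (hfs.mul_left G) (hfc.mul hGc) (fun p hp => by
      have := divergence_energyCurrent_le hρ hu hp
      rwa [hG hp] at this) hr₀.1
    have h3 := hid r₀ hr₀.1
    have h4 := (le_abs_self _).trans h1
    linarith
  -- From q² ≤ a² + 2qγ: if q exceeded a + 2γ then q ≥ a, and q² > q(a + 2γ) ≥ a² + 2qγ.
  have hqle : q ≤ a + 2 * γ := by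
    have : 0 ≤ q := Real.sqrt_nonneg _
    by_contra hcon
    push Not at hcon
    nlinarith [mul_nonneg ha hγ, mul_nonneg this hγ]
  refine eLpNorm_two_le_of_integral (by positivity) ?_ ?_
  · refine (hEint s hs.1).congr (.of_forall fun x => ?_)
    simp only [norm_smul, mul_pow, norm_gradient_sq, Real.norm_eq_abs, sq_abs, hφ]
  · calc ∫ x : Space, ‖coneWeight ρ (s, x) • gradient u (s, x)‖ ^ 2 = E s := by
          refine integral_congr_ae (.of_forall fun x => ?_)
          simp only [norm_smul, mul_pow, norm_gradient_sq, Real.norm_eq_abs, sq_abs, hφ]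
      _ ≤ E r₀ := hmax hs
      _ = q ^ 2 := hq2.symm
      _ ≤ _ := pow_le_pow_left₀ (Real.sqrt_nonneg _) hqle 2

lemma tendsto_coneWeight (p : Spacetime) :
    Filter.Tendsto (fun n : ℕ => coneWeight (n + 1 : ℝ) p) Filter.atTop (nhds 1) := by
  have h1 : Filter.Tendsto (fun n : ℕ => (p.1 + √(1 + rsq p)) / ((n : ℝ) + 1)) Filter.atTop
      (nhds 0) := by
    have := (tendsto_one_div_add_atTop_nhds_zero_nat (𝕜 := ℝ)).const_mul (p.1 + √(1 + rsq p))
    simpa [div_eq_mul_inv] using this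
  have h2 := (h1.const_sub 1).max (tendsto_const_nhds (x := (0 : ℝ)))
  simpa [coneWeight] using h2

/-- The energy estimate for `C²` solutions of the scalar wave equation. -/
theorem sliceNorm_gradient_le {G : Spacetime → ℝ} (hu : ContDiffOn ℝ 2 u halfSpace)
    (hG : EqOn (box u) G halfSpace) {t a γ : ℝ} (ha : 0 ≤ a) (hγ : 0 ≤ γ)
    (ha' : sliceNorm (gradient u) 0 ≤ ENNReal.ofReal a)
    (hγ' : ∫⁻ s in Icc (0 : ℝ) t, sliceNorm G s ≤ ENNReal.ofReal γ) {s : ℝ} (hs : s ∈ Icc 0 t) :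
    sliceNorm (gradient u) s ≤ ENNReal.ofReal (a + 2 * γ) := by
  have hgc := continuous_slice (contDiffOn_gradient (n := 1) hu).continuousOn hs.1
  have hcw : ∀ ρ, Continuous (coneWeight ρ) := fun ρ =>
    ((continuous_const.sub ((continuous_fst.add contDiff_japanese.continuous).div_const ρ)).max
      continuous_const)
  -- Fatou's lemma with ρ = n + 1 → ∞: the localized bound does not depend on ρ, so finiteness of
  -- the full norm comes out as a conclusion.
  have key := Lp.eLpNorm_lim_le_liminf_eLpNorm (μ := (volume : Measure Space)) (p := 2)
    (f := fun (n : ℕ) (x : Space) => coneWeight (n + 1 : ℝ) (s, x) • gradient u (s, x))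
    (fun n => (((hcw _).comp (by fun_prop : Continuous fun x : Space => ((s, x) : Spacetime))).smul
      hgc).aestronglyMeasurable)
    (fun x => gradient u (s, x)) (.of_forall fun x => by
      simpa using (tendsto_coneWeight (s, x)).smul_const (gradient u (s, x)))
  refine key.trans ?_
  refine Filter.liminf_le_of_frequently_le' (Filter.Frequently.of_forall fun n => ?_)
  exact sliceNorm_coneWeight_le hu hG ha hγ ha' hγ' (by positivity) hs

end Energy

/-! ### A Poincaré inequality on balls. -/

section Poincare

lemma enorm_setIntegral_Ioc_sq_le {f : ℝ → ℝ} {s : ℝ}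
    (hf : AEStronglyMeasurable f (volume.restrict (Ioc 0 s))) :
    ‖∫ r in Ioc 0 s, f r‖ₑ ^ 2 ≤ ENNReal.ofReal s * ∫⁻ r in Ioc 0 s, ‖f r‖ₑ ^ 2 := by
  have h := enorm_integral_mul_le (g := fun _ => (1 : ℝ)) hf aestronglyMeasurable_const
  simp only [mul_one] at h
  have h2 := pow_le_pow_left' h 2
  rw [mul_pow, eLpNorm_two_sq, eLpNorm_two_sq] at h2
  simpa [mul_comm] using h2

/-- The Jacobian in dimension 3 is θ⁻³, at most 8 when θ ≥ 1/2. -/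
lemma lintegral_comp_add_smul (h : Space → ℝ≥0∞) (hh : Measurable h) (z : Space) {θ : ℝ}
    (hθ : 1 / 2 ≤ θ) : ∫⁻ y, h (z + θ • y) ≤ 8 * ∫⁻ y, h y := by
  have h0 : 0 < θ := by linarith
  have e : ∫⁻ y, h (z + θ • y) = ∫⁻ y, h (z + y) ∂(Measure.map (fun y : Space => θ • y) volume) :=
    (lintegral_map (f := fun y => h (z + y)) (g := fun y : Space => θ • y)
      (hh.comp (by fun_prop)) (by fun_prop)).symm
  rw [e, Measure.map_addHaar_smul _ h0.ne', lintegral_smul_measure, lintegral_add_left_eq_self,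
    smul_eq_mul]
  gcongr
  have : |(θ ^ Module.finrank ℝ Space)⁻¹| ≤ 8 := by
    rw [finrank_euclideanSpace, Fintype.card_fin, abs_of_pos (by positivity)]
    rw [inv_le_comm₀ (by positivity) (by norm_num)]
    calc (8 : ℝ)⁻¹ = (1 / 2) ^ 3 := by norm_num
      _ ≤ θ ^ 3 := pow_le_pow_left₀ (by norm_num) hθ 3
  calc ENNReal.ofReal _ ≤ ENNReal.ofReal 8 := ENNReal.ofReal_le_ofReal this
    _ = 8 := by simp

/-- The fundamental theorem of calculus along the segment from x to y, followed by Cauchy-Schwarz in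
θ. -/
lemma enorm_sub_sq_le {w : Space → ℝ} (hw : ContDiff ℝ 1 w) (x y : Space) :
    ‖w y - w x‖ₑ ^ 2
      ≤ ‖y - x‖ₑ ^ 2 * ∫⁻ θ in Ioc (0 : ℝ) 1, ‖fderiv ℝ w (x + θ • (y - x))‖ₑ ^ 2 := by
  have hfc : Continuous fun θ : ℝ => fderiv ℝ w (x + θ • (y - x)) (y - x) :=
    ((hw.continuous_fderiv one_ne_zero).comp (by fun_prop)).clm_apply continuous_const
  have e : w y - w x = ∫ θ in Ioc (0 : ℝ) 1, fderiv ℝ w (x + θ • (y - x)) (y - x) := by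
    rw [← intervalIntegral.integral_of_le zero_le_one,
      intervalIntegral.integral_eq_sub_of_hasDerivAt (f := fun θ : ℝ => w (x + θ • (y - x)))
        (fun θ _ => ?_) (hfc.intervalIntegrable _ _)]
    · simp
    · have h1 : HasDerivAt (fun θ : ℝ => x + θ • (y - x)) (y - x) θ := by
        simpa using ((hasDerivAt_id θ).smul_const (y - x)).const_add x
      exact ((hw.differentiable one_ne_zero) _).hasFDerivAt.comp_hasDerivAt θ h1
  rw [e]
  refine (enorm_setIntegral_Ioc_sq_le hfc.aestronglyMeasurable).trans ?_
  rw [ENNReal.ofReal_one, one_mul, ← lintegral_const_mul' _ _ (by simp)]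
  refine lintegral_mono fun θ => ?_
  rw [mul_comm, ← mul_pow]
  exact pow_le_pow_left' (ContinuousLinearMap.le_opENorm _ _) 2

/-- The Poincaré inequality on a ball, for the value at a suitable point instead of the mean. -/
lemma exists_lintegral_sub_sq_le {w : Space → ℝ} (hw : ContDiff ℝ 1 w) {L : ℝ} (hL : 0 < L) :
    ∃ c : ℝ, ∫⁻ x in Metric.ball 0 L, ‖w x - c‖ₑ ^ 2
      ≤ ENNReal.ofReal (32 * L ^ 2) * ∫⁻ x in Metric.ball 0 L, ‖fderiv ℝ w x‖ₑ ^ 2 := by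
  set B : Set Space := Metric.ball 0 L with hB
  set D : Space → ℝ≥0∞ := fun x => ‖fderiv ℝ w x‖ₑ ^ 2 with hD
  have hDc : Continuous D := 
    (ENNReal.continuous_pow 2).comp (hw.continuous_fderiv one_ne_zero).enorm
  set I := ∫⁻ x in B, D x with hI
  have hBm : MeasurableSet B := Metric.isOpen_ball.measurableSet
  have hB0 : volume B ≠ 0 := (Metric.measure_ball_pos volume 0 hL).ne'
  have hBt : volume B ≠ ∞ := measure_ball_lt_top.ne
  have hind : Measurable (B.indicator D) := hDc.measurable.indicator hBm
  -- By convexity the segment stays in B, so `D` may be replaced by its indicator on B before the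
  -- change of variables.
  have key : ∀ z ∈ B, ∀ θ ∈ Icc (1 / 2 : ℝ) 1, ∫⁻ y in B, D ((1 - θ) • z + θ • y) ≤ 8 * I := by
    intro z hz θ hθ
    rw [hI, ← lintegral_indicator hBm D]
    refine le_trans ?_ (lintegral_comp_add_smul _ hind ((1 - θ) • z) hθ.1)
    rw [← lintegral_indicator hBm]
    refine lintegral_mono fun y => ?_
    by_cases hy : y ∈ B
    · rw [indicator_of_mem hy, indicator_of_mem]
      exact (convex_ball 0 L) hz hy (by linarith [hθ.2]) (by linarith [hθ.1]) (by ring)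
    · rw [indicator_of_notMem hy]; exact zero_le
  -- For θ ≥ 1/2 the substitution is made in y, for θ ≤ 1/2 in x, so the Jacobian never exceeds 8.
  have hθ : ∀ θ ∈ Ioc (0 : ℝ) 1,
      ∫⁻ y in B, ∫⁻ x in B, D (x + θ • (y - x)) ≤ 8 * I * volume B := by
    intro θ hθ
    rcases le_total (1 / 2) θ with h | h
    · rw [lintegral_lintegral_swap (by
        refine Measurable.aemeasurable ?_
        exact hDc.measurable.comp (by fun_prop))]
      calc ∫⁻ x in B, ∫⁻ y in B, D (x + θ • (y - x)) ≤ ∫⁻ x in B, 8 * I := by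
            refine setLIntegral_mono measurable_const fun x hx => ?_
            refine le_trans (le_of_eq ?_) (key x hx θ ⟨h, hθ.2⟩)
            congr 1; ext y; congr 1; module
        _ = _ := by simp
    · calc ∫⁻ y in B, ∫⁻ x in B, D (x + θ • (y - x)) ≤ ∫⁻ y in B, 8 * I := by
            refine setLIntegral_mono measurable_const fun y hy => ?_
            refine le_trans (le_of_eq ?_)
              (key y hy (1 - θ) ⟨by linarith, by linarith [hθ.1]⟩)
            congr 1; ext x; congr 1; module
        _ = _ := by simp
  have hF : Measurable fun q : (Space × ℝ) × Space =>
      D (q.2 + q.1.2 • (q.1.1 - q.2)) := hDc.measurable.comp (by fun_prop)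
  -- The factor 32L² is (2L)² from |y - x| ≤ 2L, times the Jacobian bound 8.
  have htot : ∫⁻ y in B, ∫⁻ x in B, ‖w x - w y‖ₑ ^ 2
      ≤ ENNReal.ofReal (32 * L ^ 2) * I * volume B := by
    calc ∫⁻ y in B, ∫⁻ x in B, ‖w x - w y‖ₑ ^ 2
        ≤ ∫⁻ y in B, ∫⁻ x in B, ENNReal.ofReal (4 * L ^ 2)
            * ∫⁻ θ in Ioc (0 : ℝ) 1, D (x + θ • (y - x)) := by
          refine setLIntegral_mono' hBm fun y hy => setLIntegral_mono' hBm fun x hx => ?_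
          rw [← enorm_neg, neg_sub]
          refine (enorm_sub_sq_le hw x y).trans ?_
          gcongr
          rw [← ofReal_norm, ← ENNReal.ofReal_pow (norm_nonneg _)]
          refine ENNReal.ofReal_le_ofReal ?_
          rw [hB, mem_ball_zero_iff] at hx hy
          have : ‖y - x‖ ≤ 2 * L := (norm_sub_le _ _).trans (by linarith)
          nlinarith [norm_nonneg (y - x)]
      _ = ENNReal.ofReal (4 * L ^ 2) * ∫⁻ y in B, ∫⁻ x in B,
            ∫⁻ θ in Ioc (0 : ℝ) 1, D (x + θ • (y - x)) := by
          simp only [lintegral_const_mul' _ _ ENNReal.ofReal_ne_top]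
      _ = ENNReal.ofReal (4 * L ^ 2) * ∫⁻ θ in Ioc (0 : ℝ) 1, ∫⁻ y in B, ∫⁻ x in B,
            D (x + θ • (y - x)) := by
          congr 1
          rw [lintegral_lintegral_swap (f := fun (θ : ℝ) (y : Space) =>
            ∫⁻ x in B, D (x + θ • (y - x)))]
          · refine lintegral_congr fun y => ?_
            rw [lintegral_lintegral_swap]
            exact (hDc.measurable.comp (by fun_prop)).aemeasurable
          · have := hF.lintegral_prod_right' (ν := volume.restrict B)
            exact (this.comp measurable_swap).aemeasurable
      _ ≤ ENNReal.ofReal (4 * L ^ 2) * ∫⁻ θ in Ioc (0 : ℝ) 1, 8 * I * volume B := by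
          refine mul_le_mul' le_rfl ?_
          exact setLIntegral_mono measurable_const hθ
      _ = _ := by
          rw [show (32 : ℝ) * L ^ 2 = 4 * L ^ 2 * 8 by ring,
            ENNReal.ofReal_mul (p := 4 * L ^ 2) (by positivity), lintegral_const,
            Measure.restrict_apply_univ, Real.volume_Ioc, sub_zero, ENNReal.ofReal_one, mul_one,
            ENNReal.ofReal_ofNat]
          ring
  -- Some y does at least as well as the average over y, and w y is the constant.
  obtain ⟨y, -, hy⟩ := exists_le_setLAverage (μ := volume) (s := B)
    (f := fun y => ∫⁻ x in B, ‖w x - w y‖ₑ ^ 2) hB0 hBt (by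
      refine Measurable.aemeasurable ?_
      refine Measurable.lintegral_prod_right' (f := fun q : Space × Space => ‖w q.2 - w q.1‖ₑ ^ 2)
        ?_
      have := hw.continuous
      exact Continuous.measurable (by fun_prop))
  refine ⟨w y, hy.trans ?_⟩
  rw [setLAverage_eq]
  exact ENNReal.div_le_of_le_mul htot

end Poincare

/-! ### Local L² distance of the solution from a constant. -/

section Hardy

variable {u : Spacetime → ℝ}

lemma norm_fderivWithin_comp_inr_le (u : Spacetime → ℝ) (p : Spacetime) :
    ‖(fderivWithin ℝ u halfSpace p).comp (ContinuousLinearMap.inr ℝ ℝ Space)‖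
      ≤ ‖gradient u p‖ := by
  refine ContinuousLinearMap.opNorm_le_bound _ (norm_nonneg _) fun v => ?_
  have hv : v = ∑ i, v i • basisVec i := by
    ext j; simp [basisVec, Pi.single_apply]
  have e : (fderivWithin ℝ u halfSpace p).comp (ContinuousLinearMap.inr ℝ ℝ Space) v
      = ∑ i : Fin 3, v i * partialDeriv i.succ u p := by
    conv_lhs => rw [hv]
    simp only [map_sum, map_smul, smul_eq_mul]
    rfl
  rw [e, Real.norm_eq_abs]
  refine abs_le_of_sq_le_sq ?_ (by positivity)
  rw [mul_pow, norm_gradient_sq, EuclideanSpace.norm_sq_eq]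
  refine (Finset.sum_mul_sq_le_sq_mul_sq _ _ _).trans ?_
  rw [mul_comm]
  simp only [Real.norm_eq_abs, sq_abs]
  gcongr
  rw [energyDensity, Fin.sum_univ_succ]
  exact le_add_of_nonneg_left (sq_nonneg _)

/-- One constant c serves all times: it is chosen at time 0 by Poincaré, and u(s) - u(0) is an
integral of ∂_t u over a time at most L. Thus 66 = 2·1 + 2·32. -/
lemma exists_lintegral_slice_sub_le (hu : ContDiffOn ℝ 1 u halfSpace) {t M L : ℝ} (hM : 0 ≤ M)
    (ht : 0 ≤ t) (hL : 0 < L) (htL : t ≤ L)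
    (hE : ∀ s ∈ Icc 0 t, sliceNorm (gradient u) s ≤ ENNReal.ofReal M) :
    ∃ c : ℝ, ∀ s ∈ Icc 0 t, ∫⁻ x in Metric.ball (0 : Space) L, ‖u (s, x) - c‖ₑ ^ 2
      ≤ ENNReal.ofReal (66 * L ^ 2 * M ^ 2) := by
  have hgrad : ∀ s ∈ Icc 0 t, ∫⁻ x : Space, ‖gradient u (s, x)‖ₑ ^ 2 ≤ ENNReal.ofReal (M ^ 2) := by
    intro s hs
    rw [← eLpNorm_two_sq, ENNReal.ofReal_pow hM]
    exact pow_le_pow_left' (hE s hs) 2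
  have hw : ContDiff ℝ 1 fun x : Space => u (0, x) :=
    contDiffOn_univ.1 (hu.comp (contDiff_const.prodMk contDiff_id).contDiffOn
      fun x _ => mk_mem_halfSpace le_rfl x)
  obtain ⟨c, hc⟩ := exists_lintegral_sub_sq_le hw hL
  refine ⟨c, fun s hs => ?_⟩
  have h0 : ∫⁻ x in Metric.ball (0 : Space) L, ‖u (0, x) - c‖ₑ ^ 2
      ≤ ENNReal.ofReal (32 * L ^ 2 * M ^ 2) := by
    refine hc.trans ?_
    rw [ENNReal.ofReal_mul (by positivity : 0 ≤ 32 * L ^ 2)]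
    gcongr
    refine (setLIntegral_le_lintegral _ _).trans
      (le_trans (lintegral_mono fun x => ?_) (hgrad 0 ⟨le_rfl, ht⟩))
    rw [(hasFDerivAt_slice hu le_rfl x).fderiv]
    refine pow_le_pow_left' ?_ 2
    rw [enorm_le_iff_norm_le]
    exact norm_fderivWithin_comp_inr_le u (0, x)
  have hdc : ContinuousOn (partialDeriv 0 u) halfSpace := continuousOn_partialDeriv hu 0
  have h1 : ∫⁻ x : Space, ‖u (s, x) - u (0, x)‖ₑ ^ 2 ≤ ENNReal.ofReal (L ^ 2 * M ^ 2) := by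
    have hx : ∀ x : Space, ‖u (s, x) - u (0, x)‖ₑ ^ 2
        ≤ ENNReal.ofReal s * ∫⁻ r in Ioc 0 s, ‖partialDeriv 0 u (r, x)‖ₑ ^ 2 := by
      intro x
      have hmap : MapsTo (fun r : ℝ => ((r, x) : Spacetime)) (Icc 0 s) halfSpace :=
        fun r hr => mk_mem_halfSpace hr.1 x
      have hcl : ContinuousOn (fun r : ℝ => ((r, x) : Spacetime)) (Icc 0 s) := by fun_prop
      have hd0 := hdc.comp hcl hmap
      have e : u (s, x) - u (0, x) = ∫ r in Ioc 0 s, partialDeriv 0 u (r, x) := by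
        rw [← intervalIntegral.integral_of_le hs.1]
        refine (intervalIntegral.integral_eq_sub_of_hasDerivAt_of_le hs.1
          (f := fun r => u (r, x)) (hu.continuousOn.comp hcl hmap) (fun r hr => ?_) ?_).symm
        · have hd := hasFDerivAt_of_contDiffOn hu (p := (r, x)) hr.1
          have hl : HasDerivAt (fun r : ℝ => ((r, x) : Spacetime)) ((1 : ℝ), (0 : Space)) r :=
            (hasDerivAt_id r).prodMk (hasDerivAt_const r x)
          exact hd.comp_hasDerivAt r hl
        · refine ContinuousOn.intervalIntegrable ?_
          rw [uIcc_of_le hs.1]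
          exact hd0
      rw [e]
      exact enorm_setIntegral_Ioc_sq_le
        ((hd0.mono Ioc_subset_Icc_self).aestronglyMeasurable measurableSet_Ioc)
    have hmeas : AEMeasurable (Function.uncurry fun (x : Space) (r : ℝ) =>
        ‖partialDeriv 0 u (r, x)‖ₑ ^ 2) ((volume : Measure Space).prod
          (volume.restrict (Ioc 0 s))) := by
      have hcont : ContinuousOn (fun q : Space × ℝ => ‖partialDeriv 0 u (q.2, q.1)‖ₑ ^ 2)
          (univ ×ˢ Ioc 0 s) := by
        refine (ENNReal.continuous_pow 2).comp_continuousOn (ContinuousOn.enorm ?_)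
        exact hdc.comp (by fun_prop) fun q hq => mk_mem_halfSpace hq.2.1.le _
      have e : (volume : Measure Space).prod ((volume : Measure ℝ).restrict (Ioc 0 s))
          = ((volume : Measure Space).prod (volume : Measure ℝ)).restrict (univ ×ˢ Ioc 0 s) := by
        rw [← Measure.prod_restrict, Measure.restrict_univ]
      rw [e]
      exact hcont.aemeasurable (MeasurableSet.univ.prod measurableSet_Ioc)
    calc ∫⁻ x : Space, ‖u (s, x) - u (0, x)‖ₑ ^ 2
        ≤ ∫⁻ x : Space, ENNReal.ofReal s * ∫⁻ r in Ioc 0 s, ‖partialDeriv 0 u (r, x)‖ₑ ^ 2 :=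
          lintegral_mono hx
      _ = ENNReal.ofReal s * ∫⁻ r in Ioc 0 s, ∫⁻ x : Space, ‖partialDeriv 0 u (r, x)‖ₑ ^ 2 := by
          rw [lintegral_const_mul' _ _ ENNReal.ofReal_ne_top, lintegral_lintegral_swap hmeas]
      _ ≤ ENNReal.ofReal s * ∫⁻ r in Ioc 0 s, ENNReal.ofReal (M ^ 2) := by
          refine mul_le_mul' le_rfl ?_
          refine setLIntegral_mono measurable_const fun r hr => ?_
          refine le_trans (lintegral_mono fun x => ?_) (hgrad r ⟨hr.1.le, hr.2.trans hs.2⟩)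
          exact pow_le_pow_left' (enorm_partialDeriv_le u 0 _) 2
      _ = ENNReal.ofReal (s ^ 2 * M ^ 2) := by
          rw [lintegral_const, Measure.restrict_apply_univ, Real.volume_Ioc, sub_zero,
            ← ENNReal.ofReal_mul (by positivity), ← ENNReal.ofReal_mul hs.1]
          congr 1; ring
      _ ≤ _ := by
          refine ENNReal.ofReal_le_ofReal ?_
          gcongr
          · exact hs.1
          · exact hs.2.trans htL
  have hcs : ∀ r, 0 ≤ r → Continuous fun x : Space => u (r, x) := fun r hr =>
    continuous_slice hu.continuousOn hr
  calc ∫⁻ x in Metric.ball (0 : Space) L, ‖u (s, x) - c‖ₑ ^ 2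
      ≤ ∫⁻ x in Metric.ball (0 : Space) L,
          (2 * ‖u (s, x) - u (0, x)‖ₑ ^ 2 + 2 * ‖u (0, x) - c‖ₑ ^ 2) := by
        refine lintegral_mono fun x => ?_
        have h2 : ∀ a : ℝ, ‖a‖ₑ ^ 2 = ENNReal.ofReal (a ^ 2) := fun a => by
          rw [← ofReal_norm, ← ENNReal.ofReal_pow (norm_nonneg _), Real.norm_eq_abs, sq_abs]
        have h3 : (2 : ℝ≥0∞) = ENNReal.ofReal 2 := by simp
        rw [h2, h2, h2, h3, ← ENNReal.ofReal_mul (by norm_num), ← ENNReal.ofReal_mul (by norm_num),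
          ← ENNReal.ofReal_add (by positivity) (by positivity)]
        refine ENNReal.ofReal_le_ofReal ?_
        nlinarith [sq_nonneg ((u (s, x) - u (0, x)) - (u (0, x) - c))]
    _ = 2 * (∫⁻ x in Metric.ball (0 : Space) L, ‖u (s, x) - u (0, x)‖ₑ ^ 2)
          + 2 * ∫⁻ x in Metric.ball (0 : Space) L, ‖u (0, x) - c‖ₑ ^ 2 := by
        have m1 : Measurable fun x : Space => 2 * ‖u (s, x) - u (0, x)‖ₑ ^ 2 :=
          (((hcs s hs.1).sub (hcs 0 le_rfl)).enorm.measurable.pow_const 2).const_mul 2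
        rw [lintegral_add_left m1, lintegral_const_mul' _ _ (by simp),
          lintegral_const_mul' _ _ (by simp)]
    _ ≤ 2 * ENNReal.ofReal (L ^ 2 * M ^ 2) + 2 * ENNReal.ofReal (32 * L ^ 2 * M ^ 2) := by
        gcongr
        exact (setLIntegral_le_lintegral _ _).trans h1
    _ = _ := by
        have h3 : (2 : ℝ≥0∞) = ENNReal.ofReal 2 := by simp
        rw [h3, ← ENNReal.ofReal_mul (by norm_num), ← ENNReal.ofReal_mul (by norm_num),
          ← ENNReal.ofReal_add (by positivity) (by positivity)]
        congr 1; ring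

end Hardy

/-! ### The time-independent cutoff to a ball. -/

section BallWeight

/-- The weight `(1 - r² / ρ²)₊`, supported in a ball. -/
def ballWeight (ρ : ℝ) (p : Spacetime) : ℝ := max (1 - rsq p / ρ ^ 2) 0

lemma continuous_ballWeight (ρ : ℝ) : Continuous (ballWeight ρ) :=
  (continuous_const.sub (contDiff_rsq (n := 1).continuous.div_const _)).max continuous_const

lemma contDiff_ballWeight_sq (ρ : ℝ) : ContDiff ℝ 1 fun p => ballWeight ρ p ^ 2 :=
  contDiff_max_zero_sq.comp (contDiff_const.sub (contDiff_rsq.div_const (ρ ^ 2)))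

lemma ballWeight_nonneg (ρ : ℝ) (p : Spacetime) : 0 ≤ ballWeight ρ p := le_max_right _ _

lemma ballWeight_le_one (ρ : ℝ) (p : Spacetime) : ballWeight ρ p ≤ 1 := by
  refine max_le ?_ zero_le_one
  have : 0 ≤ rsq p / ρ ^ 2 := div_nonneg (rsq_nonneg p) (sq_nonneg ρ)
  linarith

lemma ballWeight_eq_zero {ρ : ℝ} (hρ : 0 < ρ) {p : Spacetime} (hp : ρ ^ 2 ≤ rsq p) :
    ballWeight ρ p = 0 := by
  refine max_eq_right ?_
  rw [sub_nonpos, one_le_div (by positivity)]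
  exact hp

lemma spatialSupport_ballWeight {ρ : ℝ} (hρ : 0 < ρ) : SpatialSupport ρ (ballWeight ρ) :=
  fun _ _ hx => ballWeight_eq_zero hρ (pow_le_pow_left₀ hρ.le hx.le 2)

lemma spatialSupport_ballWeight_sq {ρ : ℝ} (hρ : 0 < ρ) :
    SpatialSupport ρ fun p => ballWeight ρ p ^ 2 := fun p hp hx => by
  simp [spatialSupport_ballWeight hρ p hp hx]

/-- On the ball of radius ρ the wider cutoff is at least 3/4, and 2·(3/4)² = 9/8. This lets errors
carrying too few factors of the narrow cutoff be absorbed by the wide one. -/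
lemma one_le_two_mul_ballWeight_sq {ρ : ℝ} (hρ : 0 < ρ) {p : Spacetime} (hp : rsq p ≤ ρ ^ 2) :
    1 ≤ 2 * ballWeight (2 * ρ) p ^ 2 := by
  have h1 : rsq p / (2 * ρ) ^ 2 ≤ 1 / 4 := by
    rw [div_le_iff₀ (by positivity)]; linarith
  have h2 : 3 / 4 ≤ ballWeight (2 * ρ) p := le_max_of_le_left (by linarith)
  nlinarith

lemma hasDerivAt_ballWeight_profile (ρ y : ℝ) :
    HasDerivAt (fun y => max (1 - y / ρ ^ 2) 0 ^ 2)
      (-(2 / ρ ^ 2 * max (1 - y / ρ ^ 2) 0)) y := by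
  have h1 : HasDerivAt (fun y : ℝ => 1 - y / ρ ^ 2) (-(1 / ρ ^ 2)) y :=
    ((hasDerivAt_id y).div_const _).const_sub 1
  have h2 := (hasDerivAt_max_zero_sq (1 - y / ρ ^ 2)).comp y h1
  refine h2.congr_deriv ?_
  ring

lemma partialDeriv_zero_ballWeight_sq (ρ : ℝ) {p : Spacetime} (hp : p ∈ halfSpace) :
    partialDeriv 0 (fun p => ballWeight ρ p ^ 2) p = 0 :=
  partialDeriv_zero_radial hp (hasDerivAt_ballWeight_profile ρ (rsq p))

lemma partialDeriv_succ_ballWeight_sq (ρ : ℝ) {p : Spacetime} (hp : p ∈ halfSpace) (i : Fin 3) :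
    partialDeriv i.succ (fun p => ballWeight ρ p ^ 2) p
      = -(4 / ρ ^ 2 * ballWeight ρ p * coord i p) := by
  rw [show (fun p => ballWeight ρ p ^ 2) = fun p => max (1 - rsq p / ρ ^ 2) 0 ^ 2 from rfl,
    partialDeriv_succ_radial hp (hasDerivAt_ballWeight_profile ρ (rsq p))]
  unfold ballWeight
  ring

end BallWeight

/-! ### Hardy's inequality with a cutoff. -/

section Hardy

variable {w : Spacetime → ℝ}

/-- The radial part `x · ∇w` of the gradient. -/
def radialDeriv (w : Spacetime → ℝ) (p : Spacetime) : ℝ :=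
  ∑ i : Fin 3, coord i p * partialDeriv i.succ w p

/-- The spatial part `|∇w|²` of the energy density. -/
def spatialDensity (w : Spacetime → ℝ) (p : Spacetime) : ℝ :=
  ∑ i : Fin 3, partialDeriv i.succ w p ^ 2

lemma spatialDensity_nonneg (w : Spacetime → ℝ) (p : Spacetime) : 0 ≤ spatialDensity w p :=
  Finset.sum_nonneg fun _ _ => sq_nonneg _

lemma energyDensity_eq (w : Spacetime → ℝ) (p : Spacetime) :
    energyDensity w p = partialDeriv 0 w p ^ 2 + spatialDensity w p := by
  rw [energyDensity, Fin.sum_univ_succ, spatialDensity]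

lemma spatialDensity_le (w : Spacetime → ℝ) (p : Spacetime) :
    spatialDensity w p ≤ energyDensity w p := by
  rw [energyDensity_eq]; exact le_add_of_nonneg_left (sq_nonneg _)

lemma radialDeriv_sq_le (w : Spacetime → ℝ) (p : Spacetime) :
    radialDeriv w p ^ 2 ≤ rsq p * spatialDensity w p := by
  rw [rsq_eq]
  exact Finset.sum_mul_sq_le_sq_mul_sq _ _ _

lemma hasDerivAt_inv_one_add {y : ℝ} (hy : 0 ≤ y) :
    HasDerivAt (fun y : ℝ => (1 + y)⁻¹) (-((1 + y)⁻¹ ^ 2)) y := by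
  have h0 : 1 + y ≠ 0 := by positivity
  refine (((hasDerivAt_id y).const_add 1).inv h0).congr_deriv ?_
  simp [div_eq_mul_inv]

lemma contDiff_inv_one_add_rsq : ContDiff ℝ 1 fun p : Spacetime => (1 + rsq p)⁻¹ :=
  (contDiff_const.add contDiff_rsq).inv fun p => by have := rsq_nonneg p; positivity

/-- The current in the proof of Hardy's inequality. -/
def hardyCurrent (L : ℝ) (w : Spacetime → ℝ) (i : Fin 3) (p : Spacetime) : ℝ :=
  ballWeight L p ^ 2 * (coord i p * ((1 + rsq p)⁻¹ * w p ^ 2))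

lemma contDiffOn_hardyCurrent (L : ℝ) (hw : ContDiffOn ℝ 1 w halfSpace) (i : Fin 3) :
    ContDiffOn ℝ 1 (hardyCurrent L w i) halfSpace :=
  (contDiff_ballWeight_sq L).contDiffOn.mul ((contDiff_coord i).contDiffOn.mul
    (contDiff_inv_one_add_rsq.contDiffOn.mul (hw.pow 2)))

lemma divergence_hardyCurrent (L : ℝ) (hw : ContDiffOn ℝ 1 w halfSpace) {p : Spacetime}
    (hp : p ∈ halfSpace) :
    ∑ i : Fin 3, partialDeriv i.succ (hardyCurrent L w i) p
      = -(4 / L ^ 2 * ballWeight L p * rsq p * (1 + rsq p)⁻¹ * w p ^ 2)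
        + ballWeight L p ^ 2 * (3 * (1 + rsq p)⁻¹ - 2 * rsq p * (1 + rsq p)⁻¹ ^ 2) * w p ^ 2
        + 2 * ballWeight L p ^ 2 * (1 + rsq p)⁻¹ * w p * radialDeriv w p := by
  have hwd : DifferentiableWithinAt ℝ w halfSpace p := hw.differentiableOn one_ne_zero p hp
  have hkd : DifferentiableWithinAt ℝ (fun p : Spacetime => (1 + rsq p)⁻¹) halfSpace p :=
    (contDiff_inv_one_add_rsq.differentiable one_ne_zero p).differentiableWithinAt
  have hbd : DifferentiableWithinAt ℝ (fun p => ballWeight L p ^ 2) halfSpace p :=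
    ((contDiff_ballWeight_sq L).differentiable one_ne_zero p).differentiableWithinAt
  have hi : ∀ i : Fin 3, partialDeriv i.succ (hardyCurrent L w i) p
      = ballWeight L p ^ 2 * (coord i p * ((1 + rsq p)⁻¹ * (2 * w p * partialDeriv i.succ w p)
            + 2 * (-((1 + rsq p)⁻¹ ^ 2)) * coord i p * w p ^ 2) + (1 + rsq p)⁻¹ * w p ^ 2)
        + -(4 / L ^ 2 * ballWeight L p * coord i p)
          * (coord i p * ((1 + rsq p)⁻¹ * w p ^ 2)) := by
    intro i
    have hx := differentiableWithinAt_coord i p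
    unfold hardyCurrent
    rw [partialDeriv_mul hp hbd (hx.fun_mul (hkd.fun_mul (hwd.fun_pow 2))),
      partialDeriv_mul hp hx (hkd.fun_mul (hwd.fun_pow 2)),
      partialDeriv_mul hp hkd (hwd.fun_pow 2), partialDeriv_coord i hp,
      partialDeriv_succ_ballWeight_sq L hp,
      partialDeriv_comp (h := fun a => a ^ 2) hp (hasDerivAt_pow 2 _) hwd,
      partialDeriv_succ_radial hp (hasDerivAt_inv_one_add (rsq_nonneg p))]
    simp
  simp only [hi, radialDeriv, Fin.sum_univ_three, rsq_eq p]
  ring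

/-- Hardy's inequality on a ball, with a remainder of order zero. -/
lemma hardy_inequality {L : ℝ} (hL : 0 < L) (hw : ContDiffOn ℝ 1 w halfSpace) {s : ℝ}
    (hs : 0 ≤ s) :
    ∫ x : Space, ballWeight L (s, x) ^ 2 * ((1 + rsq (s, x))⁻¹ * w (s, x) ^ 2)
      ≤ 8 / L ^ 2 * (∫ x : Space, ballWeight L (s, x) * w (s, x) ^ 2)
        + 4 * ∫ x : Space, ballWeight L (s, x) ^ 2 * spatialDensity w (s, x) := by
  have hb := spatialSupport_ballWeight_sq hL
  have hbc := (contDiff_ballWeight_sq L).continuous.continuousOn (s := halfSpace)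
  have hkc := contDiff_inv_one_add_rsq.continuous.continuousOn (s := halfSpace)
  have hVc : ContinuousOn (spatialDensity w) halfSpace :=
    continuousOn_finsetSum _ fun i _ => (continuousOn_partialDeriv hw i.succ).pow 2
  have hJs : ∀ i, SpatialSupport L (hardyCurrent L w i) := fun i => hb.mul_left _
  have hJ := fun i => contDiffOn_hardyCurrent L hw i
  have hdi : ∀ i : Fin 3, Integrable fun x : Space =>
      partialDeriv i.succ (hardyCurrent L w i) (s, x) := fun i =>
    ((hJs i).partialDeriv i.succ).integrable_slice (continuousOn_partialDeriv (hJ i) _) hs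
  have hz : ∫ x : Space, ∑ i : Fin 3, partialDeriv i.succ (hardyCurrent L w i) (s, x) = 0 := by
    rw [integral_finsetSum _ fun i _ => hdi i]
    exact Finset.sum_eq_zero fun i _ => integral_partialDeriv_succ_eq_zero (hJs i) (hJ i) i hs
  have i1 := (hb.mul_left fun p => (1 + rsq p)⁻¹ * w p ^ 2).integrable_slice
    (hbc.mul (hkc.mul (hw.continuousOn.pow 2))) hs
  have i2 := ((spatialSupport_ballWeight hL).mul_left fun p => w p ^ 2).integrable_slice
    ((continuous_ballWeight L).continuousOn.mul (hw.continuousOn.pow 2)) hs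
  have i3 := (hb.mul_left (spatialDensity w)).integrable_slice (hbc.mul hVc) hs
  -- With k = (1 + r²)⁻¹ one has div(kx) = k + 2k² ≥ k. Half of k w² survives after 2kw(x·∇w) is
  -- completed to the square `h4`; the remaining 2k(x·∇w)² is at most 2|∇w|².
  have hpt : ∀ x : Space,
      2⁻¹ * (ballWeight L (s, x) ^ 2 * ((1 + rsq (s, x))⁻¹ * w (s, x) ^ 2))
      ≤ ∑ i : Fin 3, partialDeriv i.succ (hardyCurrent L w i) (s, x)
        + (4 / L ^ 2 * (ballWeight L (s, x) * w (s, x) ^ 2)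
        + 2 * (ballWeight L (s, x) ^ 2 * spatialDensity w (s, x))) := by
    intro x
    set p : Spacetime := (s, x) with hp
    rw [divergence_hardyCurrent L hw (mk_mem_halfSpace hs x)]
    have hX := radialDeriv_sq_le w p
    have hr := rsq_nonneg p
    have hV := spatialDensity_nonneg w p
    set m := ballWeight L p
    set V := spatialDensity w p
    set X := radialDeriv w p
    set k := (1 + rsq p)⁻¹ with hk
    have hm : 0 ≤ m := ballWeight_nonneg L p
    have hk0 : 0 ≤ k := by positivity
    have hk1 : rsq p * k = 1 - k := by rw [hk]; field_simp; ring
    have hkr : rsq p * k ≤ 1 := by linarith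
    have e1 : 4 / L ^ 2 * m * rsq p * k * w p ^ 2 ≤ 4 / L ^ 2 * (m * w p ^ 2) := by
      have : 0 ≤ 4 / L ^ 2 * (m * w p ^ 2) := by positivity
      calc _ = (4 / L ^ 2 * (m * w p ^ 2)) * (rsq p * k) := by ring
        _ ≤ _ := mul_le_of_le_one_right this hkr
    have hkX : k * X ^ 2 ≤ V := by
      calc k * X ^ 2 ≤ k * (rsq p * V) := by gcongr
        _ = (rsq p * k) * V := by ring
        _ ≤ V := mul_le_of_le_one_left hV hkr
    have e2 : 2⁻¹ * (k * w p ^ 2)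
        ≤ (3 * k - 2 * rsq p * k ^ 2) * w p ^ 2 + 2 * k * w p * X + 2 * V := by
      have h3 : 2 * rsq p * k ^ 2 = 2 * k - 2 * k * k := by
        rw [show 2 * rsq p * k ^ 2 = 2 * k * (rsq p * k) by ring, hk1]; ring
      rw [h3]
      have h4 : 0 ≤ k * (w p + 2 * X) ^ 2 := by positivity
      have h5 : 0 ≤ k * k * w p ^ 2 := by positivity
      nlinarith
    have e3 := mul_le_mul_of_nonneg_left e2 (sq_nonneg m)
    linarith
  have i4 : Integrable fun x : Space => 4 / L ^ 2 * (ballWeight L (s, x) * w (s, x) ^ 2)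
      + 2 * (ballWeight L (s, x) ^ 2 * spatialDensity w (s, x)) :=
    (i2.const_mul _).add (i3.const_mul _)
  have i5 : Integrable fun x : Space =>
      ∑ i : Fin 3, partialDeriv i.succ (hardyCurrent L w i) (s, x)
      + (4 / L ^ 2 * (ballWeight L (s, x) * w (s, x) ^ 2)
      + 2 * (ballWeight L (s, x) ^ 2 * spatialDensity w (s, x))) :=
    (integrable_finsetSum _ fun i _ => hdi i).add i4
  have hint := integral_mono (i1.const_mul 2⁻¹) i5 hpt
  rw [integral_add (integrable_finsetSum _ fun i _ => hdi i) i4, hz, integral_const_mul,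
    integral_add (i2.const_mul _) (i3.const_mul _), integral_const_mul, integral_const_mul] at hint
  have : 8 / L ^ 2 = 2 * (4 / L ^ 2) := by ring
  rw [this]
  linarith

end Hardy

/-! ### The Morawetz current and its divergence. -/

section Morawetz

variable {w : Spacetime → ℝ}

/-- The function `(R² + r²)^{-1/2}`. -/
def multiplier (R : ℝ) (p : Spacetime) : ℝ := (√(R ^ 2 + rsq p))⁻¹

lemma multiplier_pos {R : ℝ} (hR : 0 < R) (p : Spacetime) : 0 < multiplier R p := by
  have := rsq_nonneg p
  unfold multiplier; positivity

lemma multiplier_sq {R : ℝ} (hR : 0 < R) (p : Spacetime) :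
    multiplier R p ^ 2 * (R ^ 2 + rsq p) = 1 := by
  have h : 0 < R ^ 2 + rsq p := by have := rsq_nonneg p; positivity
  rw [multiplier, inv_pow, Real.sq_sqrt h.le, inv_mul_cancel₀ h.ne']

lemma contDiff_multiplier {R : ℝ} (hR : 0 < R) : ContDiff ℝ 1 (multiplier R) := by
  have h : ∀ p, 0 < R ^ 2 + rsq p := fun p => by have := rsq_nonneg p; positivity
  exact ((contDiff_const.add contDiff_rsq).sqrt fun p => (h p).ne').inv
    fun p => (Real.sqrt_pos.2 (h p)).ne'

lemma partialDeriv_succ_multiplier {R : ℝ} (hR : 0 < R) {p : Spacetime} (hp : p ∈ halfSpace)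
    (i : Fin 3) :
    partialDeriv i.succ (multiplier R) p = -(coord i p * multiplier R p ^ 3) := by
  have h : 0 < R ^ 2 + rsq p := by have := rsq_nonneg p; positivity
  have hs : 0 < √(R ^ 2 + rsq p) := Real.sqrt_pos.2 h
  have hd : HasDerivAt (fun y => (√(R ^ 2 + y))⁻¹) (-(2⁻¹ * (√(R ^ 2 + rsq p))⁻¹ ^ 3)) (rsq p) := by
    refine ((((hasDerivAt_id (rsq p)).const_add (R ^ 2)).sqrt h.ne').inv hs.ne').congr_deriv ?_
    simp only [id]
    field_simp
  rw [show multiplier R = fun p => (√(R ^ 2 + rsq p))⁻¹ from rfl, partialDeriv_succ_radial hp hd]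
  ring

lemma partialDeriv_zero_multiplier {R : ℝ} (hR : 0 < R) {p : Spacetime} (hp : p ∈ halfSpace) :
    partialDeriv 0 (multiplier R) p = 0 := by
  have h : 0 < R ^ 2 + rsq p := by have := rsq_nonneg p; positivity
  exact partialDeriv_zero_radial (h := fun y => (√(R ^ 2 + y))⁻¹) hp
    ((((hasDerivAt_id (rsq p)).const_add (R ^ 2)).sqrt h.ne').inv (Real.sqrt_pos.2 h).ne')

lemma contDiffOn_radialDeriv (hw : ContDiffOn ℝ 2 w halfSpace) :
    ContDiffOn ℝ 1 (radialDeriv w) halfSpace :=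
  ContDiffOn.sum fun i _ => (contDiff_coord i).contDiffOn.mul
    (contDiffOn_partialDeriv (n := 1) hw i.succ)

lemma contDiffOn_spatialDensity (hw : ContDiffOn ℝ 2 w halfSpace) :
    ContDiffOn ℝ 1 (spatialDensity w) halfSpace :=
  ContDiffOn.sum fun i _ => (contDiffOn_partialDeriv (n := 1) hw i.succ).pow 2

lemma partialDeriv_spatialDensity (hw : ContDiffOn ℝ 2 w halfSpace) {p : Spacetime}
    (hp : p ∈ halfSpace) (μ : Fin 4) :
    partialDeriv μ (spatialDensity w) p
      = ∑ j : Fin 3, 2 * partialDeriv j.succ w p * partialDeriv μ (partialDeriv j.succ w) p := by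
  have hd : ∀ μ, DifferentiableWithinAt ℝ (partialDeriv μ w) halfSpace p := fun μ =>
    differentiableWithinAt_of_contDiffOn (n := 0) (contDiffOn_partialDeriv (n := 1) hw μ) hp
  unfold spatialDensity
  rw [partialDeriv_sum _ hp fun j _ => (hd j.succ).fun_pow 2]
  refine Finset.sum_congr rfl fun j _ => ?_
  rw [partialDeriv_comp (h := fun a => a ^ 2) hp (hasDerivAt_pow 2 _) (hd j.succ)]
  simp

lemma partialDeriv_radialDeriv (hw : ContDiffOn ℝ 2 w halfSpace) {p : Spacetime}
    (hp : p ∈ halfSpace) (μ : Fin 4) :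
    partialDeriv μ (radialDeriv w) p
      = ∑ j : Fin 3, (coord j p * partialDeriv μ (partialDeriv j.succ w) p
          + (if μ = j.succ then 1 else 0) * partialDeriv j.succ w p) := by
  have hd : ∀ μ, DifferentiableWithinAt ℝ (partialDeriv μ w) halfSpace p := fun μ =>
    differentiableWithinAt_of_contDiffOn (n := 0) (contDiffOn_partialDeriv (n := 1) hw μ) hp
  unfold radialDeriv
  rw [partialDeriv_sum _ hp fun j _ => (differentiableWithinAt_coord j p).fun_mul (hd j.succ)]
  refine Finset.sum_congr rfl fun j _ => ?_
  rw [partialDeriv_mul hp (differentiableWithinAt_coord j p) (hd j.succ), partialDeriv_coord j hp]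

/-- The current of the Morawetz multiplier `(R² + r²)^{-1/2} (x · ∇ + 1)`, localized to a ball. -/
def morawetzCurrent (ρ R : ℝ) (w : Spacetime → ℝ) : Fin 4 → Spacetime → ℝ :=
  Fin.cases
    (fun p => ballWeight ρ p ^ 2
      * (partialDeriv 0 w p * (multiplier R p * (radialDeriv w p + w p))))
    (fun i p => ballWeight ρ p ^ 2
      * (coord i p * (multiplier R p * (2⁻¹ * (spatialDensity w p - partialDeriv 0 w p ^ 2)))
        - partialDeriv i.succ w p * (multiplier R p * (radialDeriv w p + w p))
        - coord i p * (multiplier R p ^ 3 * (2⁻¹ * w p ^ 2))))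

lemma contDiffOn_morawetzCurrent (ρ : ℝ) {R : ℝ} (hR : 0 < R) (hw : ContDiffOn ℝ 2 w halfSpace)
    (μ : Fin 4) : ContDiffOn ℝ 1 (morawetzCurrent ρ R w μ) halfSpace := by
  have hb := (contDiff_ballWeight_sq ρ).contDiffOn (s := halfSpace)
  have hg := (contDiff_multiplier hR).contDiffOn (s := halfSpace)
  have hd : ∀ μ, ContDiffOn ℝ 1 (partialDeriv μ w) halfSpace := fun μ =>
    contDiffOn_partialDeriv (n := 1) hw μ
  have h1 : ContDiffOn ℝ 1 w halfSpace := hw.of_le (by norm_num)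
  have hA := hg.mul ((contDiffOn_radialDeriv hw).add h1)
  refine Fin.cases ?_ (fun i => ?_) μ
  · exact hb.mul ((hd 0).mul hA)
  · have hx := (contDiff_coord i (n := 1)).contDiffOn (s := halfSpace)
    exact hb.mul (((hx.mul (hg.mul (contDiffOn_const.mul
      ((contDiffOn_spatialDensity hw).sub ((hd 0).pow 2))))).sub ((hd i.succ).mul hA)).sub
      (hx.mul ((hg.pow 3).mul (contDiffOn_const.mul (h1.pow 2)))))

/-- The last term of the spatial current, which is w²∇g/2, cancels the cross term w ∇g·∇w and leaves
w²Δg/2. This has a sign, since Δg = -3R²g⁵. The final group of terms comes from differentiating the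
cutoff. -/
lemma divergence_morawetzCurrent (ρ : ℝ) {R : ℝ} (hR : 0 < R) (hw : ContDiffOn ℝ 2 w halfSpace)
    {p : Spacetime} (hp : p ∈ halfSpace) :
    ∑ μ, partialDeriv μ (morawetzCurrent ρ R w μ) p
      = ballWeight ρ p ^ 2 * (multiplier R p * (radialDeriv w p + w p) * box w p
          + multiplier R p * partialDeriv 0 w p ^ 2
          + 2⁻¹ * (3 * multiplier R p - rsq p * multiplier R p ^ 3)
            * (spatialDensity w p - partialDeriv 0 w p ^ 2)
          + multiplier R p ^ 3 * radialDeriv w p ^ 2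
          - 2 * multiplier R p * spatialDensity w p
          - 3 / 2 * multiplier R p ^ 3 * w p ^ 2
          + 3 / 2 * rsq p * multiplier R p ^ 5 * w p ^ 2)
        - 4 / ρ ^ 2 * ballWeight ρ p
          * (2⁻¹ * multiplier R p * rsq p * (spatialDensity w p - partialDeriv 0 w p ^ 2)
            - multiplier R p * radialDeriv w p * (radialDeriv w p + w p)
            - 2⁻¹ * rsq p * multiplier R p ^ 3 * w p ^ 2) := by
  have hd : ∀ μ, DifferentiableWithinAt ℝ (partialDeriv μ w) halfSpace p := fun μ =>
    differentiableWithinAt_of_contDiffOn (n := 0) (contDiffOn_partialDeriv (n := 1) hw μ) hp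
  have hwd : DifferentiableWithinAt ℝ w halfSpace p :=
    differentiableWithinAt_of_contDiffOn (n := 1) hw hp
  have hbd : DifferentiableWithinAt ℝ (fun p => ballWeight ρ p ^ 2) halfSpace p :=
    ((contDiff_ballWeight_sq ρ).differentiable one_ne_zero p).differentiableWithinAt
  have hg : DifferentiableWithinAt ℝ (multiplier R) halfSpace p :=
    ((contDiff_multiplier hR).differentiable one_ne_zero p).differentiableWithinAt
  have hX : DifferentiableWithinAt ℝ (radialDeriv w) halfSpace p :=
    differentiableWithinAt_of_contDiffOn (n := 0) (contDiffOn_radialDeriv hw) hp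
  have hV : DifferentiableWithinAt ℝ (spatialDensity w) halfSpace p :=
    differentiableWithinAt_of_contDiffOn (n := 0) (contDiffOn_spatialDensity hw) hp
  have hXw := hX.fun_add hwd
  have hA := hg.fun_mul hXw
  have hcm : ∀ (c : ℝ) {f : Spacetime → ℝ}, DifferentiableWithinAt ℝ f halfSpace p →
      ∀ μ, partialDeriv μ (fun q => c * f q) p = c * partialDeriv μ f p :=
    fun c f hf μ => partialDeriv_const_smul c hp hf μ
  have hpow : ∀ (n : ℕ) {f : Spacetime → ℝ}, DifferentiableWithinAt ℝ f halfSpace p →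
      ∀ μ, partialDeriv μ (fun q => f q ^ n) p = n * f p ^ (n - 1) * partialDeriv μ f p :=
    fun n f hf μ => partialDeriv_comp (h := fun a => a ^ n) hp (hasDerivAt_pow n _) hf μ
  have hB := hV.fun_sub ((hd 0).fun_pow 2)
  have h0 : partialDeriv 0 (morawetzCurrent ρ R w 0) p
      = ballWeight ρ p ^ 2 * (partialDeriv 0 w p
          * (multiplier R p * ((∑ j : Fin 3, coord j p * partialDeriv 0 (partialDeriv j.succ w) p)
            + partialDeriv 0 w p))
        + partialDeriv 0 (partialDeriv 0 w) p * (multiplier R p * (radialDeriv w p + w p))) := by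
    change partialDeriv 0 (fun p => ballWeight ρ p ^ 2
      * (partialDeriv 0 w p * (multiplier R p * (radialDeriv w p + w p)))) p = _
    rw [partialDeriv_mul hp hbd ((hd 0).fun_mul hA), partialDeriv_zero_ballWeight_sq ρ hp,
      partialDeriv_mul hp (hd 0) hA, partialDeriv_mul hp hg hXw,
      partialDeriv_zero_multiplier hR hp, partialDeriv_add hp hX hwd,
      partialDeriv_radialDeriv hw hp]
    simp [(Fin.succ_ne_zero _).symm]
  have hi : ∀ i : Fin 3, partialDeriv i.succ (morawetzCurrent ρ R w i.succ) p
      = ballWeight ρ p ^ 2 *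
          (coord i p * (multiplier R p * (2⁻¹ * ((∑ j : Fin 3, 2 * partialDeriv j.succ w p
                * partialDeriv i.succ (partialDeriv j.succ w) p)
              - 2 * partialDeriv 0 w p * partialDeriv 0 (partialDeriv i.succ w) p))
            + -(coord i p * multiplier R p ^ 3)
              * (2⁻¹ * (spatialDensity w p - partialDeriv 0 w p ^ 2)))
          + multiplier R p * (2⁻¹ * (spatialDensity w p - partialDeriv 0 w p ^ 2))
          - (partialDeriv i.succ w p * (multiplier R p
              * ((∑ j : Fin 3, coord j p * partialDeriv i.succ (partialDeriv j.succ w) p)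
                + partialDeriv i.succ w p + partialDeriv i.succ w p)
              + -(coord i p * multiplier R p ^ 3) * (radialDeriv w p + w p))
            + partialDeriv i.succ (partialDeriv i.succ w) p
              * (multiplier R p * (radialDeriv w p + w p)))
          - (coord i p * (multiplier R p ^ 3 * (2⁻¹ * (2 * w p * partialDeriv i.succ w p))
            + 3 * multiplier R p ^ 2 * -(coord i p * multiplier R p ^ 3) * (2⁻¹ * w p ^ 2))
            + multiplier R p ^ 3 * (2⁻¹ * w p ^ 2)))
        + -(4 / ρ ^ 2 * ballWeight ρ p * coord i p)
          * (coord i p * (multiplier R p * (2⁻¹ * (spatialDensity w p - partialDeriv 0 w p ^ 2)))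
            - partialDeriv i.succ w p * (multiplier R p * (radialDeriv w p + w p))
            - coord i p * (multiplier R p ^ 3 * (2⁻¹ * w p ^ 2))) := by
    intro i
    have hx := differentiableWithinAt_coord i p
    have hgB := hg.fun_mul (hB.const_mul 2⁻¹)
    have hgw := (hg.fun_pow 3).fun_mul ((hwd.fun_pow 2).const_mul 2⁻¹)
    change partialDeriv i.succ (fun p => ballWeight ρ p ^ 2
      * (coord i p * (multiplier R p * (2⁻¹ * (spatialDensity w p - partialDeriv 0 w p ^ 2)))
        - partialDeriv i.succ w p * (multiplier R p * (radialDeriv w p + w p))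
        - coord i p * (multiplier R p ^ 3 * (2⁻¹ * w p ^ 2)))) p = _
    rw [partialDeriv_mul hp hbd
        (((hx.fun_mul hgB).fun_sub ((hd i.succ).fun_mul hA)).fun_sub (hx.fun_mul hgw)),
      partialDeriv_succ_ballWeight_sq ρ hp,
      partialDeriv_sub hp ((hx.fun_mul hgB).fun_sub ((hd i.succ).fun_mul hA)) (hx.fun_mul hgw),
      partialDeriv_sub hp (hx.fun_mul hgB) ((hd i.succ).fun_mul hA),
      partialDeriv_mul hp hx hgB, partialDeriv_mul hp hg (hB.const_mul 2⁻¹),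
      hcm _ hB, partialDeriv_sub hp hV ((hd 0).fun_pow 2), hpow 2 (hd 0),
      partialDeriv_spatialDensity hw hp, partialDeriv_comm hw i.succ 0 hp,
      partialDeriv_mul hp (hd i.succ) hA, partialDeriv_mul hp hg hXw, partialDeriv_add hp hX hwd,
      partialDeriv_radialDeriv hw hp, partialDeriv_mul hp hx hgw,
      partialDeriv_mul hp (hg.fun_pow 3) ((hwd.fun_pow 2).const_mul 2⁻¹), hpow 3 hg,
      hcm _ (hwd.fun_pow 2), hpow 2 hwd, partialDeriv_succ_multiplier hR hp,
      partialDeriv_coord i hp, Finset.sum_add_distrib]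
    simp
  have hsym : ∀ i j : Fin 3, partialDeriv i.succ (partialDeriv j.succ w) p
      = partialDeriv j.succ (partialDeriv i.succ w) p := fun i j => partialDeriv_comm hw _ _ hp
  rw [Fin.sum_univ_succ, h0]
  simp only [hi, box]
  have hXe : radialDeriv w p = ∑ i : Fin 3, coord i p * partialDeriv i.succ w p := rfl
  have hVe : spatialDensity w p = ∑ i : Fin 3, partialDeriv i.succ w p ^ 2 := rfl
  rw [hXe, hVe, rsq_eq]
  simp only [Fin.sum_univ_three]
  -- Mixed second derivatives are independent atoms for `ring`, so they are first put in one order.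
  rw [hsym 1 0, hsym 2 0, hsym 2 1]
  ring

end Morawetz

/-! ### Linearity and monotonicity of integrals over the slab. -/

section SlabIntegral

/-- Continuous functions on the half space whose support is bounded in space. -/
def SlabFunction (f : Spacetime → ℝ) : Prop :=
  ContinuousOn f halfSpace ∧ ∃ ρ, SpatialSupport ρ f

/-- The integral over the slab `[0, t] × ℝ³`. -/
def slabIntegral (t : ℝ) (f : Spacetime → ℝ) : ℝ := ∫ s in (0 : ℝ)..t, ∫ x : Space, f (s, x)

lemma SlabFunction.integrable_slice {f : Spacetime → ℝ} (hf : SlabFunction f) {s : ℝ}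
    (hs : 0 ≤ s) : Integrable fun x : Space => f (s, x) :=
  hf.2.choose_spec.integrable_slice hf.1 hs

lemma SlabFunction.intervalIntegrable {f : Spacetime → ℝ} (hf : SlabFunction f) {t : ℝ}
    (ht : 0 ≤ t) : IntervalIntegrable (fun s => ∫ x : Space, f (s, x)) volume 0 t :=
  hf.2.choose_spec.intervalIntegrable hf.1 ht

lemma SlabFunction.const_mul {f : Spacetime → ℝ} (hf : SlabFunction f) (c : ℝ) :
    SlabFunction fun p => c * f p :=
  ⟨continuousOn_const.mul hf.1, hf.2.choose, fun p hp hx => by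
    simp [hf.2.choose_spec p hp hx]⟩

lemma SlabFunction.add {f g : Spacetime → ℝ} (hf : SlabFunction f) (hg : SlabFunction g) :
    SlabFunction fun p => f p + g p :=
  ⟨hf.1.add hg.1, max hf.2.choose hg.2.choose, fun p hp hx => by
    simp [hf.2.choose_spec p hp ((le_max_left _ _).trans_lt hx),
      hg.2.choose_spec p hp ((le_max_right _ _).trans_lt hx)]⟩

lemma slabIntegral_const_mul (t c : ℝ) (f : Spacetime → ℝ) :
    slabIntegral t (fun p => c * f p) = c * slabIntegral t f := by
  simp only [slabIntegral, integral_const_mul, intervalIntegral.integral_const_mul]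

lemma slabIntegral_add {f g : Spacetime → ℝ} (hf : SlabFunction f) (hg : SlabFunction g) {t : ℝ}
    (ht : 0 ≤ t) :
    slabIntegral t (fun p => f p + g p) = slabIntegral t f + slabIntegral t g := by
  rw [slabIntegral, slabIntegral, slabIntegral, ← intervalIntegral.integral_add
    (hf.intervalIntegrable ht) (hg.intervalIntegrable ht)]
  refine intervalIntegral.integral_congr fun s hs => ?_
  rw [uIcc_of_le ht] at hs
  exact integral_add (hf.integrable_slice hs.1) (hg.integrable_slice hs.1)

lemma slabIntegral_mono {f g : Spacetime → ℝ} (hf : SlabFunction f) (hg : SlabFunction g)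
    (h : ∀ p ∈ halfSpace, f p ≤ g p) {t : ℝ} (ht : 0 ≤ t) :
    slabIntegral t f ≤ slabIntegral t g :=
  hf.2.choose_spec.integral_mono hf.1 hg.2.choose_spec hg.1 h ht

lemma slabIntegral_le_of_slice_le {f : Spacetime → ℝ} (hf : SlabFunction f) {t c : ℝ} (ht : 0 ≤ t)
    (h : ∀ s ∈ Icc 0 t, ∫ x : Space, f (s, x) ≤ c) : slabIntegral t f ≤ t * c := by
  have := intervalIntegral.integral_mono_on ht (hf.intervalIntegrable ht)
    (intervalIntegrable_const (c := c)) h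
  simpa [slabIntegral] using this

end SlabIntegral

/-! ### Pointwise inequalities for the Morawetz divergence. -/

section Morawetz

variable {w : Spacetime → ℝ}

/-- Lower bound for the terms in which the cutoff is differentiated. -/
lemma morawetz_cutoff_terms {g k R ρ r2 a V X w : ℝ} (hR : 1 ≤ R) (hρ : 1 ≤ ρ)
    (hr : 0 ≤ r2) (hg : 0 < g) (hgR : g ^ 2 * (R ^ 2 + r2) = 1) (hV : 0 ≤ V)
    (hX : X ^ 2 ≤ r2 * V) (hk : k = (1 + r2)⁻¹) (h : r2 ≤ ρ ^ 2) :
    -(ρ * (3 / 2 * (a ^ 2 + V) + 7 / 4 * (k * w ^ 2)))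
      ≤ 2⁻¹ * g * r2 * (V - a ^ 2) - g * X * (X + w) - 2⁻¹ * r2 * g ^ 3 * w ^ 2 := by
  have hk0 : 0 < k := by rw [hk]; positivity
  have hρ0 : 0 < ρ := by linarith
  have hR2 : 1 ≤ R ^ 2 := one_le_pow₀ hR
  have hρ2 : 1 ≤ ρ ^ 2 := one_le_pow₀ hρ
  -- In the support of the cutoff 1 + r² ≤ 2ρ², so an undifferentiated w² costs at most 2ρ² times
  -- the Hardy density k w².
  have hk2 : 1 ≤ 2 * (k * ρ ^ 2) := by
    rw [hk, inv_mul_eq_div, ← mul_div_assoc, one_le_div (by positivity)]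
    linarith
  have hgr2 : g ^ 2 * r2 ≤ 1 := by
    have : 0 ≤ g ^ 2 * R ^ 2 := by positivity
    linarith
  have hgr : g * r2 ≤ ρ := by
    refine le_of_sq_le_sq ?_ hρ0.le
    calc (g * r2) ^ 2 = (g ^ 2 * r2) * r2 := by ring
      _ ≤ 1 * ρ ^ 2 := by gcongr
      _ = ρ ^ 2 := one_mul _
  have hgk : g ^ 2 ≤ k := by
    rw [hk, le_inv_comm₀ (by positivity) (by positivity)]
    calc 1 + r2 ≤ R ^ 2 + r2 := by linarith
      _ = (g ^ 2)⁻¹ := eq_inv_of_mul_eq_one_right hgR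
  -- Compare squares: g² ≤ k ≤ 2(kρ)², and 2 ≤ (3/2)².
  have hg32 : g ≤ 3 / 2 * ρ * k := by
    refine le_of_sq_le_sq ?_ (by positivity)
    calc g ^ 2 ≤ k := hgk
      _ = k * 1 := (mul_one k).symm
      _ ≤ k * (2 * (k * ρ ^ 2)) := by gcongr
      _ ≤ (3 / 2 * ρ * k) ^ 2 := by linarith [sq_nonneg (k * ρ)]
  have t1 : 2⁻¹ * (g * r2 * a ^ 2) ≤ 2⁻¹ * (ρ * a ^ 2) := by gcongr
  have t0 : 0 ≤ 2⁻¹ * (g * r2 * V) := by positivity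
  have t2 : g * X ^ 2 ≤ ρ * V := by
    calc g * X ^ 2 ≤ g * (r2 * V) := by gcongr
      _ = (g * r2) * V := by ring
      _ ≤ ρ * V := by gcongr
  have hgX : (g * X) ^ 2 ≤ V := by
    calc (g * X) ^ 2 = g ^ 2 * X ^ 2 := by ring
      _ ≤ g ^ 2 * (r2 * V) := by gcongr
      _ = (g ^ 2 * r2) * V := by ring
      _ ≤ V := mul_le_of_le_one_left hV hgr2
  have t3 : g * X * w ≤ 2⁻¹ * ρ * V + ρ * (k * w ^ 2) := by
    have h1 : 0 ≤ (ρ * (g * X) - w) ^ 2 := sq_nonneg _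
    have h2 : w ^ 2 ≤ 2 * (k * ρ ^ 2) * w ^ 2 := le_mul_of_one_le_left (sq_nonneg w) hk2
    have h3 : ρ ^ 2 * (g * X) ^ 2 ≤ ρ ^ 2 * V := by gcongr
    have h4 : ρ * (g * X * w) ≤ ρ * (2⁻¹ * ρ * V + ρ * (k * w ^ 2)) := by linarith
    exact le_of_mul_le_mul_left h4 hρ0
  have t4 : 2⁻¹ * (r2 * g ^ 3 * w ^ 2) ≤ 2⁻¹ * (3 / 2 * ρ * k * w ^ 2) := by
    have h1 : r2 * g ^ 3 ≤ 3 / 2 * ρ * k := by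
      calc r2 * g ^ 3 = (g ^ 2 * r2) * g := by ring
        _ ≤ 1 * g := by gcongr
        _ ≤ _ := by rw [one_mul]; exact hg32
    gcongr
  have t5 : 0 ≤ ρ * a ^ 2 := by positivity
  linarith

/-- The bulk terms of the multiplier `(R² + r²)^{-1/2} (x · ∇ + 1)`. -/
lemma morawetz_bulk_terms {g R r2 a V X w : ℝ} (hg : 0 < g) (hgR : g ^ 2 * (R ^ 2 + r2) = 1)
    (hX : X ^ 2 ≤ r2 * V) :
    2⁻¹ * (R ^ 2 * g ^ 3 * (a ^ 2 + V)) + (g * a ^ 2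
      + 2⁻¹ * (3 * g - r2 * g ^ 3) * (V - a ^ 2) + g ^ 3 * X ^ 2
      - 2 * g * V - 3 / 2 * g ^ 3 * w ^ 2 + 3 / 2 * r2 * g ^ 5 * w ^ 2) ≤ 0 := by
  have hg1 : g = g ^ 3 * (R ^ 2 + r2) := by
    calc g = g * (g ^ 2 * (R ^ 2 + r2)) := by rw [hgR, mul_one]
      _ = _ := by ring
  have hg3 : g ^ 3 = g ^ 5 * (R ^ 2 + r2) := by
    calc g ^ 3 = g ^ 3 * (g ^ 2 * (R ^ 2 + r2)) := by rw [hgR, mul_one]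
      _ = _ := by ring
  -- After R² + r² = g⁻² is used, what remains is the angular part r²|∇w|² - (x·∇w)², nonnegative by
  -- Cauchy-Schwarz, and the term from Δg, both with a favourable sign.
  have e : 2⁻¹ * (R ^ 2 * g ^ 3 * (a ^ 2 + V)) + (g * a ^ 2
    + 2⁻¹ * (3 * g - r2 * g ^ 3) * (V - a ^ 2) + g ^ 3 * X ^ 2
    - 2 * g * V - 3 / 2 * g ^ 3 * w ^ 2 + 3 / 2 * r2 * g ^ 5 * w ^ 2)
    = -(g ^ 3 * (r2 * V - X ^ 2)) - 3 / 2 * R ^ 2 * g ^ 5 * w ^ 2 := by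
    linear_combination (-(a ^ 2) / 2 - V / 2) * hg1 - 3 / 2 * w ^ 2 * hg3
  rw [e]
  have h1 : 0 ≤ g ^ 3 * (r2 * V - X ^ 2) := mul_nonneg (by positivity) (by linarith)
  have h2 : 0 ≤ 3 / 2 * R ^ 2 * g ^ 5 * w ^ 2 := by positivity
  linarith

/-- The pointwise inequality behind the Morawetz estimate. -/
lemma morawetz_pointwise {m ψ g k R ρ r2 a V X w G : ℝ} (hR : 1 ≤ R) (hρ : 1 ≤ ρ) (hm : 0 ≤ m)
    (hm1 : m ≤ 1) (hr : 0 ≤ r2) (hg : 0 < g) (hgR : g ^ 2 * (R ^ 2 + r2) = 1) (hV : 0 ≤ V)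
    (hX : X ^ 2 ≤ r2 * V) (hk : k = (1 + r2)⁻¹) (hψ : 0 ≤ ψ)
    (hin : r2 ≤ ρ ^ 2 → 1 ≤ 2 * ψ) (hout : ρ ^ 2 ≤ r2 → m = 0) :
    2⁻¹ * (m ^ 2 * (R ^ 2 * g ^ 3 * (a ^ 2 + V)))
      + (m ^ 2 * (g * (X + w) * G + g * a ^ 2
          + 2⁻¹ * (3 * g - r2 * g ^ 3) * (V - a ^ 2) + g ^ 3 * X ^ 2
          - 2 * g * V - 3 / 2 * g ^ 3 * w ^ 2 + 3 / 2 * r2 * g ^ 5 * w ^ 2)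
        - 4 / ρ ^ 2 * m * (2⁻¹ * g * r2 * (V - a ^ 2) - g * X * (X + w) - 2⁻¹ * r2 * g ^ 3 * w ^ 2))
      ≤ m ^ 2 * (g * (X + w)) * G + ρ⁻¹ * (12 * (ψ * (a ^ 2 + V)) + 14 * (ψ * (k * w ^ 2))) := by
  have hk0 : 0 < k := by rw [hk]; positivity
  have hρ0 : 0 < ρ := by linarith
  have main := mul_le_mul_of_nonneg_left
    (morawetz_bulk_terms (a := a) (w := w) hg hgR hX) (sq_nonneg m)
  have herr : 0 ≤ ρ⁻¹ * (12 * (ψ * (a ^ 2 + V)) + 14 * (ψ * (k * w ^ 2)))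
      + 4 / ρ ^ 2 * m * (2⁻¹ * g * r2 * (V - a ^ 2) - g * X * (X + w)
        - 2⁻¹ * r2 * g ^ 3 * w ^ 2) := by
    -- Outside the ball the cutoff vanishes. Inside, 1 ≤ 2ψ pays for the errors, which carry only
    -- one factor m.
    rcases le_total (ρ ^ 2) r2 with h | h
    · rw [hout h]
      simp only [mul_zero, zero_mul, add_zero]
      positivity
    have h1 : 0 ≤ a ^ 2 + V := by positivity
    have h2 : 0 ≤ k * w ^ 2 := by positivity
    have hS : 6 * (a ^ 2 + V) + 7 * (k * w ^ 2)
        ≤ 12 * (ψ * (a ^ 2 + V)) + 14 * (ψ * (k * w ^ 2)) := by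
      linarith [mul_le_mul_of_nonneg_right (hin h) h1, mul_le_mul_of_nonneg_right (hin h) h2]
    have hQ := morawetz_cutoff_terms (a := a) (w := w) hR hρ hr hg hgR hV hX hk h
    set Q := 2⁻¹ * g * r2 * (V - a ^ 2) - g * X * (X + w) - 2⁻¹ * r2 * g ^ 3 * w ^ 2
    set P := ρ * (3 / 2 * (a ^ 2 + V) + 7 / 4 * (k * w ^ 2)) with hPdef
    have hP : 0 ≤ P := by positivity
    have hmQ : -P ≤ m * Q := by
      have h3 := mul_le_mul_of_nonneg_left hQ hm
      have h4 := mul_le_mul_of_nonneg_right hm1 hP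
      linarith
    have h5 := mul_le_mul_of_nonneg_left hmQ (by positivity : 0 ≤ 4 / ρ ^ 2)
    -- The cutoff derivative is of size ρ⁻² and the differentiated current of size ρ; one factor ρ⁻¹
    -- remains to compensate for the length of the time interval.
    have h6 : 4 / ρ ^ 2 * -P = -(ρ⁻¹ * (6 * (a ^ 2 + V) + 7 * (k * w ^ 2))) := by
      rw [hPdef]; field_simp; ring
    have h7 := mul_le_mul_of_nonneg_left hS (by positivity : 0 ≤ ρ⁻¹)
    rw [h6] at h5
    linarith
  linarith

end Morawetz

/-! ### The integrated Morawetz estimate, uniform in the scale R. -/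

section MorawetzEstimate

variable {w : Spacetime → ℝ}

lemma integral_energyDensity_le (hw : ContDiffOn ℝ 2 w halfSpace) {M s : ℝ} (hM : 0 ≤ M)
    (hs : 0 ≤ s) (hE : sliceNorm (gradient w) s ≤ ENNReal.ofReal M) :
    Integrable (fun x : Space => energyDensity w (s, x)) ∧
      ∫ x : Space, energyDensity w (s, x) ≤ M ^ 2 := by
  have := integral_norm_sq_le_of_eLpNorm_two hM
    (continuous_slice (contDiffOn_gradient (n := 1) hw).continuousOn hs).aestronglyMeasurable hE
  simpa only [norm_gradient_sq] using this

lemma integral_ballWeight_mul_sq_le (hw : ContinuousOn w halfSpace) {L s B : ℝ}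
    (hL : 0 < L) (hs : 0 ≤ s) (hB : 0 ≤ B)
    (hP : ∫⁻ x in Metric.ball (0 : Space) L, ‖w (s, x)‖ₑ ^ 2 ≤ ENNReal.ofReal B) :
    ∫ x : Space, ballWeight L (s, x) * w (s, x) ^ 2 ≤ B := by
  have hi := ((spatialSupport_ballWeight hL).mul_left fun p => w p ^ 2).integrable_slice
    ((continuous_ballWeight L).continuousOn.mul (hw.pow 2)) hs
  rw [← ENNReal.ofReal_le_ofReal_iff hB, ofReal_integral_eq_lintegral_ofReal hi
    (.of_forall fun x => mul_nonneg (ballWeight_nonneg _ _) (sq_nonneg _))]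
  refine le_trans ?_ hP
  rw [← lintegral_indicator Metric.isOpen_ball.measurableSet]
  refine lintegral_mono fun x => ?_
  by_cases hx : x ∈ Metric.ball (0 : Space) L
  · rw [indicator_of_mem hx, ← ofReal_norm, ← ENNReal.ofReal_pow (norm_nonneg _),
      Real.norm_eq_abs, sq_abs]
    exact ENNReal.ofReal_le_ofReal
      (mul_le_of_le_one_left (sq_nonneg _) (ballWeight_le_one _ _))
  · have : ballWeight L (s, x) = 0 := by
      refine ballWeight_eq_zero hL (pow_le_pow_left₀ hL.le ?_ 2)
      simpa using hx
    simp [this]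

lemma integral_hardy_weight_le (hw : ContDiffOn ℝ 2 w halfSpace) {M s L : ℝ} (hM : 0 ≤ M)
    (hs : 0 ≤ s) (hL : 0 < L) (hE : sliceNorm (gradient w) s ≤ ENNReal.ofReal M)
    (hP : ∫⁻ x in Metric.ball (0 : Space) L, ‖w (s, x)‖ₑ ^ 2
      ≤ ENNReal.ofReal (66 * L ^ 2 * M ^ 2)) :
    ∫ x : Space, ballWeight L (s, x) ^ 2 * ((1 + rsq (s, x))⁻¹ * w (s, x) ^ 2)
      ≤ 532 * M ^ 2 := by
  have h1 : ContDiffOn ℝ 1 w halfSpace := hw.of_le (by norm_num)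
  have h2 := integral_ballWeight_mul_sq_le hw.continuousOn hL hs (by positivity) hP
  obtain ⟨hi, h3⟩ := integral_energyDensity_le hw hM hs hE
  have h4 : ∫ x : Space, ballWeight L (s, x) ^ 2 * spatialDensity w (s, x) ≤ M ^ 2 := by
    refine le_trans (integral_mono ?_ hi fun x => ?_) h3
    · exact ((spatialSupport_ballWeight_sq hL).mul_left _).integrable_slice
        ((contDiff_ballWeight_sq L).continuous.continuousOn.mul
          (contDiffOn_spatialDensity hw).continuousOn) hs
    · refine le_trans (mul_le_of_le_one_left (spatialDensity_nonneg _ _) ?_)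
        (spatialDensity_le _ _)
      exact pow_le_one₀ (ballWeight_nonneg _ _) (ballWeight_le_one _ _)
  refine (hardy_inequality hL h1 hs).trans ?_
  have h5 := mul_le_mul_of_nonneg_left h2 (by positivity : 0 ≤ 8 / L ^ 2)
  -- The powers of L cancel, so the Hardy bound does not depend on the radius; 532 = 8·66 + 4.
  have h6 : 8 / L ^ 2 * (66 * L ^ 2 * M ^ 2) = 528 * M ^ 2 := by field_simp; ring
  linarith

/-- The multiplier applied to `w`, localized to a ball. -/
def morawetzMultiplier (ρ R : ℝ) (w : Spacetime → ℝ) (p : Spacetime) : ℝ :=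
  ballWeight ρ p ^ 2 * (multiplier R p * (radialDeriv w p + w p))

lemma continuousOn_morawetzMultiplier (ρ : ℝ) {R : ℝ} (hR : 0 < R)
    (hw : ContDiffOn ℝ 2 w halfSpace) : ContinuousOn (morawetzMultiplier ρ R w) halfSpace :=
  (contDiff_ballWeight_sq ρ).continuous.continuousOn.mul
    ((contDiff_multiplier hR).continuous.continuousOn.mul
      ((contDiffOn_radialDeriv hw).continuousOn.add hw.continuousOn))

/-- Since R ≥ 1, both g²r² ≤ 1 and g² ≤ (1 + r²)⁻¹. The narrow cutoff is traded for the one of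
radius 2ρ, for which the Hardy bound is available. -/
lemma morawetzMultiplier_sq_le {ρ R : ℝ} (hρ : 0 < ρ) (hR : 1 ≤ R) (p : Spacetime) :
    morawetzMultiplier ρ R w p ^ 2
      ≤ 2 * energyDensity w p + 4 * (ballWeight (2 * ρ) p ^ 2 * ((1 + rsq p)⁻¹ * w p ^ 2)) := by
  have hr := rsq_nonneg p
  have hV := spatialDensity_nonneg w p
  have hVe := spatialDensity_le w p
  have hX := radialDeriv_sq_le w p
  have hg := multiplier_sq (by linarith : 0 < R) p
  have hR2 : 1 ≤ R ^ 2 := one_le_pow₀ hR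
  unfold morawetzMultiplier
  set m := ballWeight ρ p
  have hm0 : 0 ≤ m := ballWeight_nonneg ρ p
  have hm1 : m ≤ 1 := ballWeight_le_one ρ p
  set g := multiplier R p
  set X := radialDeriv w p
  set V := spatialDensity w p
  have hgr : g ^ 2 * rsq p ≤ 1 := by
    have : 0 ≤ g ^ 2 * R ^ 2 := by positivity
    linarith
  have hgk : g ^ 2 ≤ (1 + rsq p)⁻¹ := by
    rw [← one_div, le_div_iff₀ (by positivity)]
    linarith [mul_le_mul_of_nonneg_left hR2 (sq_nonneg g)]
  have hkw : 0 ≤ (1 + rsq p)⁻¹ * w p ^ 2 := by positivity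
  have hmψ : (m ^ 2) ^ 2 * ((1 + rsq p)⁻¹ * w p ^ 2)
      ≤ 2 * (ballWeight (2 * ρ) p ^ 2 * ((1 + rsq p)⁻¹ * w p ^ 2)) := by
    rcases le_total (ρ ^ 2) (rsq p) with h | h
    · have : m = 0 := ballWeight_eq_zero hρ h
      rw [this]
      have : 0 ≤ ballWeight (2 * ρ) p ^ 2 * ((1 + rsq p)⁻¹ * w p ^ 2) := by positivity
      simpa using this
    · have h1 := mul_le_mul_of_nonneg_right (one_le_two_mul_ballWeight_sq hρ h) hkw
      have h2 : (m ^ 2) ^ 2 ≤ 1 := pow_le_one₀ (sq_nonneg m) (pow_le_one₀ hm0 hm1)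
      have h3 := mul_le_mul_of_nonneg_right h2 hkw
      linarith
  have hgX : (g * X) ^ 2 ≤ V := by
    calc (g * X) ^ 2 = g ^ 2 * X ^ 2 := by ring
      _ ≤ g ^ 2 * (rsq p * V) := by gcongr
      _ = (g ^ 2 * rsq p) * V := by ring
      _ ≤ V := mul_le_of_le_one_left hV hgr
  have hgw : (g * w p) ^ 2 ≤ (1 + rsq p)⁻¹ * w p ^ 2 := by
    rw [mul_pow]; gcongr
  have hm4 : (m ^ 2) ^ 2 * V ≤ V :=
    mul_le_of_le_one_left hV (pow_le_one₀ (sq_nonneg m) (pow_le_one₀ hm0 hm1))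
  have h1 : (g * (X + w p)) ^ 2 ≤ 2 * V + 2 * ((1 + rsq p)⁻¹ * w p ^ 2) := by
    linarith [sq_nonneg (g * X - g * w p)]
  have h2 := mul_le_mul_of_nonneg_left h1 (sq_nonneg (m ^ 2))
  rw [mul_pow]
  linarith

lemma sliceNorm_morawetzMultiplier_le (hw : ContDiffOn ℝ 2 w halfSpace) {ρ R M s : ℝ}
    (hρ : 0 < ρ) (hR : 1 ≤ R) (hM : 0 ≤ M) (hs : 0 ≤ s)
    (hE : sliceNorm (gradient w) s ≤ ENNReal.ofReal M)
    (hP : ∫⁻ x in Metric.ball (0 : Space) (2 * ρ), ‖w (s, x)‖ₑ ^ 2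
      ≤ ENNReal.ofReal (66 * (2 * ρ) ^ 2 * M ^ 2)) :
    sliceNorm (morawetzMultiplier ρ R w) s ≤ ENNReal.ofReal (47 * M) := by
  have hH := integral_hardy_weight_le hw hM hs (by positivity) hE hP
  obtain ⟨hi, h3⟩ := integral_energyDensity_le hw hM hs hE
  have hi2 := ((spatialSupport_ballWeight_sq (by positivity : 0 < 2 * ρ)).mul_left
    fun p => (1 + rsq p)⁻¹ * w p ^ 2).integrable_slice
    ((contDiff_ballWeight_sq _).continuous.continuousOn.mul
      (contDiff_inv_one_add_rsq.continuous.continuousOn.mul (hw.continuousOn.pow 2))) hs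
  have hi3 : Integrable fun x : Space => 2 * energyDensity w (s, x)
      + 4 * (ballWeight (2 * ρ) (s, x) ^ 2 * ((1 + rsq (s, x))⁻¹ * w (s, x) ^ 2)) :=
    (hi.const_mul 2).add (hi2.const_mul 4)
  have hle : ∀ x : Space, ‖morawetzMultiplier ρ R w (s, x)‖ ^ 2 ≤ 2 * energyDensity w (s, x)
      + 4 * (ballWeight (2 * ρ) (s, x) ^ 2 * ((1 + rsq (s, x))⁻¹ * w (s, x) ^ 2)) := fun x => by
    rw [Real.norm_eq_abs, sq_abs]
    exact morawetzMultiplier_sq_le hρ hR (s, x)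
  have hA := continuous_slice (continuousOn_morawetzMultiplier ρ (by linarith : 0 < R) hw) hs
  have hi4 : Integrable fun x : Space => ‖morawetzMultiplier ρ R w (s, x)‖ ^ 2 := by
    refine hi3.mono' (hA.norm.pow 2).aestronglyMeasurable (.of_forall fun x => ?_)
    rw [Real.norm_of_nonneg (sq_nonneg _)]
    exact hle x
  -- The constant 47 satisfies 47² = 2209 ≥ 2 + 4·532.
  refine eLpNorm_two_le_of_integral (by positivity) hi4 ((integral_mono hi4 hi3 hle).trans ?_)
  rw [integral_add (hi.const_mul 2) (hi2.const_mul 4), integral_const_mul, integral_const_mul]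
  linarith [sq_nonneg M]

/-- The Morawetz estimate at a fixed scale `R`. -/
theorem slabIntegral_morawetz_le {G : Spacetime → ℝ} (hw : ContDiffOn ℝ 2 w halfSpace)
    (hG : EqOn (box w) G halfSpace) {t M ρ R : ℝ} (ht : 0 ≤ t) (hM : 0 ≤ M) (hρ : 1 ≤ ρ)
    (htρ : t ≤ ρ) (hR : 1 ≤ R)
    (hE : ∀ s ∈ Icc 0 t, sliceNorm (gradient w) s ≤ ENNReal.ofReal M)
    (hGM : ∫⁻ s in Icc (0 : ℝ) t, sliceNorm G s ≤ ENNReal.ofReal M)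
    (hP : ∀ s ∈ Icc 0 t, ∫⁻ x in Metric.ball (0 : Space) (2 * ρ), ‖w (s, x)‖ₑ ^ 2
      ≤ ENNReal.ofReal (66 * (2 * ρ) ^ 2 * M ^ 2)) :
    slabIntegral t (fun p => ballWeight ρ p ^ 2 * (R ^ 2 * multiplier R p ^ 3 * energyDensity w p))
      ≤ 16000 * M ^ 2 := by
  have hρ0 : 0 < ρ := by linarith
  have hR0 : 0 < R := by linarith
  have hd : ∀ μ, ContDiffOn ℝ 1 (partialDeriv μ w) halfSpace := fun μ =>
    contDiffOn_partialDeriv (n := 1) hw μ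
  have hbc : ContinuousOn (box w) halfSpace :=
    (continuousOn_partialDeriv (hd 0) 0).sub
      (continuousOn_finsetSum _ fun i _ => continuousOn_partialDeriv (hd i.succ) i.succ)
  have hGc : ContinuousOn G halfSpace := hbc.congr hG.symm
  have hφc := (contDiff_ballWeight_sq ρ).continuous.continuousOn (s := halfSpace)
  have hψc := (contDiff_ballWeight_sq (2 * ρ)).continuous.continuousOn (s := halfSpace)
  have hφs := spatialSupport_ballWeight_sq hρ0
  have hψs := spatialSupport_ballWeight_sq (by positivity : 0 < 2 * ρ)
  have hgc := (contDiff_multiplier hR0).continuous.continuousOn (s := halfSpace)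
  have hen := (contDiffOn_energyDensity hw).continuousOn
  have hAc := continuousOn_morawetzMultiplier ρ hR0 hw
  have hAs : SpatialSupport ρ (morawetzMultiplier ρ R w) := hφs.mul_left _
  have hJ := contDiffOn_morawetzCurrent ρ hR0 hw
  have hJs : ∀ μ, SpatialSupport ρ (morawetzCurrent ρ R w μ) :=
    Fin.cases (hφs.mul_left _) fun i => hφs.mul_left _
  have s1 : SlabFunction fun p =>
      ballWeight ρ p ^ 2 * (R ^ 2 * multiplier R p ^ 3 * energyDensity w p) :=
    ⟨hφc.mul ((continuousOn_const.mul (hgc.pow 3)).mul hen), ρ, hφs.mul_left _⟩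
  have s2 : SlabFunction fun p => ∑ μ, partialDeriv μ (morawetzCurrent ρ R w μ) p :=
    ⟨continuousOn_finsetSum _ fun μ _ => continuousOn_partialDeriv (hJ μ) μ, ρ,
      SpatialSupport.sum _ fun μ => (hJs μ).partialDeriv μ⟩
  have s3 : SlabFunction fun p => morawetzMultiplier ρ R w p * G p :=
    ⟨hAc.mul hGc, ρ, hAs.mul_left _⟩
  have s4 : SlabFunction fun p => ballWeight (2 * ρ) p ^ 2 * energyDensity w p :=
    ⟨hψc.mul hen, 2 * ρ, hψs.mul_left _⟩
  have s5 : SlabFunction fun p => ballWeight (2 * ρ) p ^ 2 * ((1 + rsq p)⁻¹ * w p ^ 2) :=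
    ⟨hψc.mul (contDiff_inv_one_add_rsq.continuous.continuousOn.mul (hw.continuousOn.pow 2)),
      2 * ρ, hψs.mul_left _⟩
  have s45 := ((s4.const_mul 12).add (s5.const_mul 14)).const_mul ρ⁻¹
  have hmono := slabIntegral_mono ((s1.const_mul 2⁻¹).add s2) (s3.add s45) (fun p hp => by
    have := morawetz_pointwise (m := ballWeight ρ p) (ψ := ballWeight (2 * ρ) p ^ 2)
      (a := partialDeriv 0 w p) (w := w p) (G := box w p) hR hρ (ballWeight_nonneg ρ p)
      (ballWeight_le_one ρ p) (rsq_nonneg p) (multiplier_pos hR0 p) (multiplier_sq hR0 p)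
      (spatialDensity_nonneg w p) (radialDeriv_sq_le w p) rfl (sq_nonneg _)
      (one_le_two_mul_ballWeight_sq hρ0) (ballWeight_eq_zero hρ0)
    rw [← energyDensity_eq] at this
    rw [divergence_morawetzCurrent ρ hR0 hw hp, ← hG hp]
    exact this) ht
  rw [slabIntegral_add (s1.const_mul 2⁻¹) s2 ht, slabIntegral_add s3 s45 ht,
    slabIntegral_const_mul, slabIntegral_const_mul,
    slabIntegral_add (s4.const_mul 12) (s5.const_mul 14) ht, slabIntegral_const_mul,
    slabIntegral_const_mul] at hmono
  have hAn : ∀ s ∈ Icc 0 t, sliceNorm (morawetzMultiplier ρ R w) s ≤ ENNReal.ofReal (47 * M) :=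
    fun s hs => sliceNorm_morawetzMultiplier_le hw hρ0 hR hM hs.1 (hE s hs) (hP s hs)
  have b3 : slabIntegral t (fun p => morawetzMultiplier ρ R w p * G p) ≤ 47 * M * M :=
    (le_abs_self _).trans
      (abs_integral_mul_le hAc hGc (by positivity) hM hAn hGM (right_mem_Icc.2 ht))
  have hJ0 : ∀ s ∈ Icc 0 t, |∫ x : Space, morawetzCurrent ρ R w 0 (s, x)| ≤ M * (47 * M) := by
    intro s hs
    have e : ∫ x : Space, morawetzCurrent ρ R w 0 (s, x)
        = ∫ x : Space, partialDeriv 0 w (s, x) * morawetzMultiplier ρ R w (s, x) := by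
      refine integral_congr_ae (.of_forall fun x => ?_)
      simp only [morawetzCurrent, Fin.cases_zero, morawetzMultiplier]; ring
    have h0 : sliceNorm (partialDeriv 0 w) s ≤ ENNReal.ofReal M :=
      (eLpNorm_mono_enorm fun x => enorm_partialDeriv_le w 0 (s, x)).trans (hE s hs)
    rw [e, ← ENNReal.ofReal_le_ofReal_iff (by positivity), ← Real.norm_eq_abs, ofReal_norm,
      ENNReal.ofReal_mul hM]
    exact (enorm_integral_mul_le (continuous_slice (hd 0).continuousOn hs.1).aestronglyMeasurable
      (continuous_slice hAc hs.1).aestronglyMeasurable).trans (mul_le_mul' h0 (hAn s hs))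
  -- The divergence theorem leaves only the boundary terms at times 0 and t, each at most 47M².
  have b2 : -(2 * (M * (47 * M)))
      ≤ slabIntegral t fun p => ∑ μ, partialDeriv μ (morawetzCurrent ρ R w μ) p := by
    have := integral_divergence hJ hJs ht
    rw [slabIntegral, ← this]
    have h1 := abs_le.1 (hJ0 t (right_mem_Icc.2 ht))
    have h2 := abs_le.1 (hJ0 0 (left_mem_Icc.2 ht))
    linarith [h1.1, h2.2]
  have b4 : slabIntegral t (fun p => ballWeight (2 * ρ) p ^ 2 * energyDensity w p)
      ≤ t * M ^ 2 := by
    refine slabIntegral_le_of_slice_le s4 ht fun s hs => ?_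
    obtain ⟨hi, h3⟩ := integral_energyDensity_le hw hM hs.1 (hE s hs)
    refine le_trans (integral_mono (s4.integrable_slice hs.1) hi fun x => ?_) h3
    exact mul_le_of_le_one_left (energyDensity_nonneg _ _)
      (pow_le_one₀ (ballWeight_nonneg _ _) (ballWeight_le_one _ _))
  have b5 : slabIntegral t
      (fun p => ballWeight (2 * ρ) p ^ 2 * ((1 + rsq p)⁻¹ * w p ^ 2)) ≤ t * (532 * M ^ 2) :=
    slabIntegral_le_of_slice_le s5 ht fun s hs =>
      integral_hardy_weight_le hw hM hs.1 (by positivity) (hE s hs) (hP s hs)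
  -- The slab integrals grow like t ≤ ρ, which ρ⁻¹ cancels; 7460 = 12 + 14·532.
  have b45 : ρ⁻¹ * (12 * slabIntegral t (fun p => ballWeight (2 * ρ) p ^ 2 * energyDensity w p)
      + 14 * slabIntegral t (fun p => ballWeight (2 * ρ) p ^ 2 * ((1 + rsq p)⁻¹ * w p ^ 2)))
      ≤ 7460 * M ^ 2 := by
    rw [inv_mul_le_iff₀ hρ0]
    have : t * M ^ 2 ≤ ρ * M ^ 2 := by gcongr
    linarith
  -- Twice 47 + 94 + 7460 is 15202.
  linarith [sq_nonneg M]

end MorawetzEstimate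

/-! ### Integration over the scales R and the scalar estimate. -/

section Weighted

lemma volume_restrict_slab (t : ℝ) :
    (volume : Measure Spacetime).restrict (Icc 0 t ×ˢ univ)
      = ((volume : Measure ℝ).restrict (Ioc 0 t)).prod (volume : Measure Space) := by
  rw [Measure.volume_eq_prod, ← Measure.prod_restrict, Measure.restrict_univ,
    Measure.restrict_congr_set Ioc_ae_eq_Icc]

lemma SlabFunction.lintegral_ofReal {f : Spacetime → ℝ} (hf : SlabFunction f)
    (h0 : ∀ p, 0 ≤ f p) {t : ℝ} (ht : 0 ≤ t) :
    ∫⁻ p in Icc 0 t ×ˢ (univ : Set Space), ENNReal.ofReal (f p)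
      = ENNReal.ofReal (slabIntegral t f) := by
  have hi := hf.2.choose_spec.integrable_slab hf.1 t
  rw [volume_restrict_slab, ← ofReal_integral_eq_lintegral_ofReal hi (.of_forall h0),
    integral_prod _ hi, slabIntegral, intervalIntegral.integral_of_le ht]

/-- The R-derivative of -(R² + r²)^{-1/2} is R(R² + r²)^{-3/2}. -/
lemma lintegral_multiplier_cube {ρ : ℝ} (hρ : 1 ≤ ρ) (p : Spacetime) :
    ∫⁻ R in Ioc 1 ρ, ENNReal.ofReal (R * multiplier R p ^ 3)
      = ENNReal.ofReal (multiplier 1 p - multiplier ρ p) := by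
  have hr := rsq_nonneg p
  have hc : ContinuousOn (fun R => R * multiplier R p ^ 3) (Icc 1 ρ) := by
    refine continuousOn_id.mul (ContinuousOn.pow (ContinuousOn.inv₀ (by fun_prop) ?_) 3)
    intro R hR
    have : 0 < R := by linarith [hR.1]
    exact (Real.sqrt_pos.2 (by positivity)).ne'
  have hi : IntegrableOn (fun R => R * multiplier R p ^ 3) (Ioc 1 ρ) :=
    (hc.integrableOn_compact isCompact_Icc).mono_set Ioc_subset_Icc_self
  have hpos : ∀ᵐ R ∂(volume.restrict (Ioc 1 ρ)), 0 ≤ R * multiplier R p ^ 3 := by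
    refine (ae_restrict_iff' measurableSet_Ioc).2 (.of_forall fun R hR => ?_)
    have : 0 < R := by linarith [hR.1]
    have := multiplier_pos this p
    positivity
  rw [← ofReal_integral_eq_lintegral_ofReal hi hpos, ← intervalIntegral.integral_of_le hρ]
  congr 1
  rw [intervalIntegral.integral_eq_sub_of_hasDerivAt (f := fun R => -multiplier R p)]
  · ring
  · intro R hR
    rw [uIcc_of_le hρ] at hR
    have hR0 : 0 < R := by linarith [hR.1]
    have h : 0 < R ^ 2 + rsq p := by positivity
    have hs : 0 < √(R ^ 2 + rsq p) := Real.sqrt_pos.2 h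
    have h1 : HasDerivAt (fun R : ℝ => R ^ 2 + rsq p) (2 * R) R := by
      simpa using (hasDerivAt_pow 2 R).add_const (rsq p)
    refine ((h1.sqrt h.ne').inv hs.ne').neg.congr_deriv ?_
    unfold multiplier
    field_simp
  · rw [intervalIntegrable_iff_integrableOn_Ioc_of_le hρ]
    exact hi

/-- Three facts enter: (1 + r)⁻¹ ≤ g_1, g_ρ ≤ 1/ρ, and g_1(1 - m²) ≤ 2/ρ. The last uses g_1 r ≤ 1,
with 1 - m² ≤ 2r²/ρ² when r ≤ ρ. -/
lemma inv_one_add_norm_le {ρ : ℝ} (hρ : 1 ≤ ρ) (p : Spacetime) :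
    (1 + ‖p.2‖)⁻¹ ≤ ballWeight ρ p ^ 2 * (multiplier 1 p - multiplier ρ p) + 3 / ρ := by
  have hρ0 : 0 < ρ := by linarith
  have hn := norm_nonneg p.2
  have hr : rsq p = ‖p.2‖ ^ 2 := rfl
  have hr0 := rsq_nonneg p
  have hm0 := ballWeight_nonneg ρ p
  have hm1 := ballWeight_le_one ρ p
  have hg0 := multiplier_pos one_pos p
  have h1 : (1 + ‖p.2‖)⁻¹ ≤ multiplier 1 p := by
    refine inv_anti₀ (Real.sqrt_pos.2 (by positivity)) ?_
    refine Real.sqrt_le_iff.2 ⟨by positivity, ?_⟩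
    rw [hr]; nlinarith
  have h2 : multiplier ρ p ≤ ρ⁻¹ := by
    refine inv_anti₀ hρ0 (Real.le_sqrt_of_sq_le ?_)
    linarith
  have h3 : multiplier 1 p * ‖p.2‖ ≤ 1 := by
    rw [multiplier, inv_mul_le_iff₀ (Real.sqrt_pos.2 (by positivity)), mul_one]
    refine Real.le_sqrt_of_sq_le ?_
    rw [hr]; linarith
  have h4 : multiplier 1 p * (1 - ballWeight ρ p ^ 2) ≤ 2 / ρ := by
    rcases le_total ρ ‖p.2‖ with h | h
    · rw [ballWeight_eq_zero hρ0 (pow_le_pow_left₀ hρ0.le h 2)]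
      rw [le_div_iff₀ hρ0]
      have : multiplier 1 p * ρ ≤ multiplier 1 p * ‖p.2‖ := by gcongr
      linarith
    · have hm : 1 - rsq p / ρ ^ 2 ≤ ballWeight ρ p := le_max_left _ _
      have h5 : 1 - ballWeight ρ p ^ 2 ≤ 2 * (‖p.2‖ ^ 2 / ρ ^ 2) := by
        rw [← hr]; nlinarith
      calc multiplier 1 p * (1 - ballWeight ρ p ^ 2)
          ≤ multiplier 1 p * (2 * (‖p.2‖ ^ 2 / ρ ^ 2)) := by gcongr
        _ = 2 * (multiplier 1 p * ‖p.2‖) * ‖p.2‖ / ρ ^ 2 := by ring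
        _ ≤ 2 * 1 * ρ / ρ ^ 2 := by gcongr
        _ = 2 / ρ := by field_simp
  have h5 : ballWeight ρ p ^ 2 * multiplier ρ p ≤ ρ⁻¹ := by
    refine le_trans (mul_le_of_le_one_left (multiplier_pos hρ0 p).le ?_) h2
    exact pow_le_one₀ hm0 hm1
  have h6 : 3 / ρ = 2 / ρ + ρ⁻¹ := by field_simp; norm_num
  rw [h6]
  linarith

variable {u : Spacetime → ℝ}

lemma enorm_weight_smul_gradient_sq (u : Spacetime → ℝ) (p : Spacetime) :
    ‖(1 + ‖p.2‖) ^ (-(1 / 2) : ℝ) • gradient u p‖ₑ ^ 2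
      = ENNReal.ofReal ((1 + ‖p.2‖)⁻¹ * energyDensity u p) := by
  have h : 0 ≤ 1 + ‖p.2‖ := by positivity
  rw [← ofReal_norm, ← ENNReal.ofReal_pow (norm_nonneg _), norm_smul, mul_pow, norm_gradient_sq,
    Real.norm_of_nonneg (by positivity), ← Real.rpow_natCast, ← Real.rpow_mul h]
  norm_num [Real.rpow_neg_one]

lemma gradient_sub_const (u : Spacetime → ℝ) (c : ℝ) :
    gradient (fun p => u p - c) = gradient u := by
  funext p
  simp [gradient, partialDeriv, fderivWithin_sub_const]

lemma box_sub_const (u : Spacetime → ℝ) (c : ℝ) : box (fun p => u p - c) = box u := by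
  have : ∀ μ, partialDeriv μ (fun p => u p - c) = partialDeriv μ u := fun μ => by
    funext p; simp [partialDeriv, fderivWithin_sub_const]
  funext p
  simp [box, this]

lemma energyDensity_sub_const (u : Spacetime → ℝ) (c : ℝ) :
    energyDensity (fun p => u p - c) = energyDensity u := by
  funext p
  simp [energyDensity, partialDeriv, fderivWithin_sub_const]

/-- The fixed-scale bounds are superposed with weight dR/R, which produces the logarithm; the part
of (1 + r)⁻¹ that the superposition misses is O(1/ρ). -/
lemma lintegral_weight_le {G : Spacetime → ℝ} (hu : ContDiffOn ℝ 2 u halfSpace)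
    (hG : EqOn (box u) G halfSpace) {t M ρ : ℝ} (ht : 0 ≤ t) (hM : 0 ≤ M) (hρ : 1 ≤ ρ)
    (htρ : t ≤ ρ)
    (hE : ∀ s ∈ Icc 0 t, sliceNorm (gradient u) s ≤ ENNReal.ofReal M)
    (hGM : ∫⁻ s in Icc (0 : ℝ) t, sliceNorm G s ≤ ENNReal.ofReal M) :
    ∫⁻ p in Icc 0 t ×ˢ (univ : Set Space), ENNReal.ofReal ((1 + ‖p.2‖)⁻¹ * energyDensity u p)
      ≤ ENNReal.ofReal (16000 * M ^ 2 * Real.log ρ) + ENNReal.ofReal (3 * M ^ 2) := by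
  have hρ0 : 0 < ρ := by linarith
  -- The radius 2ρ is that of the wide cutoff in the Morawetz estimate, which is then applied to u -
  -- c.
  obtain ⟨c, hc⟩ := exists_lintegral_slice_sub_le (L := 2 * ρ) (hu.of_le (by norm_num)) hM ht
    (by positivity) (by linarith) hE
  have hen := (contDiffOn_energyDensity hu).continuousOn
  have hR : ∀ R, 1 ≤ R → ∫⁻ p in Icc 0 t ×ˢ (univ : Set Space),
      ENNReal.ofReal (ballWeight ρ p ^ 2 * (R ^ 2 * multiplier R p ^ 3 * energyDensity u p))
      ≤ ENNReal.ofReal (16000 * M ^ 2) := by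
    intro R hR
    have hR0 : 0 < R := by linarith
    have hS : SlabFunction fun p =>
        ballWeight ρ p ^ 2 * (R ^ 2 * multiplier R p ^ 3 * energyDensity u p) :=
      ⟨(contDiff_ballWeight_sq ρ).continuous.continuousOn.mul ((continuousOn_const.mul
        ((contDiff_multiplier hR0).continuous.continuousOn.pow 3)).mul hen), ρ,
        (spatialSupport_ballWeight_sq hρ0).mul_left _⟩
    rw [hS.lintegral_ofReal (fun p => ?_) ht]
    · have := slabIntegral_morawetz_le (w := fun p => u p - c) (hu.sub contDiffOn_const)
        (by rwa [box_sub_const]) ht hM hρ htρ hR (by rwa [gradient_sub_const]) hGM hc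
      rw [energyDensity_sub_const] at this
      exact ENNReal.ofReal_le_ofReal this
    · have h1 := multiplier_pos hR0 p
      have h2 := energyDensity_nonneg u p
      positivity
  have hmeas : AEMeasurable (Function.uncurry fun (p : Spacetime) (R : ℝ) =>
      ENNReal.ofReal (R⁻¹ * (ballWeight ρ p ^ 2
        * (R ^ 2 * multiplier R p ^ 3 * energyDensity u p))))
      (((volume : Measure Spacetime).restrict (Icc 0 t ×ˢ univ)).prod
        ((volume : Measure ℝ).restrict (Ioc 1 ρ))) := by
    rw [Measure.prod_restrict]
    refine ContinuousOn.aemeasurable ?_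
      ((measurableSet_Icc.prod MeasurableSet.univ).prod measurableSet_Ioc)
    have hmap : MapsTo (Prod.fst : Spacetime × ℝ → Spacetime)
        ((Icc 0 t ×ˢ univ) ×ˢ Ioc 1 ρ) halfSpace := fun q hq => mem_halfSpace.2 hq.1.1.1
    have hR0 : ∀ q ∈ (Icc 0 t ×ˢ (univ : Set Space)) ×ˢ Ioc 1 ρ, 0 < q.2 :=
      fun q hq => by linarith [hq.2.1]
    have hb : Continuous fun q : Spacetime × ℝ => ballWeight ρ q.1 :=
      (continuous_ballWeight ρ).comp continuous_fst
    have hrc : Continuous fun q : Spacetime × ℝ => rsq q.1 :=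
      (contDiff_rsq (n := 1)).continuous.comp continuous_fst
    refine ENNReal.continuous_ofReal.comp_continuousOn
      ((continuousOn_snd.inv₀ fun q hq => (hR0 q hq).ne').mul
        ((hb.pow 2).continuousOn.mul
          (((continuous_snd.pow 2).continuousOn.mul (ContinuousOn.pow (ContinuousOn.inv₀
            (((continuous_snd.pow 2).add hrc).sqrt).continuousOn ?_) 3)).mul
            (hen.comp continuousOn_fst hmap))))
    intro q hq
    have h1 := hR0 q hq
    have h2 := rsq_nonneg q.1
    have h3 : 0 < q.2 ^ 2 + rsq q.1 := by positivity
    exact (Real.sqrt_pos.2 h3).ne'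
  have hdouble : ∫⁻ p in Icc 0 t ×ˢ (univ : Set Space), ∫⁻ R in Ioc 1 ρ,
      ENNReal.ofReal (R⁻¹ * (ballWeight ρ p ^ 2
        * (R ^ 2 * multiplier R p ^ 3 * energyDensity u p)))
      ≤ ENNReal.ofReal (16000 * M ^ 2 * Real.log ρ) := by
    rw [lintegral_lintegral_swap hmeas]
    calc _ ≤ ∫⁻ R in Ioc 1 ρ, ENNReal.ofReal (16000 * M ^ 2 * R⁻¹) := by
          refine setLIntegral_mono' measurableSet_Ioc fun R hR' => ?_
          have hR0 : 0 < R := by linarith [hR'.1]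
          have hRi : 0 ≤ R⁻¹ := by positivity
          simp only [ENNReal.ofReal_mul hRi]
          rw [lintegral_const_mul' _ _ ENNReal.ofReal_ne_top, mul_comm (16000 * M ^ 2),
            ENNReal.ofReal_mul hRi]
          exact mul_le_mul' le_rfl (hR R hR'.1.le)
      _ = ENNReal.ofReal (16000 * M ^ 2 * Real.log ρ) := by
          have hi : IntervalIntegrable (fun R : ℝ => 16000 * M ^ 2 * R⁻¹) volume 1 ρ := by
            refine ContinuousOn.intervalIntegrable ?_
            rw [uIcc_of_le hρ]
            exact continuousOn_const.mul (continuousOn_id.inv₀ fun R hR' =>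
              (by linarith [hR'.1] : 0 < R).ne')
          rw [intervalIntegrable_iff_integrableOn_Ioc_of_le hρ] at hi
          rw [← ofReal_integral_eq_lintegral_ofReal hi, ← intervalIntegral.integral_of_le hρ,
            intervalIntegral.integral_const_mul, integral_inv_of_pos one_pos hρ0, div_one]
          refine (ae_restrict_iff' measurableSet_Ioc).2 (.of_forall fun R hR' => ?_)
          have hR0 : 0 < R := by linarith [hR'.1]
          simp only [Pi.zero_apply]
          positivity
  -- The remainder has energy at most M² on each slice, and t/ρ ≤ 1.
  have hfar : ∫⁻ p in Icc 0 t ×ˢ (univ : Set Space), ENNReal.ofReal (3 / ρ * energyDensity u p)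
      ≤ ENNReal.ofReal (3 * M ^ 2) := by
    have hm : AEMeasurable (fun p => ENNReal.ofReal (3 / ρ * energyDensity u p))
        ((volume : Measure Spacetime).restrict (Icc 0 t ×ˢ univ)) :=
      (ENNReal.continuous_ofReal.comp_continuousOn (continuousOn_const.mul
        (hen.mono fun p hp => mem_halfSpace.2 hp.1.1))).aemeasurable
        (measurableSet_Icc.prod MeasurableSet.univ)
    rw [volume_restrict_slab] at hm ⊢
    rw [lintegral_prod _ hm]
    calc _ ≤ ∫⁻ s in Ioc 0 t, ENNReal.ofReal (3 / ρ * M ^ 2) := by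
          refine setLIntegral_mono' measurableSet_Ioc fun s hs => ?_
          obtain ⟨hi, h3⟩ := integral_energyDensity_le hu hM hs.1.le (hE s ⟨hs.1.le, hs.2⟩)
          rw [← ofReal_integral_eq_lintegral_ofReal (hi.const_mul _) (.of_forall fun x =>
            mul_nonneg (by positivity) (energyDensity_nonneg _ _)), integral_const_mul]
          exact ENNReal.ofReal_le_ofReal (by gcongr)
      _ = ENNReal.ofReal (3 / ρ * M ^ 2 * t) := by
          rw [lintegral_const, Measure.restrict_apply_univ, Real.volume_Ioc, sub_zero,
            ← ENNReal.ofReal_mul (by positivity)]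
      _ ≤ _ := by
          refine ENNReal.ofReal_le_ofReal ?_
          calc 3 / ρ * M ^ 2 * t = 3 * M ^ 2 * (t / ρ) := by ring
            _ ≤ 3 * M ^ 2 := mul_le_of_le_one_right (by positivity) ((div_le_one hρ0).2 htρ)
  have hpt : ∀ p : Spacetime, ENNReal.ofReal ((1 + ‖p.2‖)⁻¹ * energyDensity u p)
      ≤ (∫⁻ R in Ioc 1 ρ, ENNReal.ofReal (R⁻¹ * (ballWeight ρ p ^ 2
        * (R ^ 2 * multiplier R p ^ 3 * energyDensity u p))))
        + ENNReal.ofReal (3 / ρ * energyDensity u p) := by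
    intro p
    have h0 := energyDensity_nonneg u p
    have e : ∫⁻ R in Ioc 1 ρ, ENNReal.ofReal (R⁻¹ * (ballWeight ρ p ^ 2
        * (R ^ 2 * multiplier R p ^ 3 * energyDensity u p)))
        = ENNReal.ofReal (ballWeight ρ p ^ 2 * energyDensity u p)
          * ENNReal.ofReal (multiplier 1 p - multiplier ρ p) := by
      rw [← lintegral_multiplier_cube hρ, ← lintegral_const_mul' _ _ ENNReal.ofReal_ne_top]
      refine setLIntegral_congr_fun measurableSet_Ioc fun R hR' => ?_
      have hR0 : R ≠ 0 := by linarith [hR'.1]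
      rw [← ENNReal.ofReal_mul (by positivity)]
      congr 1
      field_simp
    have h1 := mul_le_mul_of_nonneg_right (inv_one_add_norm_le hρ p) h0
    rw [e, ← ENNReal.ofReal_mul (by positivity)]
    refine (ENNReal.ofReal_le_ofReal h1).trans ?_
    rw [add_mul]
    refine ENNReal.ofReal_add_le.trans (le_of_eq ?_)
    congr 2; ring
  calc _ ≤ ∫⁻ p in Icc 0 t ×ˢ (univ : Set Space), ((∫⁻ R in Ioc 1 ρ,
        ENNReal.ofReal (R⁻¹ * (ballWeight ρ p ^ 2
          * (R ^ 2 * multiplier R p ^ 3 * energyDensity u p))))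
        + ENNReal.ofReal (3 / ρ * energyDensity u p)) := lintegral_mono hpt
    _ = _ := lintegral_add_left' hmeas.lintegral_prod_right _
    _ ≤ _ := add_le_add hdouble hfar

/-- The estimate for `C²` solutions of the scalar wave equation. -/
theorem sliceNorm_add_weightedNorm_le {G : Spacetime → ℝ} (hu : ContDiffOn ℝ 2 u halfSpace)
    (hG : EqOn (box u) G halfSpace) {t : ℝ} (ht : 0 ≤ t) :
    sliceNorm (gradient u) t
        + ENNReal.ofReal (Real.log (2 + t) ^ (-(1 / 2) : ℝ)) * weightedNorm (gradient u) t
      ≤ 256 * (sliceNorm (gradient u) 0 + ∫⁻ s in Icc (0 : ℝ) t, sliceNorm G s) := by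
  -- An infinite right-hand side is trivial; otherwise both terms are real numbers.
  by_cases hfin : sliceNorm (gradient u) 0 + ∫⁻ s in Icc (0 : ℝ) t, sliceNorm G s = ∞
  · rw [hfin, ENNReal.mul_top (by norm_num)]; exact le_top
  obtain ⟨h1, h2⟩ := ENNReal.add_ne_top.1 hfin
  obtain ⟨a, ha, hae⟩ : ∃ a : ℝ, 0 ≤ a ∧ sliceNorm (gradient u) 0 = ENNReal.ofReal a :=
    ⟨_, ENNReal.toReal_nonneg, (ENNReal.ofReal_toReal h1).symm⟩
  obtain ⟨γ, hγ, hγe⟩ : ∃ γ : ℝ, 0 ≤ γ ∧ ∫⁻ s in Icc (0 : ℝ) t, sliceNorm G s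
      = ENNReal.ofReal γ := ⟨_, ENNReal.toReal_nonneg, (ENNReal.ofReal_toReal h2).symm⟩
  set M := a + 2 * γ with hMdef
  have hM : 0 ≤ M := by positivity
  have hE : ∀ s ∈ Icc 0 t, sliceNorm (gradient u) s ≤ ENNReal.ofReal M := fun s hs =>
    sliceNorm_gradient_le hu hG ha hγ hae.le hγe.le hs
  have hGM : ∫⁻ s in Icc (0 : ℝ) t, sliceNorm G s ≤ ENNReal.ofReal M :=
    hγe.le.trans (ENNReal.ofReal_le_ofReal (by linarith))
  have hlog : 1 / 2 ≤ Real.log (2 + t) := by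
    have := Real.log_two_gt_d9
    have := Real.log_le_log (by norm_num) (by linarith : (2 : ℝ) ≤ 2 + t)
    linarith
  -- With ρ = 2 + t: 127² = 16129, and since ln(2 + t) ≥ 1/2 the surplus 129 ln(2 + t) absorbs the
  -- remainder 3.
  have hw : weightedNorm (gradient u) t ≤ ENNReal.ofReal (127 * M * √(Real.log (2 + t))) := by
    rw [← ENNReal.pow_le_pow_left_iff two_ne_zero, weightedNorm, eLpNorm_two_sq,
      ← ENNReal.ofReal_pow (by positivity)]
    simp only [enorm_weight_smul_gradient_sq]
    refine (lintegral_weight_le hu hG ht hM (by linarith : 1 ≤ 2 + t) (by linarith) hE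
      hGM).trans ?_
    rw [← ENNReal.ofReal_add (by positivity) (by positivity)]
    refine ENNReal.ofReal_le_ofReal ?_
    rw [mul_pow, Real.sq_sqrt (by linarith)]
    nlinarith [mul_le_mul_of_nonneg_left hlog (sq_nonneg M)]
  have hlw : ENNReal.ofReal (Real.log (2 + t) ^ (-(1 / 2) : ℝ)) * weightedNorm (gradient u) t
      ≤ ENNReal.ofReal (127 * M) := by
    refine (mul_le_mul' le_rfl hw).trans ?_
    rw [← ENNReal.ofReal_mul (Real.rpow_nonneg (by linarith) _)]
    refine ENNReal.ofReal_le_ofReal (le_of_eq ?_)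
    rw [Real.sqrt_eq_rpow, mul_comm, mul_assoc, ← Real.rpow_add (by linarith)]
    norm_num
  calc _ ≤ ENNReal.ofReal M + ENNReal.ofReal (127 * M) :=
        add_le_add (hE t (right_mem_Icc.2 ht)) hlw
    _ = ENNReal.ofReal (128 * M) := by
        rw [← ENNReal.ofReal_add hM (by positivity)]; congr 1; ring
    -- 128(a + 2γ) ≤ 256(a + γ).
    _ ≤ ENNReal.ofReal (256 * (a + γ)) := ENNReal.ofReal_le_ofReal (by linarith)
    _ = _ := by
        rw [hae, hγe, ← ENNReal.ofReal_add ha hγ, ENNReal.ofReal_mul (by norm_num)]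
        norm_num

end Weighted

/-! ### Passage to systems and to words in Z. -/

section Reduction

lemma eLpNorm_two_le_mul_sum {X ι F F' : Type*} [MeasurableSpace X] {m : Measure X}
    [NormedAddCommGroup F] [NormedAddCommGroup F'] (s : Finset ι) {f : X → F} {g : ι → X → F'}
    (c : ℝ≥0) (hg : ∀ i ∈ s, AEStronglyMeasurable (g i) m)
    (h : ∀ᵐ x ∂m, ‖f x‖ₑ ≤ c * ∑ i ∈ s, ‖g i x‖ₑ) :
    eLpNorm f 2 m ≤ c * ∑ i ∈ s, eLpNorm (g i) 2 m := by
  calc eLpNorm f 2 m ≤ eLpNorm ((c : ℝ) • ∑ i ∈ s, fun x => ‖g i x‖) 2 m := by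
        refine eLpNorm_mono_enorm_ae (h.mono fun x hx => hx.trans (le_of_eq ?_))
        have h0 : 0 ≤ ∑ i ∈ s, ‖g i x‖ := Finset.sum_nonneg fun _ _ => norm_nonneg _
        rw [Pi.smul_apply, Finset.sum_apply, enorm_smul, Real.enorm_of_nonneg h0,
          ENNReal.ofReal_sum_of_nonneg fun _ _ => norm_nonneg _]
        simp
    _ = c * eLpNorm (∑ i ∈ s, fun x => ‖g i x‖) 2 m := by
        rw [eLpNorm_const_smul]; simp
    _ ≤ c * ∑ i ∈ s, eLpNorm (fun x => ‖g i x‖) 2 m :=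
        mul_le_mul' le_rfl (eLpNorm_sum_le (fun i hi => (hg i hi).norm) one_le_two)
    _ = _ := by simp only [eLpNorm_norm]

/-- The sum of the two norms on the left-hand side of the estimate. -/
def slabNorm {F : Type*} [NormedAddCommGroup F] [NormedSpace ℝ F] (f : Spacetime → F) (t : ℝ) :
    ℝ≥0∞ :=
  sliceNorm f t + ENNReal.ofReal (Real.log (2 + t) ^ (-(1 / 2) : ℝ)) * weightedNorm f t

/-- Both norms on the left of the theorem respect pointwise domination by a finite sum. This
transfers the commutator bound and the splitting into components alike. -/
lemma slabNorm_le_mul_sum {ι F F' : Type*} [NormedAddCommGroup F] [NormedSpace ℝ F]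
    [NormedAddCommGroup F'] [NormedSpace ℝ F'] (s : Finset ι) {f : Spacetime → F}
    {g : ι → Spacetime → F'} (c : ℝ≥0) (hg : ∀ i ∈ s, ContinuousOn (g i) halfSpace)
    (h : ∀ p ∈ halfSpace, ‖f p‖ₑ ≤ c * ∑ i ∈ s, ‖g i p‖ₑ) {t : ℝ} (ht : 0 ≤ t) :
    slabNorm f t ≤ c * ∑ i ∈ s, slabNorm (g i) t := by
  have hms : MeasurableSet (Icc 0 t ×ˢ (univ : Set Space)) :=
    measurableSet_Icc.prod MeasurableSet.univ
  have h1 : sliceNorm f t ≤ c * ∑ i ∈ s, sliceNorm (g i) t :=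
    eLpNorm_two_le_mul_sum s c
      (fun i hi => (continuous_slice (hg i hi) ht).aestronglyMeasurable)
      (.of_forall fun x => h _ (mk_mem_halfSpace ht x))
  have h2 : weightedNorm f t ≤ c * ∑ i ∈ s, weightedNorm (g i) t := by
    refine eLpNorm_two_le_mul_sum s c (fun i hi => ?_) ?_
    · refine ContinuousOn.aestronglyMeasurable (ContinuousOn.smul ?_
        ((hg i hi).mono fun p hp => mem_halfSpace.2 hp.1.1)) hms
      refine ContinuousOn.rpow_const (by fun_prop) fun p _ => Or.inl ?_
      have := norm_nonneg p.2
      positivity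
    · refine (ae_restrict_iff' hms).2 (.of_forall fun p hp => ?_)
      simp only [enorm_smul, ← Finset.mul_sum]
      rw [mul_left_comm]
      exact mul_le_mul' le_rfl (h p (mem_halfSpace.2 hp.1.1))
  unfold slabNorm
  rw [Finset.sum_add_distrib, mul_add, ← Finset.mul_sum, mul_left_comm]
  exact add_le_add h1 (mul_le_mul' le_rfl h2)

variable {E : Type*} [NormedAddCommGroup E] [InnerProductSpace ℝ E]

lemma gradient_inner_apply (e : E) {w : Spacetime → E} (hw : ContDiffOn ℝ 2 w halfSpace)
    {p : Spacetime} (hp : p ∈ halfSpace) (μ : Fin 4) :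
    gradient (fun q => innerSL ℝ e (w q)) p μ = inner ℝ e (partialDeriv μ w p) :=
  partialDeriv_clm (innerSL ℝ e) hp (differentiableWithinAt_of_contDiffOn (n := 1) hw hp) μ

lemma enorm_gradient_inner_le {e : E} (he : ‖e‖ = 1) {w : Spacetime → E}
    (hw : ContDiffOn ℝ 2 w halfSpace) {p : Spacetime} (hp : p ∈ halfSpace) :
    ‖gradient (fun q => innerSL ℝ e (w q)) p‖ₑ ≤ ‖gradient w p‖ₑ := by
  rw [enorm_le_iff_norm_le]
  refine le_of_sq_le_sq ?_ (norm_nonneg _)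
  rw [PiLp.norm_sq_eq_of_L2, PiLp.norm_sq_eq_of_L2]
  refine Finset.sum_le_sum fun μ _ => pow_le_pow_left₀ (norm_nonneg _) ?_ 2
  rw [gradient_inner_apply e hw hp]
  exact (norm_inner_le_norm _ _).trans (by rw [he, one_mul]; rfl)

lemma enorm_gradient_le_sum {ι : Type*} [Fintype ι] (b : OrthonormalBasis ι ℝ E)
    {w : Spacetime → E} (hw : ContDiffOn ℝ 2 w halfSpace) {p : Spacetime} (hp : p ∈ halfSpace) :
    ‖gradient w p‖ₑ ≤ ∑ i, ‖gradient (fun q => innerSL ℝ (b i) (w q)) p‖ₑ := by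
  have h : ‖gradient w p‖ ≤ ∑ i, ‖gradient (fun q => innerSL ℝ (b i) (w q)) p‖ := by
    refine le_of_sq_le_sq ?_ (Finset.sum_nonneg fun _ _ => norm_nonneg _)
    refine le_trans (le_of_eq ?_) (Finset.sum_sq_le_sq_sum_of_nonneg fun _ _ => norm_nonneg _)
    simp only [PiLp.norm_sq_eq_of_L2, gradient_inner_apply _ hw hp]
    rw [Finset.sum_comm]
    refine Finset.sum_congr rfl fun μ _ => ?_
    exact (b.sum_sq_norm_inner_right _).symm
  simp only [← ofReal_norm]
  rw [← ENNReal.ofReal_sum_of_nonneg fun _ _ => norm_nonneg _]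
  exact ENNReal.ofReal_le_ofReal h

variable [FiniteDimensional ℝ E]

/-- The estimate for `C²` solutions of the wave equation with values in `E`. -/
theorem slabNorm_gradient_le {w G : Spacetime → E} (hw : ContDiffOn ℝ 2 w halfSpace)
    (hG : EqOn (box w) G halfSpace) {t : ℝ} (ht : 0 ≤ t) :
    slabNorm (gradient w) t ≤ (Module.finrank ℝ E * 256 : ℝ≥0)
      * (sliceNorm (gradient w) 0 + ∫⁻ s in Icc (0 : ℝ) t, sliceNorm G s) := by
  set b := stdOrthonormalBasis ℝ E
  set u : Fin (Module.finrank ℝ E) → Spacetime → ℝ := fun i q => innerSL ℝ (b i) (w q) with hu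
  have hu2 : ∀ i, ContDiffOn ℝ 2 (u i) halfSpace := fun i =>
    (innerSL ℝ (b i)).contDiff.comp_contDiffOn hw
  have hi : ∀ i, slabNorm (gradient (u i)) t
      ≤ 256 * (sliceNorm (gradient w) 0 + ∫⁻ s in Icc (0 : ℝ) t, sliceNorm G s) := by
    intro i
    have hGi : EqOn (box (u i)) (fun q => innerSL ℝ (b i) (G q)) halfSpace := fun p hp => by
      simp only [← hG hp]; exact box_clm (innerSL ℝ (b i)) hw hp
    have he : ‖b i‖ = 1 := b.orthonormal.1 i
    refine (sliceNorm_add_weightedNorm_le (hu2 i) hGi ht).trans ?_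
    refine mul_le_mul' le_rfl (add_le_add ?_ (lintegral_mono fun s => ?_))
    · exact eLpNorm_mono_enorm fun x =>
        enorm_gradient_inner_le he hw (mk_mem_halfSpace le_rfl x)
    · refine eLpNorm_mono_enorm fun x => ?_
      rw [enorm_le_iff_norm_le]
      exact (norm_inner_le_norm _ _).trans (by rw [he, one_mul])
  have h := slabNorm_le_mul_sum Finset.univ (f := gradient w) (g := fun i => gradient (u i)) 1
    (fun i _ => (contDiffOn_gradient (n := 1) (hu2 i)).continuousOn)
    (fun p hp => by rw [ENNReal.coe_one, one_mul]; exact enorm_gradient_le_sum b hw hp) ht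
  refine h.trans ?_
  rw [ENNReal.coe_one, one_mul]
  refine (Finset.sum_le_card_nsmul _ _ _ fun i _ => hi i).trans (le_of_eq ?_)
  simp [mul_assoc]

/-- Written over a single index set, the sum over words fits `slabNorm_le_mul_sum`. -/
lemma sumWords_eq_sum_sigma (N : ℕ) (f : List FieldIndex → ℝ≥0∞) :
    sumWords N f = ∑ x ∈ (Finset.range (N + 1)).sigma
      fun n => (Finset.univ : Finset (Fin n → FieldIndex)), f (List.ofFn x.2) := by
  rw [Finset.sum_sigma]; rfl

end Reduction

/-- The weighted space-time estimate for the wave equation, with the fields `Z` applied. -/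
theorem exists_sumWords_slabNorm_le {E : Type*} [NormedAddCommGroup E] [InnerProductSpace ℝ E]
    [FiniteDimensional ℝ E] (N : ℕ) :
    ∃ C : ℝ≥0, ∀ v G : Spacetime → E,
      ContDiffOn ℝ ((N + 2 : ℕ) : WithTop ℕ∞) v halfSpace →
      (∀ p ∈ halfSpace, box v p = G p) →
      ∀ t : ℝ, 0 ≤ t →
        sumWords N (fun α => slabNorm (wordDeriv α (gradient v)) t)
          ≤ (C : ℝ≥0∞) * sumWords N (fun α =>
                sliceNorm (gradient (wordDeriv α v)) 0)
            + (C : ℝ≥0∞) * sumWords N (fun α =>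
                ∫⁻ s in Icc (0 : ℝ) t, sliceNorm (wordDeriv α G) s) := by
  obtain ⟨C₁, hC₁⟩ := exists_enorm_wordDeriv_gradient_le (F := E) N
  refine ⟨wordCount N * (C₁ * (Module.finrank ℝ E * 256)), fun v G hv hG t ht => ?_⟩
  have hv1 : ContDiffOn ℝ (N + 1 : ℕ) v halfSpace := hv.of_le (by norm_cast; omega)
  have hw : ∀ β : List FieldIndex, β.length ≤ N →
      ContDiffOn ℝ 2 (wordDeriv β v) halfSpace :=
    fun β hβ => contDiffOn_wordDeriv β (n := 2) (hv.of_le (by norm_cast; omega))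
  have hlen : ∀ x ∈ (Finset.range (N + 1)).sigma
      fun n => (Finset.univ : Finset (Fin n → FieldIndex)), (List.ofFn x.2).length ≤ N := by
    intro x hx
    rw [List.length_ofFn]
    exact Nat.lt_succ_iff.1 (Finset.mem_range.1 (Finset.mem_sigma.1 hx).1)
  -- Each Z^β v is a C² solution with right-hand side Z^β G; this is where the N + 2 derivatives are
  -- spent.
  have hβ : ∀ β : List FieldIndex, β.length ≤ N → slabNorm (gradient (wordDeriv β v)) t
      ≤ (Module.finrank ℝ E * 256 : ℝ≥0) * (sliceNorm (gradient (wordDeriv β v)) 0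
        + ∫⁻ s in Icc (0 : ℝ) t, sliceNorm (wordDeriv β G) s) := by
    intro β hβ
    refine slabNorm_gradient_le (hw β hβ) (fun p hp => ?_) ht
    rw [box_wordDeriv β (hv.of_le (by norm_cast; omega)) hp]
    exact wordDeriv_congr hG β hp
  have hα : ∀ α : List FieldIndex, α.length ≤ N → slabNorm (wordDeriv α (gradient v)) t
      ≤ C₁ * sumWords N (fun β => slabNorm (gradient (wordDeriv β v)) t) := by
    intro α hα
    rw [sumWords_eq_sum_sigma]
    refine slabNorm_le_mul_sum _ C₁ (fun x hx =>
      (contDiffOn_gradient (n := 1) (hw _ (hlen x hx))).continuousOn) (fun p hp => ?_) ht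
    have := hC₁ α hα v hv1 p hp
    rwa [sumWords_eq_sum_sigma] at this
  refine (sumWords_le_of_forall_le hα).trans ?_
  have h := sumWords_mono hβ
  rw [sumWords_mul_add] at h
  refine (mul_le_mul' le_rfl (mul_le_mul' le_rfl h)).trans (le_of_eq ?_)
  push_cast
  ring

end KSSWave

end

theorem theorem2p3 {E : Type*} [NormedAddCommGroup E] [InnerProductSpace ℝ E]
    [FiniteDimensional ℝ E] (N : ℕ) :
    ∃ C : ℝ≥0, ∀ v G : KSSWave.Spacetime → E,
      ContDiffOn ℝ ((N + 2 : ℕ) : WithTop ℕ∞) v KSSWave.halfSpace →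
      (∀ p ∈ KSSWave.halfSpace, KSSWave.box v p = G p) →
      ∀ t : ℝ, 0 ≤ t →
        KSSWave.sumWords N (fun α =>
            KSSWave.sliceNorm (KSSWave.wordDeriv α (KSSWave.gradient v)) t
              + ENNReal.ofReal (Real.log (2 + t) ^ (-(1 / 2) : ℝ))
                * KSSWave.weightedNorm (KSSWave.wordDeriv α (KSSWave.gradient v)) t)
          ≤ (C : ℝ≥0∞) * KSSWave.sumWords N (fun α =>
                KSSWave.sliceNorm (KSSWave.gradient (KSSWave.wordDeriv α v)) 0)
            + (C : ℝ≥0∞) * KSSWave.sumWords N (fun α =>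
                ∫⁻ s in Set.Icc (0 : ℝ) t, KSSWave.sliceNorm (KSSWave.wordDeriv α G) s) :=
  KSSWave.exists_sumWords_slabNorm_le N
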